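/- **Setting.** Let $d\ge 1$ be an integer, $T>0$, let $\Omega$ be the set of continuous functions $\omega:[0,T]\to\mathbb R^d$, let $S_t(\omega)=\omega(t)$ be the coordinate process and $(\mathcal F_t)_{t\in[0,T]}$ its natural filtration. A *simple strategy* $G\in\mathcal G$ is a process $G:[0,T]\times\Omega\to\mathbb R^d$ of the form $$G_t=g_0\mathbf 1_{\{0\}}(t)+\sum_{l\ge 0} g_l\,\mathbf 1_{(\tau_l,\tau_{l+1}]}(t),$$ where $0=\tau_0\le\tau_1\le\dots$ are stopping times with values in $[0,T]\cup\{+\infty\}$ such that for each $\omega$ the sequence $(\tau_l(\omega))_l$ is constant from some index on, and each $g_l:\Omega\to\mathbb R^d$ is bounded and $\mathcal F_{\tau_l}$-measurable. Its integral process is $(G\cdot S)_t=\sum_{l\ge0} g_l\cdot(S_{\tau_{l+1}\wedge t}-S_{\tau_l\wedge t})$. For $\lambda>0$ let $\mathcal G_\lambda$ be the set of $G\in\mathcal G$ with $(G\cdot S)_t(\omega)\ge-\lambda$ for all $\omega\in\Omega$ and $t\in[0,T]$. For $A\subseteq\Omega$ let $\overline{\mathbb P}(A)$ be the infimum of all $\lambda>0$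 for which there are $G^n\in\mathcal G_\lambda$ ($n\in\mathbb N$) with $\liminf_{n}(\lambda+(G^n\cdot S)_T(\omega))\ge\mathbf 1_A(\omega)$ for all $\omega\in\Omega$; a property holds for *typical price paths* if it holds outside a set of outer measure $\overline{\mathbb P}$ zero. For a process $Z:[0,T]\times\Omega\to[0,+\infty]$ the *outer expectation* is $$\overline{\mathbb E}Z=\inf_{\tilde\Omega}\ \inf\Big\{\lambda>0:\ \exists (H^n)_{n\in\mathbb N}\subseteq\mathcal G_\lambda\ \ \forall\omega\in\tilde\Omega\ \ \forall\tau\ \ \liminf_{n\to\infty}\big(\lambda+(H^n\cdot S)_\tau(\omega)\big)\ge Z_\tau(\omega)\Big\}\in[0,+\infty],$$ where $\tilde\Omega$ ranges over the subsets of $\Omega$ with $\overline{\mathbb P}(\Omega\setminus\tilde\Omega)=0$, $\tau$ over the stopping times with $0\le\tau\le T$, and $\inf\emptyset=+\infty$. For a continuous $f:[0,T]\to\mathbb R$ the $n$th Lebesgue partition $\pi^n(f)$ is given by $\pi^n_0(f)=0$ and $\pi^n_{k+1}(f)=\inf\{t\in[\pi^n_k(f),T]:|f(t)-f(\pi^n_k(f))|=2^{-n}\}$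 (with $\inf\emptyset=+\infty$, and $\pi^n_{k+1}(f)=+\infty$ if $\pi^n_k(f)=+\infty$). For $\omega\in\Omega$ let $\pi_0^n=\pi^n_0(\omega)=0$ and let $\pi_{k+1}^n=\pi^n_{k+1}(\omega)$ be the smallest $t>\pi_k^n$ in $\bigcup_i\pi^n(\omega^i)\cup\bigcup_{i\ne j}\pi^n(\omega^i+\omega^j)$ ($+\infty$ if there is none). Put $$[S^i,S^j]_t=\lim_{n\to\infty}\sum_{k\ge 1}\big(S^i_{\pi^n_{k+1}\wedge t}-S^i_{\pi^n_k\wedge t}\big)\big(S^j_{\pi^n_{k+1}\wedge t}-S^j_{\pi^n_k\wedge t}\big),$$ which exists for all $t\in[0,T]$ for typical price paths (for other paths the value is arbitrary; this does not affect outer expectations). For $G\in\mathcal G$ let $$[(G\cdot S)]_t=\sum_{l\ge0}\sum_{i,j=1}^d g_l^i g_l^j\big([S^i,S^j]_{\tau_{l+1}\wedge t}-[S^i,S^j]_{\tau_l\wedge t}\big),$$ and let $\mathcal H$ be the set of $G\in\mathcal G$ with $\overline{\mathbb E}\sqrt{[(G\cdot S)]}<+\infty$. For $G=(G^1,\dots,G^d)$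 with $G^1,\dots,G^d\in\mathcal H$ put $(G\cdot S)=((G^1\cdot S),\dots,(G^d\cdot S))$, $\ (G\cdot S)^*_t=\sup_{s\in[0,t]}|(G\cdot S)_s|$ with the Euclidean norm on $\mathbb R^d$, and $|[(G\cdot S)]|_t=\sum_{i=1}^d[(G^i\cdot S)]_t$. **Proposition 3.2.** There is a universal constant $c_1$ with $0<c_1\le 6$ (not depending on $d$, $T$ or $G$) such that for all $d\ge1$, all $T>0$ and all $G=(G^1,\dots,G^d)$ with $G^1,\dots,G^d\in\mathcal H$, $$\overline{\mathbb E}\,(G\cdot S)^*\ \le\ c_1\,d\ \overline{\mathbb E}\sqrt{|[(G\cdot S)]|}.$$ -/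

import Mathlib

open MeasureTheory Filter
open scoped ENNReal

noncomputable section

namespace PricePathBDG

/-- The time interval `[0, T]`. For `0 < T` its least element `⊥` is `0` and its greatest
element `⊤` is `T`. -/
abbrev Time (T : ℝ) : Type := Set.Icc (0 : ℝ) T

instance factNonneg (T : ℝ) [h : Fact (0 < T)] : Fact (0 ≤ T) := ⟨h.out.le⟩

/-- The space `Ω` of continuous price paths `ω : [0, T] → ℝ^d`; the coordinate process is
`S t ω = ω t`. -/
abbrev PricePath (d : ℕ) (T : ℝ) : Type := C(Time T, EuclideanSpace ℝ (Fin d))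

/-- The σ-algebra on `Ω` generated by the coordinate process up to time `t`. -/
abbrev sigmaUpTo (d : ℕ) (T : ℝ) (t : Time T) : MeasurableSpace (PricePath d T) :=
  ⨆ s ≤ t, MeasurableSpace.comap (fun ω : PricePath d T => ω s) (borel (EuclideanSpace ℝ (Fin d)))

/-- The σ-algebra on `Ω` generated by the whole coordinate process. -/
abbrev sigmaAll (d : ℕ) (T : ℝ) : MeasurableSpace (PricePath d T) :=
  ⨆ t : Time T, sigmaUpTo d T t

/-- The natural filtration `(ℱ_t)` of the coordinate process (neither completed nor made
right-continuous). -/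
def natFiltration (d : ℕ) (T : ℝ) : Filtration (Time T) (sigmaAll d T) where
  seq := sigmaUpTo d T
  mono' _ _ hst := biSup_mono fun _ hr => hr.trans hst
  le' t := le_iSup (sigmaUpTo d T) t

/-- `σ ∧ t` for `σ ∈ [0, T] ∪ {+∞}` and `t ∈ [0, T]`. -/
def minTime {T : ℝ} (σ : WithTop (Time T)) (t : Time T) : Time T := min (σ.untopD t) t

/-- A simple strategy, given by stopping times `0 = τ₀ ≤ τ₁ ≤ …` with values in `[0, T] ∪ {+∞}`
which are, for each path, constant from some index on, and bounded, `ℱ_{τ_l}`-measurable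
positions `g l`. It represents the simple process `SimpleStrategy.process`. -/
structure SimpleStrategy (d : ℕ) (T : ℝ) [Fact (0 < T)] where
  τ : ℕ → PricePath d T → WithTop (Time T)
  g : ℕ → PricePath d T → EuclideanSpace ℝ (Fin d)
  isStoppingTime : ∀ l, IsStoppingTime (natFiltration d T) (τ l)
  τ_zero : ∀ ω, τ 0 ω = ((⊥ : Time T) : WithTop (Time T))
  τ_le_succ : ∀ l ω, τ l ω ≤ τ (l + 1) ω
  eventually_const : ∀ ω, ∃ l, ∀ m, l ≤ m → τ m ω = τ l ω
  measurable_g : ∀ l, Measurable[(isStoppingTime l).measurableSpace,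
    borel (EuclideanSpace ℝ (Fin d))] (g l)
  bounded_g : ∀ l, ∃ C : ℝ, ∀ ω, ‖g l ω‖ ≤ C

variable {d : ℕ} {T : ℝ} [Fact (0 < T)]

open Classical in
/-- The process `G_t = g₀ 1_{0}(t) + ∑_l g_l 1_{(τ_l, τ_{l+1}]}(t)`. -/
def SimpleStrategy.process (G : SimpleStrategy d T) (t : Time T) (ω : PricePath d T) :
    EuclideanSpace ℝ (Fin d) :=
  (if t = ⊥ then G.g 0 ω else 0) +
    ∑' l : ℕ, if G.τ l ω < (t : WithTop (Time T)) ∧ (t : WithTop (Time T)) ≤ G.τ (l + 1) ω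
      then G.g l ω else 0

/-- The integral process `(G·S)_t = ∑_l g_l · (S_{τ_{l+1} ∧ t} - S_{τ_l ∧ t})`; for each path
only finitely many terms are nonzero, and the value depends on `G.process` only. -/
def SimpleStrategy.integral (G : SimpleStrategy d T) (t : Time T) (ω : PricePath d T) : ℝ :=
  ∑' l : ℕ, inner ℝ (G.g l ω)
    (ω (minTime (G.τ (l + 1) ω) t) - ω (minTime (G.τ l ω) t))

/-- Strong `a`-admissibility: `(G·S)_t(ω) ≥ -a` for all `ω` and all `t`. -/
def SimpleStrategy.Admissible (G : SimpleStrategy d T) (a : ℝ) : Prop :=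
  ∀ (ω : PricePath d T) (t : Time T), -a ≤ G.integral t ω

/-- Vovk's outer measure. -/
def vovkOuterMeasure (A : Set (PricePath d T)) : ℝ≥0∞ :=
  sInf (ENNReal.ofReal '' {a : ℝ | 0 < a ∧ ∃ G : ℕ → SimpleStrategy d T,
    (∀ n, (G n).Admissible a) ∧
    ∀ ω : PricePath d T, ((A.indicator (fun _ => (1 : ℝ)) ω : ℝ) : EReal) ≤
      liminf (fun n => ((a + (G n).integral ⊤ ω : ℝ) : EReal)) atTop})

/-- Sets `A` of typical price paths: the complement of `A` is null. -/
def IsTypical (A : Set (PricePath d T)) : Prop := vovkOuterMeasure Aᶜ = 0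

/-- The outer expectation of a process `Z : [0, T] × Ω → [0, +∞]`: the superhedging price of all
values `Z_τ`, with `τ` a stopping time with values in `[0, T]`, on a set of typical price paths. -/
def outerExpectation (Z : Time T → PricePath d T → ℝ≥0∞) : ℝ≥0∞ :=
  ⨅ (A : Set (PricePath d T)) (_ : IsTypical A),
    sInf (ENNReal.ofReal '' {a : ℝ | 0 < a ∧ ∃ H : ℕ → SimpleStrategy d T,
      (∀ n, (H n).Admissible a) ∧
      ∀ ω ∈ A, ∀ τ : PricePath d T → Time T,
        IsStoppingTime (natFiltration d T) (fun ω' => (τ ω' : WithTop (Time T))) →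
        (Z (τ ω) ω : EReal) ≤
          liminf (fun n => ((a + (H n).integral (τ ω) ω : ℝ) : EReal)) atTop})

/-- The `n`th Lebesgue partition generated by a real function `f` on `[0, T]`: it starts at `0`,
and the next point is the first time at which `f` has moved by exactly `2^{-n}` from its value at
the current point (`+∞` if this never happens, or if the current point is `+∞`). -/
def lebesguePartition (f : Time T → ℝ) (n : ℕ) : ℕ → WithTop (Time T)
  | 0 => ((⊥ : Time T) : WithTop (Time T))
  | k + 1 => sInf {s : WithTop (Time T) | ∃ u t : Time T, lebesguePartition f n k = u ∧ u ≤ t ∧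
      |f t - f u| = (2 : ℝ)⁻¹ ^ n ∧ s = t}

/-- The `n`th Lebesgue partition generated by the path `ω`: the points, in increasing order, of
the Lebesgue partitions generated by the `ωⁱ` and by the `ωⁱ + ωʲ` with `i ≠ j`, and then `+∞`. -/
def pathPartition (ω : PricePath d T) (n : ℕ) : ℕ → WithTop (Time T)
  | 0 => ((⊥ : Time T) : WithTop (Time T))
  | k + 1 => sInf {s : WithTop (Time T) | pathPartition ω n k < s ∧
      ((∃ (i : Fin d) (m : ℕ), s = lebesguePartition (fun t => ω t i) n m) ∨
       (∃ (i j : Fin d) (m : ℕ), i ≠ j ∧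
          s = lebesguePartition (fun t => ω t i + ω t j) n m))}

/-- `∑_{k ≥ 1} Sⁱ_{π_k ∧ t, π_{k+1} ∧ t} Sʲ_{π_k ∧ t, π_{k+1} ∧ t}` along the `n`th Lebesgue
partition of `ω` (finitely many nonzero terms for each path). -/
def covariationApprox (n : ℕ) (i j : Fin d) (t : Time T) (ω : PricePath d T) : ℝ :=
  ∑' k : ℕ,
    (ω (minTime (pathPartition ω n (k + 2)) t) i - ω (minTime (pathPartition ω n (k + 1)) t) i) *
    (ω (minTime (pathPartition ω n (k + 2)) t) j - ω (minTime (pathPartition ω n (k + 1)) t) j)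

/-- The covariation `[Sⁱ, Sʲ]_t`, the limit of the sums along the Lebesgue partitions. The limit
exists for typical price paths; for the others the value is arbitrary, which does not matter for
outer expectations. -/
def covariation (i j : Fin d) (t : Time T) (ω : PricePath d T) : ℝ :=
  limUnder atTop (fun n => covariationApprox n i j t ω)

/-- The quadratic variation process
`[(G·S)]_t = ∑_l ∑_{i,j} g_lⁱ g_lʲ ([Sⁱ, Sʲ]_{τ_{l+1} ∧ t} - [Sⁱ, Sʲ]_{τ_l ∧ t})`. -/
def SimpleStrategy.quadVar (G : SimpleStrategy d T) (t : Time T) (ω : PricePath d T) : ℝ :=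
  ∑' l : ℕ, ∑ i : Fin d, ∑ j : Fin d, G.g l ω i * G.g l ω j *
    (covariation i j (minTime (G.τ (l + 1) ω) t) ω - covariation i j (minTime (G.τ l ω) t) ω)

/-- The family `𝓗` of simple strategies `G` for which the outer expectation of `√[(G·S)]` is
finite. -/
def SimpleStrategy.MemH (G : SimpleStrategy d T) : Prop :=
  outerExpectation (fun t ω => ENNReal.ofReal (√(G.quadVar t ω))) < ∞

/-- The running maximum `X*_t = sup_{s ≤ t} |X_s|` (Euclidean norm). -/
def runningMax {m : ℕ} (X : Time T → PricePath d T → EuclideanSpace ℝ (Fin m))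
    (t : Time T) (ω : PricePath d T) : ℝ≥0∞ :=
  ⨆ s : Time T, ⨆ _ : s ≤ t, ‖X s ω‖ₑ

/-- The `ℝ^d`-valued integral `((G¹·S), …, (Gᵈ·S))` of a matrix-valued simple process. -/
def vecIntegral (G : Fin d → SimpleStrategy d T) (t : Time T) (ω : PricePath d T) :
    EuclideanSpace ℝ (Fin d) :=
  WithLp.toLp 2 fun i => (G i).integral t ω

/-- `|[(G·S)]|_t = ∑_i [(Gⁱ·S)]_t`. -/
def vecQuadVar (G : Fin d → SimpleStrategy d T) (t : Time T) (ω : PricePath d T) : ℝ :=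
  ∑ i : Fin d, (G i).quadVar t ω

end PricePathBDG

end

/-!
The proof transports a deterministic inequality to typical paths. For a real sequence `x` with
`x 0 = 0`, quadratic variation `q` and running maximum `m`,
`m_N ≤ 6 √q_N + ∑_{k < N} 2 h_k (x_{k+1} - x_k)`, where `h_k = x_k / √(q_k + m_k²)`
(`DiscreteBDG.runMax_le`). Sampling `(Gⁱ·S)` along the common refinement of the `n`th Lebesgue
partition and the times of `Gⁱ`, the last sum becomes the gain of a strategy
(`SimpleStrategy.abs_integral_le_bdg`). So if `H n` superhedges `√|[(G·S)]|` from the capital `a`,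
then `6 d H n` together with these strategies superhedges `(G·S)^*` from a capital slightly larger
than `6 d a`; here `6 ∑ᵢ √[(Gⁱ·S)] ≤ 6 d √|[(G·S)]|`. Two points have to be settled.

*The quadratic variation along the refined partitions has to converge to `[(Gⁱ·S)]`.* For two
partitions of mesh `c`, the difference of the sums of squares in a direction `v` is an integral
whose position is of order `c`. Its square is therefore an integral plus an error of order `c²`
(`Grid.exists_gain_sq_sub_qv`). Weighted sums of such integrals over the scales `c = 2⁻ⁿ` are
bounded from below along each path, and typically gains which are bounded from below do not explode
(`vovkOuterMeasure_unbounded_gains`). So typically the sums of squares converge geometrically,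
uniformly in time, to a limit which does not depend on the partitions
(`vovkOuterMeasure_qv_not_close`). The directions `eᵢ` and `eᵢ + eⱼ` give the covariations by
polarization. The Lebesgue partitions control the mesh in exactly these directions.

*The superhedging strategies have to be admissible for all paths and at all times.* Convergence at
each time gives wealth processes which are eventually positive at each fixed time, but an individual
process may still fall below zero in between, where stopping it would spoil the hedge. Typically
this happens for finitely many `n` only (`vovkOuterMeasure_infinitely_many_drops`): otherwise one
could repeatedly buy a wealth process when it drops to zero and sell it after its recovery. Hence
stopping the wealth processes at their first zero makes them admissible, and for typical paths
changes only finitely many of them (`outerExpectation_runningMax_le`).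

The positions that arise are in general unbounded, whereas a simple strategy has bounded positions.
`Grid.exists_simpleStrategy` removes this discrepancy by repeating times of the partition.
-/

open scoped Topology

set_option linter.unusedSectionVars false

noncomputable section

namespace PricePathBDG

variable {d : ℕ} {T : ℝ} [Fact (0 < T)]

/-! ### Truncated times and first hitting times -/

theorem coe_minTime (σ : WithTop (Time T)) (t : Time T) :
    ((minTime σ t : Time T) : WithTop (Time T)) = min σ t := by
  induction σ with
  | top => simp [minTime]
  | coe s => simp [minTime]

@[simp] theorem minTime_top (t : Time T) : minTime (⊤ : WithTop (Time T)) t = t := by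
  simp [minTime]

@[simp] theorem minTime_coe (s t : Time T) : minTime (s : WithTop (Time T)) t = min s t := rfl

theorem minTime_le (σ : WithTop (Time T)) (t : Time T) : minTime σ t ≤ t := min_le_right _ _

theorem minTime_of_le {σ : WithTop (Time T)} {t : Time T} (h : (t : WithTop (Time T)) ≤ σ) :
    minTime σ t = t := by
  rw [← WithTop.coe_inj, coe_minTime, min_eq_right h]

theorem coe_minTime_of_le {σ : WithTop (Time T)} {t : Time T} (h : σ ≤ t) :
    ((minTime σ t : Time T) : WithTop (Time T)) = σ := by
  rw [coe_minTime, min_eq_left h]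

theorem minTime_minTime (σ σ' : WithTop (Time T)) (t : Time T) :
    minTime σ (minTime σ' t) = minTime (min σ σ') t := by
  rw [← WithTop.coe_inj]
  simp only [coe_minTime, min_assoc]

@[simp] theorem minTime_bot (t : Time T) : minTime ((⊥ : Time T) : WithTop (Time T)) t = ⊥ := by
  rw [minTime_coe, min_eq_left bot_le]

/-- The first time `t ≥ ρ` at which `y` is nonnegative, `+∞` if there is none. -/
def hitAfter (ρ : WithTop (Time T)) (y : Time T → ℝ) : WithTop (Time T) :=
  sInf {s | ∃ t : Time T, s = t ∧ ρ ≤ t ∧ 0 ≤ y t}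

theorem le_hitAfter (ρ : WithTop (Time T)) (y : Time T → ℝ) : ρ ≤ hitAfter ρ y := by
  refine le_sInf ?_
  rintro s ⟨t, rfl, h, -⟩
  exact h

theorem hitAfter_le {ρ : WithTop (Time T)} {y : Time T → ℝ} {t : Time T} (h : ρ ≤ t)
    (hy : 0 ≤ y t) : hitAfter ρ y ≤ t := sInf_le ⟨t, rfl, h, hy⟩

theorem exists_coe_eq_of_ne_top {σ : WithTop (Time T)} (h : σ ≠ ⊤) : ∃ t : Time T, σ = t :=
  ⟨σ.untop h, by simp⟩

theorem nonneg_of_hitAfter_eq {ρ : WithTop (Time T)} {y : Time T → ℝ} (hy : Continuous y)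
    {t : Time T} (h : hitAfter ρ y = t) : 0 ≤ y t := by
  by_contra! hneg
  have ho : IsOpen {s | y s < 0} := isOpen_lt hy continuous_const
  have hρ : ρ ≤ t := h ▸ le_hitAfter ρ y
  -- otherwise `y` is negative on a right neighbourhood of `t`
  by_cases htop : t = ⊤
  · have : hitAfter ρ y = ⊤ := by
      refine top_le_iff.1 (le_sInf ?_)
      rintro s ⟨u, rfl, h1, h2⟩
      have h3 : hitAfter ρ y ≤ u := hitAfter_le h1 h2
      rw [h] at h3
      have : u = t := le_antisymm (htop ▸ le_top) (WithTop.coe_le_coe.1 h3)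
      subst this
      linarith
    rw [this] at h
    exact WithTop.top_ne_coe h
  · have hlt : t < ⊤ := lt_top_iff_ne_top.2 htop
    obtain ⟨u, htu, hu⟩ := exists_Ico_subset_of_mem_nhds (ho.mem_nhds hneg) ⟨⊤, hlt⟩
    have : (u : WithTop (Time T)) ≤ hitAfter ρ y := by
      refine le_sInf ?_
      rintro s ⟨v, rfl, h1, h2⟩
      by_contra! hv
      have hv' : v < u := WithTop.coe_lt_coe.1 hv
      have h3 : hitAfter ρ y ≤ v := hitAfter_le h1 h2
      rw [h] at h3
      have := hu ⟨WithTop.coe_le_coe.1 h3, hv'⟩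
      simp only [Set.mem_ofPred_eq] at this
      linarith
    rw [h] at this
    exact absurd (WithTop.coe_le_coe.1 this) (not_le.2 htu)

theorem hitAfter_le_iff {ρ : WithTop (Time T)} {y : Time T → ℝ} (hy : Continuous y)
    {t : Time T} : hitAfter ρ y ≤ t ↔ ∃ s ≤ t, ρ ≤ s ∧ 0 ≤ y s := by
  constructor
  · intro h
    obtain ⟨s, hs⟩ := exists_coe_eq_of_ne_top (ne_top_of_le_ne_top WithTop.coe_ne_top h)
    exact ⟨s, WithTop.coe_le_coe.1 (hs ▸ h), hs ▸ le_hitAfter ρ y, nonneg_of_hitAfter_eq hy hs⟩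
  · rintro ⟨s, hst, h1, h2⟩
    exact (hitAfter_le h1 h2).trans (WithTop.coe_le_coe.2 hst)

/-- A continuous function which is negative at the start is nonpositive up to its first zero. -/
theorem hitAfter_nonpos {y : Time T → ℝ} (hy : Continuous y) (h0 : y ⊥ < 0) (t : Time T) :
    y (minTime (hitAfter ((⊥ : Time T) : WithTop (Time T)) y) t) ≤ 0 := by
  set s := minTime (hitAfter ((⊥ : Time T) : WithTop (Time T)) y) t with hs
  by_contra! hpos
  obtain ⟨u, hu, hyu⟩ := intermediate_value_Icc (bot_le : (⊥ : Time T) ≤ s) hy.continuousOn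
    (show (0 : ℝ) ∈ Set.Icc (y ⊥) (y s) from ⟨h0.le, hpos.le⟩)
  have h1 : hitAfter ((⊥ : Time T) : WithTop (Time T)) y ≤ u := hitAfter_le (by simp) hyu.ge
  have h2 : s ≤ u := by
    rw [← WithTop.coe_le_coe, hs, coe_minTime]
    exact (min_le_left _ _).trans h1
  have : u = s := le_antisymm hu.2 h2
  rw [this] at hyu
  linarith

/-! ### Continuous adapted processes -/

/-- A real process with continuous paths that is adapted to the natural filtration. -/
structure IsContAdapted (Y : Time T → PricePath d T → ℝ) : Prop where
  measurable : ∀ t, Measurable[natFiltration d T t] (Y t)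
  continuous : ∀ ω, Continuous fun t => Y t ω

theorem measurable_eval (t : Time T) :
    Measurable[natFiltration d T t] fun ω : PricePath d T => ω t := by
  have h : Measurable[MeasurableSpace.comap (fun ω : PricePath d T => ω t)
      (borel (EuclideanSpace ℝ (Fin d))), borel (EuclideanSpace ℝ (Fin d))]
      fun ω : PricePath d T => ω t := Measurable.of_comap_le le_rfl
  rw [← BorelSpace.measurable_eq (α := EuclideanSpace ℝ (Fin d))] at h
  exact h.mono (by
    rw [BorelSpace.measurable_eq (α := EuclideanSpace ℝ (Fin d))]
    exact le_iSup₂_of_le (f := fun (s : Time T) (_ : s ≤ t) =>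
      MeasurableSpace.comap (fun ω : PricePath d T => ω s)
        (borel (EuclideanSpace ℝ (Fin d)))) t le_rfl le_rfl) le_rfl

namespace IsContAdapted

variable {Y Z : Time T → PricePath d T → ℝ}

theorem stronglyAdapted (hY : IsContAdapted Y) : StronglyAdapted (natFiltration d T) Y :=
  fun t => (hY.measurable t).stronglyMeasurable

theorem isStronglyProgressive (hY : IsContAdapted Y) :
    IsStronglyProgressive (natFiltration d T) Y :=
  hY.stronglyAdapted.isStronglyProgressive_of_continuous hY.continuous

theorem const (c : ℝ) : IsContAdapted (d := d) (T := T) fun _ _ => c :=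
  ⟨fun _ => measurable_const, fun _ => continuous_const⟩

theorem add (hY : IsContAdapted Y) (hZ : IsContAdapted Z) :
    IsContAdapted fun t ω => Y t ω + Z t ω :=
  ⟨fun t => (hY.measurable t).add (hZ.measurable t),
    fun ω => (hY.continuous ω).add (hZ.continuous ω)⟩

theorem sub (hY : IsContAdapted Y) (hZ : IsContAdapted Z) :
    IsContAdapted fun t ω => Y t ω - Z t ω :=
  ⟨fun t => (hY.measurable t).sub (hZ.measurable t),
    fun ω => (hY.continuous ω).sub (hZ.continuous ω)⟩

theorem neg (hY : IsContAdapted Y) : IsContAdapted fun t ω => - Y t ω :=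
  ⟨fun t => (hY.measurable t).neg, fun ω => (hY.continuous ω).neg⟩

theorem max (hY : IsContAdapted Y) (hZ : IsContAdapted Z) :
    IsContAdapted fun t ω => Max.max (Y t ω) (Z t ω) :=
  ⟨fun t => (hY.measurable t).max (hZ.measurable t),
    fun ω => (hY.continuous ω).max (hZ.continuous ω)⟩

theorem abs (hY : IsContAdapted Y) : IsContAdapted fun t ω => |Y t ω| :=
  hY.max hY.neg

theorem inner_eval (v : EuclideanSpace ℝ (Fin d)) :
    IsContAdapted (T := T) fun t ω => inner ℝ v (ω t) :=
  ⟨fun t => measurable_const.inner (measurable_eval t),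
    fun ω => continuous_const.inner ω.continuous⟩

theorem continuous_minTime (σ : WithTop (Time T)) : Continuous (minTime σ) := by
  unfold minTime
  induction σ with
  | top =>
    simp only [WithTop.untopD_top, min_self]
    exact continuous_id
  | coe s => simpa using continuous_const.min continuous_id

theorem stopped (hY : IsContAdapted Y) {τ : PricePath d T → WithTop (Time T)}
    (hτ : IsStoppingTime (natFiltration d T) τ) :
    IsContAdapted fun t ω => Y (minTime (τ ω) t) ω := by
  refine ⟨fun t => ?_, fun ω => (hY.continuous ω).comp (continuous_minTime _)⟩
  have h := (hY.stronglyAdapted.stoppedProcess hY.continuous hτ t).measurable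
  convert h using 2 with ω
  simp only [stoppedProcess]
  congr 1
  rw [min_comm, ← coe_minTime]
  simp

/-- The value of a continuous adapted process at a stopping time (at time `T`, if the stopping
time is infinite) is measurable with respect to the σ-algebra of the stopping time. -/
theorem measurable_stopped (hY : IsContAdapted Y) {τ : PricePath d T → WithTop (Time T)}
    (hτ : IsStoppingTime (natFiltration d T) τ) :
    Measurable[hτ.measurableSpace] fun ω => Y (minTime (τ ω) ⊤) ω := by
  have hτ' := hτ.min_const (⊤ : Time T)
  have h := measurable_stoppedValue hY.isStronglyProgressive hτ'
  have h2 := h.mono (hτ'.measurableSpace_mono hτ fun ω => min_le_left _ _) le_rfl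
  convert h2 using 2 with ω
  simp only [stoppedValue]
  congr 1
  rw [← coe_minTime]
  simp

end IsContAdapted

/-- The first hitting time of a closed half-line by a continuous adapted process is a stopping time,
although the filtration is not right-continuous: by compactness the half-line has been hit by time
`t` if and only if it has been approached arbitrarily closely at countably many times up to `t`. -/
theorem isStoppingTime_hitAfter {Y : Time T → PricePath d T → ℝ} (hY : IsContAdapted Y)
    {ρ : PricePath d T → WithTop (Time T)} (hρ : IsStoppingTime (natFiltration d T) ρ) :
    IsStoppingTime (natFiltration d T) fun ω => hitAfter (ρ ω) fun t => Y t ω := by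
  intro t
  obtain ⟨D, hDc, hDd⟩ := TopologicalSpace.exists_countable_dense (Time T)
  -- the value of `Y` at `(q ∨ ρ) ∧ t`
  let Z : Time T → PricePath d T → ℝ := fun q ω => Y (min (max q (minTime (ρ ω) t)) t) ω
  have hZc : ∀ ω, Continuous fun q => Z q ω := fun ω =>
    (hY.continuous ω).comp ((continuous_id.max continuous_const).min continuous_const)
  have hZ : ∀ q, Measurable[natFiltration d T t] (Z q) := by
    intro q
    have hst : IsStoppingTime (natFiltration d T)
        fun ω => max ((q : Time T) : WithTop (Time T)) (ρ ω) := (isStoppingTime_const _ q).max hρ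
    have := (hY.stopped hst).measurable t
    convert this using 3 with ω
    rw [← WithTop.coe_inj, coe_minTime, WithTop.coe_min, WithTop.coe_max, coe_minTime]
    rcases le_total (ρ ω) t with h | h
    · rw [min_eq_left h]
    · rw [min_eq_right h, min_eq_right (le_max_right _ _),
        min_eq_right (h.trans (le_max_right _ _))]
  have heq : {ω | hitAfter (ρ ω) (fun t => Y t ω) ≤ t} =
      {ω | ρ ω ≤ t} ∩ ⋂ n : ℕ, ⋃ q ∈ D, {ω | -(1 / ((n : ℝ) + 1)) < Z q ω} := by
    ext ω
    simp only [Set.mem_ofPred_eq, Set.mem_inter_iff, Set.mem_iInter, Set.mem_iUnion]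
    rw [hitAfter_le_iff (hY.continuous ω)]
    constructor
    · rintro ⟨s, hst, hρs, hs⟩
      have hρt : ρ ω ≤ t := hρs.trans (WithTop.coe_le_coe.2 hst)
      refine ⟨hρt, fun n => ?_⟩
      have ho : IsOpen {q | -(1 / ((n : ℝ) + 1)) < Z q ω} := isOpen_lt continuous_const (hZc ω)
      have hs' : s ∈ {q | -(1 / ((n : ℝ) + 1)) < Z q ω} := by
        have h1 : minTime (ρ ω) t ≤ s := by
          rw [← WithTop.coe_le_coe, coe_minTime_of_le hρt]
          exact hρs
        have h2 : Z s ω = Y s ω := by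
          simp only [Z]
          rw [max_eq_left h1, min_eq_left hst]
        have h3 : (0 : ℝ) < 1 / ((n : ℝ) + 1) := by positivity
        simp only [Set.mem_ofPred_eq, h2]
        linarith
      obtain ⟨q, hq, hqD⟩ := hDd.inter_open_nonempty _ ho ⟨s, hs'⟩
      exact ⟨q, hqD, hq⟩
    · rintro ⟨hρt, h⟩
      obtain ⟨q, -, hq⟩ := isCompact_univ.exists_isMaxOn (Set.univ_nonempty (α := Time T))
        (hZc ω).continuousOn
      have hq0 : 0 ≤ Z q ω := by
        refine le_of_forall_pos_le_add fun ε hε => ?_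
        obtain ⟨n, hn⟩ := exists_nat_one_div_lt hε
        obtain ⟨p, -, hp⟩ := h n
        have : Z p ω ≤ Z q ω := hq (Set.mem_univ p)
        linarith
      refine ⟨_, min_le_right _ _, ?_, hq0⟩
      rw [WithTop.coe_min, WithTop.coe_max, coe_minTime_of_le hρt]
      exact le_min (le_max_right _ _) hρt
  rw [heq]
  refine (hρ t).inter (MeasurableSet.iInter fun n => MeasurableSet.biUnion hDc fun q _ => ?_)
  exact measurableSet_lt measurable_const (hZ q)

/-! ### Sums of increments along sequences of times -/

/-- The increment of the path `ω` over the `k`th interval of the sequence `τ`, up to time `t`. -/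
def incr (τ : ℕ → WithTop (Time T)) (ω : PricePath d T) (k : ℕ) (t : Time T) :
    EuclideanSpace ℝ (Fin d) :=
  ω (minTime (τ (k + 1)) t) - ω (minTime (τ k) t)

/-- No interval of the sequence `ρ` contains `a` in its interior. -/
def NoCross (ρ : ℕ → WithTop (Time T)) (a : WithTop (Time T)) : Prop :=
  ∀ k, ρ k < a → ρ (k + 1) ≤ a

theorem incr_eq_zero {τ : ℕ → WithTop (Time T)} {k : ℕ} (h : τ (k + 1) = τ k)
    (ω : PricePath d T) (t : Time T) : incr τ ω k t = 0 := by
  simp [incr, h]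

theorem incr_eq_zero_of_le {τ : ℕ → WithTop (Time T)} (hτ : Monotone τ) {k : ℕ} {t : Time T}
    (h : (t : WithTop (Time T)) ≤ τ k) (ω : PricePath d T) : incr τ ω k t = 0 := by
  rw [incr, minTime_of_le h, minTime_of_le (h.trans (hτ k.le_succ)), sub_self]

theorem sum_incr (τ : ℕ → WithTop (Time T)) (ω : PricePath d T) (t : Time T) (K : ℕ) :
    ∑ k ∈ Finset.range K, incr τ ω k t = ω (minTime (τ K) t) - ω (minTime (τ 0) t) :=
  Finset.sum_range_sub (fun k => ω (minTime (τ k) t)) K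

theorem eq_top_of_le {τ : ℕ → WithTop (Time T)} (hτ : Monotone τ) {K k : ℕ} (hK : τ K = ⊤)
    (hk : K ≤ k) : τ k = ⊤ := top_le_iff.1 (hK ▸ hτ hk)

/-- Sums over the intervals of a sequence of times that is constant from the index `K` on are
finite. -/
theorem tsum_incr {M : Type*} [AddCommMonoid M] [TopologicalSpace M]
    {τ : ℕ → WithTop (Time T)} {K : ℕ} (hK : ∀ k, K ≤ k → τ k = τ K)
    (F : ℕ → EuclideanSpace ℝ (Fin d) → M) (hF : ∀ k, F k 0 = 0) (ω : PricePath d T)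
    (t : Time T) :
    ∑' k, F k (incr τ ω k t) = ∑ k ∈ Finset.range K, F k (incr τ ω k t) := by
  refine tsum_eq_sum fun k hk => ?_
  have hk' : K ≤ k := by simpa using hk
  rw [incr_eq_zero (by rw [hK k hk', hK (k + 1) (by omega)]), hF]

theorem incr_minTime {ρ : ℕ → WithTop (Time T)} (hρ : Monotone ρ) {a : WithTop (Time T)}
    (ha : NoCross ρ a) (ω : PricePath d T) (k : ℕ) (t : Time T) :
    incr ρ ω k (minTime a t) = if ρ k < a then incr ρ ω k t else 0 := by
  simp only [incr, minTime_minTime]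
  split_ifs with h
  · rw [min_eq_left (ha k h), min_eq_left h.le]
  · rw [not_lt] at h
    rw [min_eq_right h, min_eq_right (h.trans (hρ k.le_succ)), sub_self]

theorem incr_eq_sum_incr {ρ : ℕ → WithTop (Time T)} (hρ : Monotone ρ)
    {K : ℕ} (hK : ρ K = ⊤) {a b : WithTop (Time T)} (ha : NoCross ρ a) (hb : NoCross ρ b)
    (h0 : ρ 0 ≤ a) (hab : a ≤ b) (ω : PricePath d T) (t : Time T) :
    ω (minTime b t) - ω (minTime a t) =
      ∑ k ∈ Finset.range K, if a ≤ ρ k ∧ ρ k < b then incr ρ ω k t else 0 := by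
  have key : ∀ c, NoCross ρ c → ρ 0 ≤ c → ω (minTime c t) - ω (minTime (ρ 0) t) =
      ∑ k ∈ Finset.range K, if ρ k < c then incr ρ ω k t else 0 := by
    intro c hc h0c
    have h := sum_incr ρ ω (minTime c t) K
    rw [hK, minTime_top, minTime_minTime, min_eq_left h0c] at h
    rw [← h]
    exact Finset.sum_congr rfl fun k _ => incr_minTime hρ hc ω k t
  have : ω (minTime b t) - ω (minTime a t) = (ω (minTime b t) - ω (minTime (ρ 0) t)) -
      (ω (minTime a t) - ω (minTime (ρ 0) t)) := by abel
  rw [this, key a ha h0, key b hb (h0.trans hab), ← Finset.sum_sub_distrib]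
  refine Finset.sum_congr rfl fun k _ => ?_
  by_cases h3 : ρ k < a
  · simp [h3, h3.trans_le hab, not_le.2 h3]
  · simp [h3, not_lt.1 h3]

open Classical in
/-- The position at time `ρ k` of the strategy that holds `p l` on the interval `(τ l, τ (l+1)]`. -/
def pull {M : Type*} [AddCommMonoid M] [TopologicalSpace M] (τ : ℕ → WithTop (Time T)) (p : ℕ → M)
    (ρ : ℕ → WithTop (Time T)) (k : ℕ) : M :=
  ∑' l, if τ l ≤ ρ k ∧ ρ k < τ (l + 1) then p l else 0

section pull

variable {M : Type*} [AddCommMonoid M] [TopologicalSpace M]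

theorem pull_eq_sum {τ : ℕ → WithTop (Time T)} {L : ℕ} (hL : ∀ l, L ≤ l → τ l = τ L) (p : ℕ → M)
    (ρ : ℕ → WithTop (Time T)) (k : ℕ) :
    pull τ p ρ k =
      ∑ l ∈ Finset.range L, if τ l ≤ ρ k ∧ ρ k < τ (l + 1) then p l else 0 := by
  classical
  unfold pull
  refine (tsum_eq_sum (s := Finset.range L) fun l hl => ?_).trans ?_
  · have hl' : L ≤ l := by simpa using hl
    rw [hL l hl', hL (l + 1) (by omega), if_neg]
    rintro ⟨h1, h2⟩
    exact absurd h1 (not_le.2 h2)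
  · exact Finset.sum_congr rfl fun l _ => by congr

theorem pull_eq_of_mem {τ : ℕ → WithTop (Time T)} (hτ : Monotone τ) (p : ℕ → M)
    {ρ : ℕ → WithTop (Time T)} {k l : ℕ} (h : τ l ≤ ρ k ∧ ρ k < τ (l + 1)) :
    pull τ p ρ k = p l := by
  classical
  unfold pull
  rw [tsum_eq_single l, if_pos h]
  intro m hm
  rw [if_neg]
  rintro ⟨h1, h2⟩
  rcases lt_or_gt_of_ne hm with h3 | h3
  · exact absurd (h2.trans_le ((hτ h3).trans h.1)) (lt_irrefl _)
  · exact absurd (h.2.trans_le ((hτ h3).trans h1)) (lt_irrefl _)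

theorem pull_eq_zero {τ : ℕ → WithTop (Time T)} (p : ℕ → M)
    {ρ : ℕ → WithTop (Time T)} {k : ℕ} (h : ∀ l, ¬ (τ l ≤ ρ k ∧ ρ k < τ (l + 1))) :
    pull τ p ρ k = 0 := by
  classical
  unfold pull
  rw [tsum_congr (fun l => if_neg (h l)), tsum_zero]

/-- At most one interval of `τ` contains `ρ k`, hence `pull` commutes with every map that sends
`0` to `0`. -/
theorem map_pull {N : Type*} [AddCommMonoid N] [TopologicalSpace N]
    {τ : ℕ → WithTop (Time T)} (hτ : Monotone τ) (p : ℕ → M) (ρ : ℕ → WithTop (Time T)) (k : ℕ)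
    (Φ : M → N) (hΦ : Φ 0 = 0) : Φ (pull τ p ρ k) = pull τ (fun l => Φ (p l)) ρ k := by
  by_cases h : ∃ l, τ l ≤ ρ k ∧ ρ k < τ (l + 1)
  · obtain ⟨l, hl⟩ := h
    rw [pull_eq_of_mem hτ p hl, pull_eq_of_mem hτ _ hl]
  · rw [not_exists] at h
    rw [pull_eq_zero p h, pull_eq_zero _ h, hΦ]

end pull

theorem exists_mem_interval {τ : ℕ → WithTop (Time T)} (h0 : τ 0 = ((⊥ : Time T) : WithTop _))
    {K : ℕ} (hK : τ K = ⊤) {a : WithTop (Time T)} (ha : a < ⊤) :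
    ∃ l, τ l ≤ a ∧ a < τ (l + 1) := by
  classical
  have hex : ∃ n, a < τ n := ⟨K, by rwa [hK]⟩
  have hpos : Nat.find hex ≠ 0 := by
    intro h
    have := Nat.find_spec hex
    rw [h, h0] at this
    exact absurd this (not_lt.2 (by simp))
  obtain ⟨l, hl⟩ := Nat.exists_eq_succ_of_ne_zero hpos
  refine ⟨l, not_lt.1 (Nat.find_min hex (m := l) (by omega)), ?_⟩
  have := Nat.find_spec hex
  rwa [hl] at this

/-- A sum of linear functionals of increments may be computed along a finer sequence of times. -/
theorem sum_inner_incr_eq_pull {τ ρ : ℕ → WithTop (Time T)} (hτ : Monotone τ) (hρ : Monotone ρ)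
    (hρ0 : ρ 0 = ((⊥ : Time T) : WithTop (Time T))) {L K : ℕ} (hL : ∀ l, L ≤ l → τ l = τ L)
    (hK : ρ K = ⊤) (href : ∀ l, NoCross ρ (τ l)) (p : ℕ → EuclideanSpace ℝ (Fin d))
    (ω : PricePath d T) (t : Time T) :
    ∑ l ∈ Finset.range L, inner ℝ (p l) (incr τ ω l t) =
      ∑ k ∈ Finset.range K, inner ℝ (pull τ p ρ k) (incr ρ ω k t) := by
  have h1 : ∀ l, incr τ ω l t = ∑ k ∈ Finset.range K,
      if τ l ≤ ρ k ∧ ρ k < τ (l + 1) then incr ρ ω k t else 0 := fun l =>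
    incr_eq_sum_incr hρ hK (href l) (href (l + 1)) (by simp [hρ0]) (hτ l.le_succ) ω t
  simp_rw [h1, pull_eq_sum hL, inner_sum, sum_inner]
  rw [Finset.sum_comm]
  refine Finset.sum_congr rfl fun k _ => Finset.sum_congr rfl fun l _ => ?_
  split_ifs <;> simp

/-- The increments of a sum over the intervals of `ρ` between two times which are not in the
interior of an interval of `ρ`. -/
theorem sum_map_incr_sub {ρ : ℕ → WithTop (Time T)} (hρ : Monotone ρ) (K : ℕ)
    {a b : WithTop (Time T)} (ha : NoCross ρ a) (hb : NoCross ρ b) (hab : a ≤ b)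
    (F : EuclideanSpace ℝ (Fin d) → ℝ) (hF : F 0 = 0) (ω : PricePath d T) (t : Time T) :
    ∑ k ∈ Finset.range K, F (incr ρ ω k (minTime b t)) -
        ∑ k ∈ Finset.range K, F (incr ρ ω k (minTime a t)) =
      ∑ k ∈ Finset.range K, if a ≤ ρ k ∧ ρ k < b then F (incr ρ ω k t) else 0 := by
  rw [← Finset.sum_sub_distrib]
  refine Finset.sum_congr rfl fun k _ => ?_
  rw [incr_minTime hρ ha, incr_minTime hρ hb]
  by_cases h3 : ρ k < a
  · simp [h3, h3.trans_le hab, not_le.2 h3]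
  · by_cases h4 : ρ k < b <;> simp [h3, h4, not_lt.1 h3, hF]

/-! ### The strict enumeration of a set of times -/

/-- The elements of `A ∪ {0}` in increasing order, and then `+∞`. -/
def enum (A : Set (WithTop (Time T))) : ℕ → WithTop (Time T)
  | 0 => ((⊥ : Time T) : WithTop (Time T))
  | k + 1 => sInf {s | enum A k < s ∧ s ∈ A}

variable {A : Set (WithTop (Time T))}

theorem enum_le_succ (k : ℕ) : enum A k ≤ enum A (k + 1) := le_sInf fun _ hs => hs.1.le

theorem noCross_enum {a : WithTop (Time T)} (ha : a ∈ A) : NoCross (enum A) a :=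
  fun _ hk => sInf_le ⟨hk, ha⟩

theorem enum_succ_mem (hA : A.Finite) {k : ℕ} (h : enum A (k + 1) ≠ ⊤) :
    enum A k < enum A (k + 1) ∧ enum A (k + 1) ∈ A := by
  have hne : {s | enum A k < s ∧ s ∈ A}.Nonempty := by
    by_contra hne
    rw [Set.not_nonempty_iff_eq_empty] at hne
    exact h (by rw [enum, hne, sInf_empty])
  exact hne.csInf_mem (hA.subset fun s hs => hs.2)

theorem exists_enum_eq_top (hA : A.Finite) : ∃ K, enum A K = ⊤ := by
  by_contra! h
  have hmono : StrictMono fun k => enum A (k + 1) :=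
    strictMono_nat_of_lt_succ fun k => (enum_succ_mem hA (h (k + 2))).1
  exact Set.infinite_of_injective_forall_mem hmono.injective
    (fun k => (enum_succ_mem hA (h (k + 1))).2) hA

theorem enum_succ_le_iff (hA : A.Finite) {k : ℕ} {t : Time T} :
    enum A (k + 1) ≤ t ↔ ∃ s ∈ A, enum A k < s ∧ s ≤ t := by
  constructor
  · intro h
    have := enum_succ_mem hA (ne_top_of_le_ne_top WithTop.coe_ne_top h)
    exact ⟨_, this.2, this.1, h⟩
  · rintro ⟨s, hs, h1, h2⟩
    have : s ∈ {s | enum A k < s ∧ s ∈ A} := ⟨h1, hs⟩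
    exact (sInf_le this).trans h2

/-! ### Random partitions -/

/-- A random partition of `[0, T]`: stopping times `0 = τ₀ ≤ τ₁ ≤ …` that are `+∞` from some
index on, for each path. -/
structure Grid (d : ℕ) (T : ℝ) [Fact (0 < T)] where
  τ : ℕ → PricePath d T → WithTop (Time T)
  isStoppingTime : ∀ k, IsStoppingTime (natFiltration d T) (τ k)
  τ_zero : ∀ ω, τ 0 ω = ((⊥ : Time T) : WithTop (Time T))
  τ_le_succ : ∀ k ω, τ k ω ≤ τ (k + 1) ω
  eventually_top : ∀ ω, ∃ K, τ K ω = ⊤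

namespace Grid

/-- The times of the partition along the path `ω`. -/
def times (R : Grid d T) (ω : PricePath d T) (k : ℕ) : WithTop (Time T) := R.τ k ω

theorem monotone (R : Grid d T) (ω : PricePath d T) : Monotone (R.times ω) :=
  monotone_nat_of_le_succ fun k => R.τ_le_succ k ω

theorem times_zero (R : Grid d T) (ω : PricePath d T) :
    R.times ω 0 = ((⊥ : Time T) : WithTop (Time T)) := R.τ_zero ω

theorem exists_top (R : Grid d T) (ω : PricePath d T) : ∃ K, R.times ω K = ⊤ := R.eventually_top ω

/-- `p` is a sequence of positions which may be taken up at the times of `R`. Unlike in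
`SimpleStrategy`, the positions may be unbounded. -/
def IsPosition (R : Grid d T) (p : ℕ → PricePath d T → EuclideanSpace ℝ (Fin d)) : Prop :=
  ∀ k, Measurable[(R.isStoppingTime k).measurableSpace] (p k)

/-- The integral process of the strategy that holds `p k` on `(τ k, τ (k + 1)]`. -/
def integral (R : Grid d T) (p : ℕ → PricePath d T → EuclideanSpace ℝ (Fin d)) (t : Time T)
    (ω : PricePath d T) : ℝ :=
  ∑' k, inner ℝ (p k ω) (incr (R.times ω) ω k t)

theorem const_of_top {τ : ℕ → WithTop (Time T)} (hτ : Monotone τ) {K : ℕ} (hK : τ K = ⊤) :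
    ∀ k, K ≤ k → τ k = τ K := fun _ hk => by rw [hK, eq_top_of_le hτ hK hk]

theorem tsum_eq_sum (R : Grid d T) {M : Type*} [AddCommMonoid M] [TopologicalSpace M]
    {ω : PricePath d T} {K : ℕ} (hK : R.times ω K = ⊤)
    (F : ℕ → EuclideanSpace ℝ (Fin d) → M) (hF : ∀ k, F k 0 = 0) (t : Time T) :
    ∑' k, F k (incr (R.times ω) ω k t) = ∑ k ∈ Finset.range K, F k (incr (R.times ω) ω k t) :=
  tsum_incr (const_of_top (R.monotone ω) hK) F hF ω t

theorem integral_eq_sum (R : Grid d T) (p : ℕ → PricePath d T → EuclideanSpace ℝ (Fin d))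
    {ω : PricePath d T} {K : ℕ} (hK : R.times ω K = ⊤) (t : Time T) :
    R.integral p t ω = ∑ k ∈ Finset.range K, inner ℝ (p k ω) (incr (R.times ω) ω k t) :=
  R.tsum_eq_sum hK (fun k x => inner ℝ (p k ω) x) (by simp) t

/-- The partition enumerating a countable family of stopping times which has a finite range for
each path. -/
def ofFamily {ι : Type*} [Countable ι] (σ : ι → PricePath d T → WithTop (Time T))
    (hσ : ∀ i, IsStoppingTime (natFiltration d T) (σ i))
    (hfin : ∀ ω, (Set.range fun i => σ i ω).Finite) : Grid d T where
  τ k ω := enum (Set.range fun i => σ i ω) k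
  isStoppingTime k := by
    induction k with
    | zero => exact isStoppingTime_const _ _
    | succ k ih =>
      intro t
      have : {ω | enum (Set.range fun i => σ i ω) (k + 1) ≤ t} =
          ⋃ i, {ω | σ i ω ≤ enum (Set.range fun i => σ i ω) k}ᶜ ∩ {ω | σ i ω ≤ t} := by
        ext ω
        simp only [Set.mem_ofPred_eq, enum_succ_le_iff (hfin ω), Set.mem_iUnion, Set.mem_inter_iff,
          Set.mem_compl_iff, not_le, Set.exists_range_iff]
      rw [this]
      exact MeasurableSet.iUnion fun i =>
        ((IsStoppingTime.measurableSet_le_stopping_time (hσ i) ih).compl).2 t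
  τ_zero _ := rfl
  τ_le_succ k _ := enum_le_succ k
  eventually_top ω := exists_enum_eq_top (hfin ω)

theorem noCross_ofFamily {ι : Type*} [Countable ι] (σ : ι → PricePath d T → WithTop (Time T))
    (hσ : ∀ i, IsStoppingTime (natFiltration d T) (σ i))
    (hfin : ∀ ω, (Set.range fun i => σ i ω).Finite) (i : ι) (ω : PricePath d T) :
    NoCross ((ofFamily σ hσ hfin).times ω) (σ i ω) :=
  noCross_enum (A := Set.range fun i => σ i ω) (Set.mem_range_self i)

end Grid

/-- A stopping time can be evaluated at a random index that is known at the chosen time. -/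
theorem isStoppingTime_index {τ : ℕ → PricePath d T → WithTop (Time T)}
    (hτ : ∀ k, IsStoppingTime (natFiltration d T) (τ k)) (N : PricePath d T → ℕ)
    (hN : ∀ k, MeasurableSet[(hτ k).measurableSpace] {ω | N ω = k}) :
    IsStoppingTime (natFiltration d T) fun ω => τ (N ω) ω := by
  intro t
  have : {ω | τ (N ω) ω ≤ t} = ⋃ k, {ω | N ω = k} ∩ {ω | τ k ω ≤ t} := by
    ext ω
    simp
  rw [this]
  exact MeasurableSet.iUnion fun k => (hN k).2 t

theorem measurable_index {τ : ℕ → PricePath d T → WithTop (Time T)}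
    (hτ : ∀ k, IsStoppingTime (natFiltration d T) (τ k)) (N : PricePath d T → ℕ)
    (hN : ∀ k, MeasurableSet[(hτ k).measurableSpace] {ω | N ω = k})
    {E : Type*} [MeasurableSpace E] (x : ℕ → PricePath d T → E)
    (hx : ∀ k, Measurable[(hτ k).measurableSpace] (x k)) :
    Measurable[(isStoppingTime_index hτ N hN).measurableSpace] fun ω => x (N ω) ω := by
  intro B hB
  have h1 : ∀ k, MeasurableSet[(hτ k).measurableSpace] ({ω | N ω = k} ∩ x k ⁻¹' B) := fun k =>
    MeasurableSet.inter (hN k) (hx k hB)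
  refine ⟨?_, fun t => ?_⟩
  · have : (fun ω => x (N ω) ω) ⁻¹' B = ⋃ k, {ω | N ω = k} ∩ x k ⁻¹' B := by
      ext ω
      simp
    rw [this]
    exact MeasurableSet.iUnion fun k => (h1 k).1
  · have : (fun ω => x (N ω) ω) ⁻¹' B ∩ {ω | τ (N ω) ω ≤ t} =
        ⋃ k, ({ω | N ω = k} ∩ x k ⁻¹' B) ∩ {ω | τ k ω ≤ t} := by
      ext ω
      simp [and_assoc]
    rw [this]
    exact MeasurableSet.iUnion fun k => (h1 k).2 t

namespace Grid

variable (R : Grid d T) (p : ℕ → PricePath d T → EuclideanSpace ℝ (Fin d))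

open Classical in
/-- An index that moves from `k` to `k + 1` only once the norm of the position `p k` is bounded
by the number of steps made so far. -/
def slowIndex (ω : PricePath d T) : ℕ → ℕ
  | 0 => 0
  | m + 1 => if ‖p (slowIndex ω m) ω‖ ≤ m then slowIndex ω m + 1 else slowIndex ω m

theorem slowIndex_le_succ (ω : PricePath d T) (m : ℕ) :
    slowIndex p ω m ≤ slowIndex p ω (m + 1) := by
  rw [slowIndex]
  split_ifs <;> omega

theorem exists_le_slowIndex (ω : PricePath d T) (k : ℕ) : ∃ m, k ≤ slowIndex p ω m := by
  induction k with
  | zero => exact ⟨0, Nat.zero_le _⟩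
  | succ k ih =>
    obtain ⟨m, hm⟩ := ih
    obtain ⟨n, hn⟩ := exists_nat_ge ‖p k ω‖
    have hmono : Monotone (slowIndex p ω) := monotone_nat_of_le_succ (slowIndex_le_succ p ω)
    have h1 : k ≤ slowIndex p ω (max m n) := hm.trans (hmono (le_max_left _ _))
    rcases h1.eq_or_lt with h | h
    · refine ⟨max m n + 1, ?_⟩
      rw [slowIndex, ← h, if_pos (hn.trans (by exact_mod_cast le_max_right m n))]
    · exact ⟨_, h⟩

variable {p}

theorem measurableSet_slowIndex (hp : R.IsPosition p) (m k : ℕ) :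
    MeasurableSet[(R.isStoppingTime k).measurableSpace] {ω | slowIndex p ω m = k} := by
  induction m generalizing k with
  | zero =>
    by_cases h : 0 = k
    · simp [slowIndex, h]
    · simp [slowIndex, h]
  | succ m ih =>
    have hset : ∀ j, MeasurableSet[(R.isStoppingTime j).measurableSpace] {ω | ‖p j ω‖ ≤ m} :=
      fun j => (measurable_norm.comp (hp j)) measurableSet_Iic
    have hmono : ∀ j, (R.isStoppingTime j).measurableSpace ≤
        (R.isStoppingTime (j + 1)).measurableSpace := fun j =>
      (R.isStoppingTime j).measurableSpace_mono _ fun ω => R.τ_le_succ j ω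
    have hstay : MeasurableSet[(R.isStoppingTime k).measurableSpace]
        ({ω | slowIndex p ω m = k} ∩ {ω | ‖p k ω‖ ≤ m}ᶜ) :=
      MeasurableSet.inter (ih k) (hset k).compl
    cases k with
    | zero =>
      convert hstay using 1
      ext ω
      simp only [slowIndex, Set.mem_ofPred_eq, Set.mem_inter_iff, Set.mem_compl_iff]
      split_ifs with h <;> grind
    | succ k =>
      have hmove := hmono k _ (MeasurableSet.inter (ih k) (hset k))
      convert MeasurableSet.union hmove hstay using 1
      ext ω
      simp only [slowIndex, Set.mem_ofPred_eq, Set.mem_inter_iff, Set.mem_compl_iff,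
        Set.mem_union]
      split_ifs with h <;> grind

/-- An integral along a partition, with possibly unbounded positions, is the integral of a simple
strategy: the times of the partition are repeated until the bound on the current position is
known. -/
theorem exists_simpleStrategy (hp : R.IsPosition p) :
    ∃ G : SimpleStrategy d T, ∀ t ω, G.integral t ω = R.integral p t ω := by
  classical
  let x : ℕ → ℕ → PricePath d T → EuclideanSpace ℝ (Fin d) := fun m k ω =>
    if ‖p k ω‖ ≤ m then p k ω else 0
  have hx : ∀ m k, Measurable[(R.isStoppingTime k).measurableSpace] (x m k) := fun m k => by
    have hset : MeasurableSet[(R.isStoppingTime k).measurableSpace] {ω | ‖p k ω‖ ≤ m} :=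
      (measurable_norm.comp (hp k)) measurableSet_Iic
    exact Measurable.ite hset (hp k) measurable_const
  let G : SimpleStrategy d T :=
    { τ := fun m ω => R.τ (slowIndex p ω m) ω
      g := fun m ω => x m (slowIndex p ω m) ω
      isStoppingTime := fun m =>
        isStoppingTime_index R.isStoppingTime _ (R.measurableSet_slowIndex hp m)
      τ_zero := fun ω => R.τ_zero ω
      τ_le_succ := fun m ω => R.monotone ω (slowIndex_le_succ p ω m)
      eventually_const := fun ω => by
        obtain ⟨K, hK⟩ := R.exists_top ω
        obtain ⟨M, hM⟩ := exists_le_slowIndex p ω K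
        have hmono : Monotone (slowIndex p ω) := monotone_nat_of_le_succ (slowIndex_le_succ p ω)
        refine ⟨M, fun m hm => ?_⟩
        exact (eq_top_of_le (R.monotone ω) hK (hM.trans (hmono hm))).trans
          (eq_top_of_le (R.monotone ω) hK hM).symm
      measurable_g := fun m => by
        have := measurable_index R.isStoppingTime _ (R.measurableSet_slowIndex hp m) (x m) (hx m)
        rw [BorelSpace.measurable_eq (α := EuclideanSpace ℝ (Fin d))] at this
        exact this
      bounded_g := fun m => ⟨m, fun ω => by
        simp only [x]
        split_ifs with h
        · exact h
        · simp⟩ }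
  refine ⟨G, fun t ω => ?_⟩
  obtain ⟨K, hK⟩ := R.exists_top ω
  obtain ⟨M, hM⟩ := exists_le_slowIndex p ω K
  have hmono : Monotone (slowIndex p ω) := monotone_nat_of_le_succ (slowIndex_le_succ p ω)
  have htop : ∀ m, M ≤ m → G.τ m ω = ⊤ := fun m hm =>
    eq_top_of_le (R.monotone ω) hK (hM.trans (hmono hm))
  have h1 : G.integral t ω =
      ∑ m ∈ Finset.range M, inner ℝ (G.g m ω) (incr (fun m => G.τ m ω) ω m t) :=
    tsum_incr (τ := fun m => G.τ m ω) (K := M) (fun k hk => by rw [htop k hk, htop M le_rfl])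
      (fun k y => inner ℝ (G.g k ω) y) (by simp) ω t
  have h2 : ∀ m, ∑ m ∈ Finset.range m, inner ℝ (G.g m ω) (incr (fun m => G.τ m ω) ω m t) =
      ∑ k ∈ Finset.range (slowIndex p ω m), inner ℝ (p k ω) (incr (R.times ω) ω k t) := by
    intro m
    induction m with
    | zero => simp [slowIndex]
    | succ m ih =>
      rw [Finset.sum_range_succ, ih]
      by_cases h : ‖p (slowIndex p ω m) ω‖ ≤ m
      · have hs : slowIndex p ω (m + 1) = slowIndex p ω m + 1 := by rw [slowIndex, if_pos h]
        rw [hs, Finset.sum_range_succ]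
        congr 2
        · simp [G, x, h]
        · simp only [incr, G, hs, times]
      · have hs : slowIndex p ω (m + 1) = slowIndex p ω m := by rw [slowIndex, if_neg h]
        rw [hs, incr_eq_zero (by simp only [G, hs]), inner_zero_right, add_zero]
  rw [h1, h2, R.integral_eq_sum p (eq_top_of_le (R.monotone ω) hK hM)]

end Grid

/-! ### Gains of simple strategies -/

theorem measurable_of_eventually_eq {Ω M : Type*} {m : MeasurableSpace Ω} [TopologicalSpace M]
    [TopologicalSpace.PseudoMetrizableSpace M] [MeasurableSpace M] [BorelSpace M]
    {f : ℕ → Ω → M} {g : Ω → M} (hf : ∀ n, Measurable (f n))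
    (h : ∀ ω, ∃ L, ∀ n, L ≤ n → f n ω = g ω) : Measurable g :=
  measurable_of_tendsto_metrizable hf (tendsto_pi_nhds.2 fun ω => by
    obtain ⟨L, hL⟩ := h ω
    exact tendsto_const_nhds.congr' (eventually_atTop.2 ⟨L, fun n hn => (hL n hn).symm⟩))

theorem measurable_eval_minTime {τ : PricePath d T → WithTop (Time T)}
    (hτ : IsStoppingTime (natFiltration d T) τ) (t : Time T) :
    Measurable[natFiltration d T t] fun ω : PricePath d T => ω (minTime (τ ω) t) := by
  have hs : StronglyAdapted (natFiltration d T) fun (t : Time T) (ω : PricePath d T) => ω t :=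
    fun t => (measurable_eval t).stronglyMeasurable
  have h := (hs.stoppedProcess (fun ω => ω.continuous) hτ t).measurable
  convert h using 2 with ω
  simp only [stoppedProcess]
  congr 1
  rw [min_comm, ← coe_minTime]
  simp

theorem measurableSet_lt_stoppingTime {σ τ : PricePath d T → WithTop (Time T)}
    (hσ : IsStoppingTime (natFiltration d T) σ) (hτ : IsStoppingTime (natFiltration d T) τ) :
    MeasurableSet[hσ.measurableSpace] {ω | σ ω < τ ω} := by
  convert (IsStoppingTime.measurableSet_stopping_time_le hτ hσ).compl using 1
  ext ω
  simp

/-- Positions that are known at the times of one sequence, read along a partition. -/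
theorem Grid.measurable_pull (R : Grid d T) {τ : ℕ → PricePath d T → WithTop (Time T)}
    (hτ : ∀ l, IsStoppingTime (natFiltration d T) (τ l))
    (hconst : ∀ ω, ∃ L, ∀ l, L ≤ l → τ l ω = τ L ω)
    {M : Type*} [AddCommMonoid M] [TopologicalSpace M]
    [TopologicalSpace.PseudoMetrizableSpace M] [MeasurableSpace M] [BorelSpace M]
    [MeasurableAdd₂ M] {p : ℕ → PricePath d T → M}
    (hp : ∀ l, Measurable[(hτ l).measurableSpace] (p l)) (k : ℕ) :
    Measurable[(R.isStoppingTime k).measurableSpace]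
      fun ω => pull (fun l => τ l ω) (fun l => p l ω) (R.times ω) k := by
  classical
  have hterm : ∀ l, Measurable[(R.isStoppingTime k).measurableSpace] fun ω =>
      if τ l ω ≤ R.τ k ω ∧ R.τ k ω < τ (l + 1) ω then p l ω else 0 := by
    intro l B hB
    have h1 : MeasurableSet[(R.isStoppingTime k).measurableSpace]
        (p l ⁻¹' B ∩ {ω | τ l ω ≤ R.τ k ω}) :=
      ((IsStoppingTime.measurableSet_min_iff (hτ l) (R.isStoppingTime k) _).1
        (IsStoppingTime.measurableSet_inter_le (hτ l) (R.isStoppingTime k) _ (hp l hB))).2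
    have h2 := measurableSet_lt_stoppingTime (R.isStoppingTime k) (hτ (l + 1))
    have h3 := IsStoppingTime.measurableSet_stopping_time_le (hτ l) (R.isStoppingTime k)
    by_cases h0 : (0 : M) ∈ B
    · convert (h1.inter h2).union (h3.inter h2).compl using 1
      ext ω
      simp only [Set.mem_preimage, Set.mem_union, Set.mem_inter_iff, Set.mem_compl_iff,
        Set.mem_ofPred_eq]
      split_ifs with h <;> simp only [h, h0] <;> tauto
    · convert h1.inter h2 using 1
      ext ω
      simp only [Set.mem_preimage, Set.mem_inter_iff, Set.mem_ofPred_eq]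
      split_ifs with h
      · tauto
      · simp only [h0, false_iff]
        tauto
  refine measurable_of_eventually_eq (f := fun L ω => ∑ l ∈ Finset.range L,
      if τ l ω ≤ R.τ k ω ∧ R.τ k ω < τ (l + 1) ω then p l ω else 0)
    (fun L => Finset.measurable_fun_sum _ fun l _ => hterm l) fun ω => ?_
  obtain ⟨L, hL⟩ := hconst ω
  refine ⟨L, fun n hn => ?_⟩
  rw [pull_eq_sum (τ := fun l => τ l ω) (L := n)]
  · rfl
  · intro l hl
    rw [hL l (hn.trans hl), hL n hn]

theorem Grid.measurable_integral (R : Grid d T)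
    {p : ℕ → PricePath d T → EuclideanSpace ℝ (Fin d)} (hp : R.IsPosition p) (t : Time T) :
    Measurable[natFiltration d T t] (R.integral p t) := by
  classical
  refine measurable_of_eventually_eq (m := natFiltration d T t) (f := fun K ω =>
    ∑ k ∈ Finset.range K, inner ℝ (p k ω) (incr (R.times ω) ω k t)) (fun K => ?_) fun ω => ?_
  · refine Finset.measurable_fun_sum _ fun k _ => ?_
    have h1 : Measurable[natFiltration d T t] fun ω => if R.τ k ω ≤ t then p k ω else 0 := by
      intro B hB
      have h2 := (hp k hB).2 t
      have h3 := (R.isStoppingTime k) t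
      by_cases h0 : (0 : EuclideanSpace ℝ (Fin d)) ∈ B
      · convert h2.union h3.compl using 1
        ext ω
        simp only [Set.mem_preimage, Set.mem_union, Set.mem_inter_iff, Set.mem_compl_iff,
          Set.mem_ofPred_eq]
        split_ifs with h <;> simp [h, h0]
      · convert h2 using 1
        ext ω
        simp only [Set.mem_preimage, Set.mem_inter_iff, Set.mem_ofPred_eq]
        split_ifs with h <;> simp [h, h0]
    have h4 : Measurable[natFiltration d T t] fun ω => incr (R.times ω) ω k t :=
      (measurable_eval_minTime (R.isStoppingTime (k + 1)) t).sub
        (measurable_eval_minTime (R.isStoppingTime k) t)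
    have h5 : Measurable[natFiltration d T t] fun ω =>
        (inner ℝ (if R.τ k ω ≤ t then p k ω else 0) (incr (R.times ω) ω k t) : ℝ) := h1.inner h4
    convert h5 using 2 with ω
    split_ifs with h
    · rfl
    · rw [incr_eq_zero_of_le (R.monotone ω) (not_le.1 h).le, inner_zero_right, inner_zero_right]
  · obtain ⟨K, hK⟩ := R.exists_top ω
    exact ⟨K, fun n hn => (R.integral_eq_sum p (eq_top_of_le (R.monotone ω) hK hn) t).symm⟩

theorem continuous_incr (τ : ℕ → WithTop (Time T)) (ω : PricePath d T) (k : ℕ) :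
    Continuous (incr τ ω k) :=
  (ω.continuous.comp (IsContAdapted.continuous_minTime _)).sub
    (ω.continuous.comp (IsContAdapted.continuous_minTime _))

theorem Grid.isContAdapted_integral (R : Grid d T)
    {p : ℕ → PricePath d T → EuclideanSpace ℝ (Fin d)} (hp : R.IsPosition p) :
    IsContAdapted (R.integral p) := by
  refine ⟨R.measurable_integral hp, fun ω => ?_⟩
  obtain ⟨K, hK⟩ := R.exists_top ω
  simp_rw [R.integral_eq_sum p hK]
  exact continuous_finsetSum _ fun k _ => continuous_const.inner (continuous_incr _ ω k)

namespace SimpleStrategy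

variable (G : SimpleStrategy d T)

theorem monotone (ω : PricePath d T) : Monotone fun l => G.τ l ω :=
  monotone_nat_of_le_succ fun k => G.τ_le_succ k ω

theorem finite_range (ω : PricePath d T) : (Set.range fun l => G.τ l ω).Finite := by
  obtain ⟨L, hL⟩ := G.eventually_const ω
  refine ((Finset.range (L + 1)).image fun l => G.τ l ω).finite_toSet.subset ?_
  rintro _ ⟨l, rfl⟩
  simp only [Finset.coe_image, Finset.coe_range, Set.mem_image, Set.mem_Iio]
  rcases le_total l L with h | h
  · exact ⟨l, by omega, rfl⟩
  · exact ⟨L, by omega, (hL l h).symm⟩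

theorem measurable_position (l : ℕ) : Measurable[(G.isStoppingTime l).measurableSpace] (G.g l) := by
  have := G.measurable_g l
  rwa [← BorelSpace.measurable_eq (α := EuclideanSpace ℝ (Fin d))] at this

/-- The positions of a simple strategy at the times of a partition. -/
def posOn (R : Grid d T) (k : ℕ) (ω : PricePath d T) : EuclideanSpace ℝ (Fin d) :=
  pull (fun l => G.τ l ω) (fun l => G.g l ω) (R.times ω) k

theorem isPosition_posOn (R : Grid d T) : R.IsPosition (G.posOn R) := fun k =>
  R.measurable_pull G.isStoppingTime G.eventually_const G.measurable_position k

theorem integral_eq_sum {ω : PricePath d T} {L : ℕ} (hL : ∀ l, L ≤ l → G.τ l ω = G.τ L ω)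
    (t : Time T) : G.integral t ω =
      ∑ l ∈ Finset.range L, inner ℝ (G.g l ω) (incr (fun l => G.τ l ω) ω l t) :=
  tsum_incr (τ := fun m => G.τ m ω) hL (fun k y => inner ℝ (G.g k ω) y) (by simp) ω t

theorem integral_eq_grid {R : Grid d T} {ω : PricePath d T}
    (hR : ∀ l, NoCross (R.times ω) (G.τ l ω)) (t : Time T) :
    G.integral t ω = R.integral (G.posOn R) t ω := by
  obtain ⟨L, hL⟩ := G.eventually_const ω
  obtain ⟨K, hK⟩ := R.exists_top ω
  rw [G.integral_eq_sum hL, R.integral_eq_sum _ hK]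
  exact sum_inner_incr_eq_pull (G.monotone ω) (R.monotone ω) (R.times_zero ω) hL hK hR _ ω t

end SimpleStrategy

/-- `V` is the integral process of a simple strategy. -/
def IsGain (V : Time T → PricePath d T → ℝ) : Prop :=
  ∃ G : SimpleStrategy d T, ∀ t ω, G.integral t ω = V t ω

theorem SimpleStrategy.isGain (G : SimpleStrategy d T) : IsGain G.integral := ⟨G, fun _ _ => rfl⟩

theorem Grid.isGain (R : Grid d T) {p : ℕ → PricePath d T → EuclideanSpace ℝ (Fin d)}
    (hp : R.IsPosition p) : IsGain (R.integral p) := R.exists_simpleStrategy hp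

/-- The common refinement of two sequences of stopping times. -/
def Grid.merge (τ τ' : ℕ → PricePath d T → WithTop (Time T))
    (hτ : ∀ l, IsStoppingTime (natFiltration d T) (τ l))
    (hτ' : ∀ l, IsStoppingTime (natFiltration d T) (τ' l))
    (hfin : ∀ ω, (Set.range fun l => τ l ω).Finite)
    (hfin' : ∀ ω, (Set.range fun l => τ' l ω).Finite) : Grid d T :=
  Grid.ofFamily (Sum.elim τ τ') (by rintro (l | l); exacts [hτ l, hτ' l]) fun ω => by
    have : (Set.range fun i => Sum.elim τ τ' i ω) =
        (Set.range fun l => τ l ω) ∪ Set.range fun l => τ' l ω := by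
      ext s
      simp
    rw [this]
    exact (hfin ω).union (hfin' ω)

section merge

variable {τ τ' : ℕ → PricePath d T → WithTop (Time T)}
    (hτ : ∀ l, IsStoppingTime (natFiltration d T) (τ l))
    (hτ' : ∀ l, IsStoppingTime (natFiltration d T) (τ' l))
    (hfin : ∀ ω, (Set.range fun l => τ l ω).Finite)
    (hfin' : ∀ ω, (Set.range fun l => τ' l ω).Finite)

theorem Grid.noCross_merge_left (l : ℕ) (ω : PricePath d T) :
    NoCross ((Grid.merge τ τ' hτ hτ' hfin hfin').times ω) (τ l ω) :=
  Grid.noCross_ofFamily (Sum.elim τ τ') _ _ (Sum.inl l) ω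

theorem Grid.noCross_merge_right (l : ℕ) (ω : PricePath d T) :
    NoCross ((Grid.merge τ τ' hτ hτ' hfin hfin').times ω) (τ' l ω) :=
  Grid.noCross_ofFamily (Sum.elim τ τ') _ _ (Sum.inr l) ω

end merge

namespace IsGain

variable {V U : Time T → PricePath d T → ℝ}

theorem congr (hV : IsGain V) (h : ∀ t ω, V t ω = U t ω) : IsGain U := by
  obtain ⟨G, hG⟩ := hV
  exact ⟨G, fun t ω => (hG t ω).trans (h t ω)⟩

/-- A gain process and a further sequence of stopping times have a common partition. -/
theorem exists_grid (hV : IsGain V) {σ : ℕ → PricePath d T → WithTop (Time T)}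
    (hσ : ∀ l, IsStoppingTime (natFiltration d T) (σ l))
    (hfin : ∀ ω, (Set.range fun l => σ l ω).Finite) :
    ∃ (R : Grid d T) (p : ℕ → PricePath d T → EuclideanSpace ℝ (Fin d)), R.IsPosition p ∧
      (∀ t ω, V t ω = R.integral p t ω) ∧ ∀ l ω, NoCross (R.times ω) (σ l ω) := by
  obtain ⟨G, hG⟩ := hV
  let R := Grid.merge G.τ σ G.isStoppingTime hσ G.finite_range hfin
  refine ⟨R, G.posOn R, G.isPosition_posOn R, fun t ω => ?_, fun l ω => ?_⟩
  · rw [← hG]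
    exact G.integral_eq_grid (fun l => Grid.noCross_merge_left _ _ _ _ l ω) t
  · exact Grid.noCross_merge_right _ _ _ _ l ω

theorem isContAdapted (hV : IsGain V) : IsContAdapted V := by
  obtain ⟨R, p, hp, h, -⟩ := hV.exists_grid (σ := fun _ _ => ⊤)
    (fun _ t => by simp) fun ω => by simp
  have := R.isContAdapted_integral hp
  rwa [show V = R.integral p from funext fun t => funext fun ω => h t ω]

theorem add (hV : IsGain V) (hU : IsGain U) : IsGain fun t ω => V t ω + U t ω := by
  obtain ⟨G, hG⟩ := hU
  obtain ⟨R, p, hp, h, hR⟩ := hV.exists_grid G.isStoppingTime G.finite_range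
  refine (R.isGain (p := fun k ω => p k ω + G.posOn R k ω) fun k =>
    (hp k).add (G.isPosition_posOn R k)).congr fun t ω => ?_
  obtain ⟨K, hK⟩ := R.exists_top ω
  rw [h, ← hG, G.integral_eq_grid (fun l => hR l ω), R.integral_eq_sum _ hK,
    R.integral_eq_sum _ hK, R.integral_eq_sum _ hK, ← Finset.sum_add_distrib]
  simp_rw [inner_add_left]

theorem const_mul (hV : IsGain V) (c : ℝ) : IsGain fun t ω => c * V t ω := by
  obtain ⟨R, p, hp, h, -⟩ := hV.exists_grid (σ := fun _ _ => ⊤)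
    (fun _ t => by simp) fun ω => by simp
  refine (R.isGain (p := fun k ω => c • p k ω) fun k => (hp k).const_smul c).congr fun t ω => ?_
  obtain ⟨K, hK⟩ := R.exists_top ω
  rw [h, R.integral_eq_sum _ hK, R.integral_eq_sum _ hK, Finset.mul_sum]
  simp_rw [real_inner_smul_left]

theorem sub (hV : IsGain V) (hU : IsGain U) : IsGain fun t ω => V t ω - U t ω :=
  (hV.add (hU.const_mul (-1))).congr fun t ω => by ring

theorem zero : IsGain (d := d) (T := T) fun _ _ => 0 := by
  let R : Grid d T := Grid.ofFamily (ι := Empty) (fun _ _ => ⊤) (fun i => i.elim)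
    fun ω => Set.toFinite _
  refine (R.isGain (p := fun _ _ => 0) fun k => measurable_const).congr fun t ω => ?_
  simp [Grid.integral]

theorem sum {ι : Type*} (s : Finset ι) {V : ι → Time T → PricePath d T → ℝ}
    (hV : ∀ i ∈ s, IsGain (V i)) : IsGain fun t ω => ∑ i ∈ s, V i t ω := by
  classical
  induction s using Finset.induction_on with
  | empty => simpa using zero
  | insert i s hi ih =>
    simp_rw [Finset.sum_insert hi]
    exact (hV i (by simp)).add (ih fun j hj => hV j (by simp [hj]))

theorem stopAt (hV : IsGain V) {σ : PricePath d T → WithTop (Time T)}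
    (hσ : IsStoppingTime (natFiltration d T) σ) : IsGain fun t ω => V (minTime (σ ω) t) ω := by
  classical
  obtain ⟨R, p, hp, h, hR⟩ := hV.exists_grid (σ := fun _ => σ) (fun _ => hσ) fun ω => by simp
  refine (R.isGain (p := fun k ω => if R.τ k ω < σ ω then p k ω else 0) fun k =>
    Measurable.ite (measurableSet_lt_stoppingTime (R.isStoppingTime k) hσ) (hp k)
      measurable_const).congr fun t ω => ?_
  obtain ⟨K, hK⟩ := R.exists_top ω
  rw [h, R.integral_eq_sum _ hK, R.integral_eq_sum _ hK]
  refine Finset.sum_congr rfl fun k _ => ?_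
  rw [incr_minTime (R.monotone ω) (hR 0 ω)]
  by_cases hk : R.times ω k < σ ω
  · rw [if_pos hk, if_pos (show R.τ k ω < σ ω from hk)]
  · rw [if_neg hk, if_neg (show ¬ R.τ k ω < σ ω from hk), inner_zero_left, inner_zero_right]

theorem apply_bot (hV : IsGain V) (ω : PricePath d T) : V ⊥ ω = 0 := by
  obtain ⟨G, hG⟩ := hV
  rw [← hG, SimpleStrategy.integral]
  have : ∀ σ : WithTop (Time T), minTime σ ⊥ = ⊥ := fun σ => le_bot_iff.1 (minTime_le σ ⊥)
  simp [this]

end IsGain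

/-! ### Null sets of Vovk's outer measure -/

/-- Null sets in terms of gains. Every initial capital suffices for a null set, as the
admissibility condition and the final condition both become weaker when the capital grows. -/
theorem vovkOuterMeasure_eq_zero_iff {A : Set (PricePath d T)} :
    vovkOuterMeasure A = 0 ↔ ∀ ε : ℝ, 0 < ε → ∃ V : ℕ → Time T → PricePath d T → ℝ,
      (∀ n, IsGain (V n)) ∧ (∀ n t ω, -ε ≤ V n t ω) ∧
      ∀ ω ∈ A, (1 : EReal) ≤ liminf (fun n => ((ε + V n ⊤ ω : ℝ) : EReal)) atTop := by
  constructor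
  · intro h ε hε
    have h' : vovkOuterMeasure A < ENNReal.ofReal ε := by
      rw [h]
      exact ENNReal.ofReal_pos.2 hε
    obtain ⟨_, ⟨a, ⟨ha, G, hG, hA⟩, rfl⟩, hlt⟩ := sInf_lt_iff.1 h'
    have haε : a ≤ ε := ((ENNReal.ofReal_lt_ofReal_iff hε).1 hlt).le
    refine ⟨fun n => (G n).integral, fun n => (G n).isGain,
      fun n t ω => (neg_le_neg haε).trans (hG n ω t), fun ω hω => ?_⟩
    have := hA ω
    rw [Set.indicator_of_mem hω] at this
    refine this.trans (liminf_le_liminf (Eventually.of_forall fun n => ?_))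
    exact EReal.coe_le_coe_iff.2 (by linarith)
  · intro h
    refine le_antisymm (le_of_forall_gt fun b hb => ?_) bot_le
    obtain ⟨ε, hε, hεb⟩ : ∃ ε : ℝ, 0 < ε ∧ ENNReal.ofReal ε < b := by
      obtain ⟨q, hq, hqb⟩ := ENNReal.lt_iff_exists_nnreal_btwn.1 hb
      exact ⟨q, by exact_mod_cast hq, by simpa using hqb⟩
    obtain ⟨V, hV, hadm, hA⟩ := h ε hε
    choose G hG using hV
    refine sInf_lt_iff.2 ⟨_, ⟨ε, ⟨hε, G, fun n ω t => ?_, fun ω => ?_⟩, rfl⟩, hεb⟩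
    · rw [hG]
      exact hadm n t ω
    · simp_rw [hG]
      by_cases hω : ω ∈ A
      · rw [Set.indicator_of_mem hω]
        exact hA ω hω
      · rw [Set.indicator_of_notMem hω]
        refine le_liminf_of_le (by isBoundedDefault) (Eventually.of_forall fun n => ?_)
        exact EReal.coe_le_coe_iff.2 (by linarith [hadm n ⊤ ω])

theorem vovkOuterMeasure_mono_null {A B : Set (PricePath d T)} (h : A ⊆ B)
    (hB : vovkOuterMeasure B = 0) : vovkOuterMeasure A = 0 := by
  rw [vovkOuterMeasure_eq_zero_iff] at hB ⊢
  intro ε hε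
  obtain ⟨V, hV, hadm, hA⟩ := hB ε hε
  exact ⟨V, hV, hadm, fun ω hω => hA ω (h hω)⟩

/-- The strategies for the first `n` sets are run simultaneously at the `n`th stage. -/
theorem vovkOuterMeasure_iUnion_null {A : ℕ → Set (PricePath d T)}
    (hA : ∀ i, vovkOuterMeasure (A i) = 0) : vovkOuterMeasure (⋃ i, A i) = 0 := by
  rw [vovkOuterMeasure_eq_zero_iff]
  intro ε hε
  have hε' : ∀ i : ℕ, 0 < ε / 2 / 2 ^ i := fun i => by positivity
  choose V hV hadm h1 using fun i => vovkOuterMeasure_eq_zero_iff.1 (hA i) _ (hε' i)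
  have hsum : ∀ n, ∑ i ∈ Finset.range n, ε / 2 / 2 ^ i ≤ ε := fun n =>
    ((summable_geometric_two' ε).sum_le_tsum _ fun i _ => (hε' i).le).trans_eq
      (tsum_geometric_two' ε)
  refine ⟨fun n t ω => ∑ i ∈ Finset.range n, V i n t ω, fun n => IsGain.sum _ fun i _ => hV i n,
    fun n t ω => ?_, fun ω hω => ?_⟩
  · have : ∑ i ∈ Finset.range n, -(ε / 2 / 2 ^ i) ≤ ∑ i ∈ Finset.range n, V i n t ω :=
      Finset.sum_le_sum fun i _ => hadm i n t ω
    rw [Finset.sum_neg_distrib] at this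
    linarith [hsum n]
  · obtain ⟨j, hj⟩ := Set.mem_iUnion.1 hω
    refine (h1 j ω hj).trans (liminf_le_liminf ?_)
    filter_upwards [eventually_gt_atTop j] with n hn
    refine EReal.coe_le_coe_iff.2 ?_
    have h2 : ε / 2 / 2 ^ j + V j n ⊤ ω ≤
        ∑ i ∈ Finset.range n, (ε / 2 / 2 ^ i + V i n ⊤ ω) :=
      Finset.single_le_sum (f := fun i => ε / 2 / 2 ^ i + V i n ⊤ ω)
        (fun i _ => by linarith [hadm i n ⊤ ω]) (Finset.mem_range.2 hn)
    rw [Finset.sum_add_distrib] at h2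
    linarith [hsum n]

theorem vovkOuterMeasure_union_null {A B : Set (PricePath d T)} (hA : vovkOuterMeasure A = 0)
    (hB : vovkOuterMeasure B = 0) : vovkOuterMeasure (A ∪ B) = 0 := by
  refine vovkOuterMeasure_mono_null (B := ⋃ i : ℕ, if i = 0 then A else B) ?_
    (vovkOuterMeasure_iUnion_null fun i => by split_ifs <;> assumption)
  rintro ω (h | h)
  · exact Set.mem_iUnion.2 ⟨0, by simpa using h⟩
  · exact Set.mem_iUnion.2 ⟨1, by simpa using h⟩

/-- Typically, gains that are bounded from below do not tend to infinity. No bound that is uniform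
in the path is needed: a gain process is stopped when it leaves a bounded interval, and the lower
bound along the path only has to be one of countably many. -/
theorem vovkOuterMeasure_unbounded_gains {V : ℕ → Time T → PricePath d T → ℝ}
    (hV : ∀ n, IsGain (V n)) :
    vovkOuterMeasure {ω | (∃ a : ℝ, ∀ n t, -a ≤ V n t ω) ∧
      ∀ L : ℝ, ∃ N, ∀ n, N ≤ n → ∃ t, L ≤ V n t ω} = 0 := by
  refine vovkOuterMeasure_mono_null (B := ⋃ m : ℕ, {ω | (∀ n t, -(m : ℝ) ≤ V n t ω) ∧
    ∀ L : ℝ, ∃ N, ∀ n, N ≤ n → ∃ t, L ≤ V n t ω}) ?_ (vovkOuterMeasure_iUnion_null fun m => ?_)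
  · rintro ω ⟨⟨a, ha⟩, h⟩
    obtain ⟨m, hm⟩ := exists_nat_ge a
    exact Set.mem_iUnion.2 ⟨m, fun n t => (neg_le_neg hm).trans (ha n t), h⟩
  rw [vovkOuterMeasure_eq_zero_iff]
  intro ε hε
  have hm : (0 : ℝ) < m + 1 := by positivity
  -- the level `L` is chosen such that `ε / (m + 1)` times a gain of `L` is `1`
  set L : ℝ := (m + 1) / ε with hL
  have hLpos : 0 < L := by positivity
  let y : ℕ → Time T → PricePath d T → ℝ := fun n t ω =>
    max (V n t ω - L) (-(m + 1) - V n t ω)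
  have hy : ∀ n, IsContAdapted (y n) := fun n =>
    ((hV n).isContAdapted.sub (.const L)).max ((IsContAdapted.const _).sub (hV n).isContAdapted)
  let σ : ℕ → PricePath d T → WithTop (Time T) := fun n ω =>
    hitAfter ((⊥ : Time T) : WithTop (Time T)) fun t => y n t ω
  have hσ : ∀ n, IsStoppingTime (natFiltration d T) (σ n) := fun n =>
    isStoppingTime_hitAfter (hy n) (isStoppingTime_const _ _)
  refine ⟨fun n t ω => ε / (m + 1) * V n (minTime (σ n ω) t) ω,
    fun n => ((hV n).stopAt (hσ n)).const_mul _, fun n t ω => ?_, fun ω hω => ?_⟩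
  · have h0 : y n ⊥ ω < 0 := by
      simp only [y, (hV n).apply_bot ω]
      exact max_lt (by linarith) (by linarith)
    have h1 : y n (minTime (σ n ω) t) ω ≤ 0 := hitAfter_nonpos ((hy n).continuous ω) h0 t
    have h2 : -(m + 1 : ℝ) ≤ V n (minTime (σ n ω) t) ω := by
      have := (le_max_right _ _).trans h1
      linarith
    calc -ε = ε / (m + 1) * -(m + 1) := by field_simp
      _ ≤ _ := mul_le_mul_of_nonneg_left h2 (by positivity)
  · obtain ⟨hlow, hup⟩ := hω
    obtain ⟨N, hN⟩ := hup L
    refine le_liminf_of_le (by isBoundedDefault) (eventually_atTop.2 ⟨N, fun n hn => ?_⟩)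
    obtain ⟨t, ht⟩ := hN n hn
    have h1 : σ n ω ≤ t := hitAfter_le (by simp)
      (show 0 ≤ y n t ω from le_max_of_le_left (by linarith))
    have h2 : σ n ω = minTime (σ n ω) ⊤ :=
      (coe_minTime_of_le (h1.trans (WithTop.coe_le_coe.2 le_top))).symm
    have h3 : 0 ≤ y n (minTime (σ n ω) ⊤) ω := nonneg_of_hitAfter_eq ((hy n).continuous ω) h2
    have h4 : L ≤ V n (minTime (σ n ω) ⊤) ω := by
      rcases le_max_iff.1 h3 with h | h
      · linarith
      · linarith [hlow n (minTime (σ n ω) ⊤)]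
    have h5 : 1 ≤ ε / (m + 1) * V n (minTime (σ n ω) ⊤) ω := by
      calc (1 : ℝ) = ε / (m + 1) * L := by rw [hL]; field_simp
        _ ≤ _ := mul_le_mul_of_nonneg_left h4 (by positivity)
    exact_mod_cast (by linarith : (1 : ℝ) ≤ ε + ε / (m + 1) * V n (minTime (σ n ω) ⊤) ω)

/-! ### Repeated bets on recoveries -/

namespace Bet

/-- The first time after `ρ` at which the `n`th wealth process `w n` is nonpositive. -/
def start (w : ℕ → Time T → ℝ) (ρ : WithTop (Time T)) (n : ℕ) : WithTop (Time T) :=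
  hitAfter ρ fun t => -w n t

open Classical in
/-- The time of the purchase, if the wealth process with index `n` is the one that is bought, and
`+∞` otherwise: the process bought is the first one with an index in `F` that becomes nonpositive
after `ρ`, and the one with the least index if there are several. -/
def buy (w : ℕ → Time T → ℝ) (F : Finset ℕ) (ρ : WithTop (Time T)) (n : ℕ) : WithTop (Time T) :=
  if ∀ k ∈ F, (k < n → start w ρ n < start w ρ k) ∧ (n < k → start w ρ n ≤ start w ρ k)
  then start w ρ n else ⊤

/-- The time of the sale: the first time after the purchase at which the process bought has
recovered to `η`. -/
def sell (w : ℕ → Time T → ℝ) (η : ℝ) (F : Finset ℕ) (ρ : WithTop (Time T)) (n : ℕ) :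
    WithTop (Time T) :=
  hitAfter (buy w F ρ n) fun t => w n t - η

/-- The gain of the bet that starts at `ρ`. -/
def gain (w : ℕ → Time T → ℝ) (η : ℝ) (F : Finset ℕ) (ρ : WithTop (Time T)) (t : Time T) : ℝ :=
  ∑ n ∈ F, (w n (minTime (sell w η F ρ n) t) - w n (minTime (buy w F ρ n) t))

/-- The time at which the `j`th bet has been won. -/
def round (w : ℕ → Time T → ℝ) (η : ℝ) (F : Finset ℕ) : ℕ → WithTop (Time T)
  | 0 => ((⊥ : Time T) : WithTop (Time T))
  | j + 1 => F.inf (sell w η F (round w η F j))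

variable {w : ℕ → Time T → ℝ} {η : ℝ} {F : Finset ℕ} {ρ : WithTop (Time T)}

theorem start_le_buy (n : ℕ) : start w ρ n ≤ buy w F ρ n := by
  unfold buy
  split_ifs
  · exact le_rfl
  · exact le_top

theorem le_buy (n : ℕ) : ρ ≤ buy w F ρ n := (le_hitAfter _ _).trans (start_le_buy n)

theorem buy_le_sell (n : ℕ) : buy w F ρ n ≤ sell w η F ρ n := le_hitAfter _ _

theorem le_sell (n : ℕ) : ρ ≤ sell w η F ρ n := (le_buy n).trans (buy_le_sell n)

theorem round_le_succ (j : ℕ) : round w η F j ≤ round w η F (j + 1) :=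
  Finset.le_inf fun n _ => le_sell n

theorem buy_unique {n n' : ℕ} (hn : n ∈ F) (hn' : n' ∈ F) (h : buy w F ρ n ≠ ⊤)
    (h' : buy w F ρ n' ≠ ⊤) : n = n' := by
  unfold buy at h h'
  split_ifs at h with h1
  · split_ifs at h' with h2
    · rcases lt_trichotomy n n' with hlt | heq | hlt
      · exact absurd ((h2 n hn).1 hlt) (not_lt.2 ((h1 n' hn').2 hlt))
      · exact heq
      · exact absurd ((h1 n' hn').1 hlt) (not_lt.2 ((h2 n hn).2 hlt))
    · exact absurd rfl h'
  · exact absurd rfl h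

theorem exists_buy_le {n : ℕ} (hn : n ∈ F) {t : Time T} (hρ : ρ ≤ t) (h : w n t ≤ 0) :
    ∃ n' ∈ F, buy w F ρ n' ≤ t := by
  obtain ⟨n', hn', hmin⟩ := F.exists_min_image (fun k => toLex (start w ρ k, k)) ⟨n, hn⟩
  refine ⟨n', hn', ?_⟩
  have hst : start w ρ n ≤ t := hitAfter_le hρ (by linarith)
  have hle : start w ρ n' ≤ start w ρ n := by
    rcases Prod.Lex.toLex_le_toLex.1 (hmin n hn) with h1 | h1
    · exact h1.le
    · exact h1.1.le
  unfold buy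
  rw [if_pos]
  · exact hle.trans hst
  · intro k hk
    rcases Prod.Lex.toLex_le_toLex.1 (hmin k hk) with h1 | h1
    · exact ⟨fun _ => h1, fun _ => h1.le⟩
    · exact ⟨fun h2 => absurd h1.2 (not_le.2 h2), fun _ => h1.1.le⟩

theorem nonpos_of_buy_eq (hw : ∀ n, Continuous (w n)) {n : ℕ} {u : Time T}
    (h : buy w F ρ n = u) : w n u ≤ 0 := by
  unfold buy at h
  split_ifs at h with h1
  · have : 0 ≤ -w n u := nonneg_of_hitAfter_eq (hw n).neg h
    linarith
  · exact absurd h.symm WithTop.coe_ne_top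

theorem le_of_sell_eq (hw : ∀ n, Continuous (w n)) {n : ℕ} {u : Time T}
    (h : sell w η F ρ n = u) : η ≤ w n u := by
  have : 0 ≤ w n u - η := nonneg_of_hitAfter_eq ((hw n).sub continuous_const) h
  linarith

theorem sell_le {n : ℕ} {t : Time T} (h : buy w F ρ n ≤ t) (hη : η ≤ w n t) :
    sell w η F ρ n ≤ t := hitAfter_le h (by linarith)

theorem sell_eq_top {n : ℕ} (h : buy w F ρ n = ⊤) : sell w η F ρ n = ⊤ :=
  top_le_iff.1 (h ▸ buy_le_sell n)

/-- Either nothing is bought, or exactly one process is. -/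
theorem round_cases (w : ℕ → Time T → ℝ) (η : ℝ) (F : Finset ℕ) (ρ : WithTop (Time T)) :
    ((F.inf (sell w η F ρ) = ⊤ ∧ ∀ t, gain w η F ρ t = 0) ∨
    ∃ n ∈ F, F.inf (sell w η F ρ) = sell w η F ρ n ∧ ∀ t, gain w η F ρ t =
      w n (minTime (sell w η F ρ n) t) - w n (minTime (buy w F ρ n) t)) := by
  by_cases h : ∃ n ∈ F, buy w F ρ n ≠ ⊤
  · obtain ⟨n, hn, hbuy⟩ := h
    have hother : ∀ k ∈ F, k ≠ n → buy w F ρ k = ⊤ := fun k hk hkn => by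
      by_contra hk'
      exact hkn (buy_unique hk hn hk' hbuy)
    refine Or.inr ⟨n, hn, le_antisymm (Finset.inf_le hn) (Finset.le_inf fun k hk => ?_),
      fun t => ?_⟩
    · by_cases hkn : k = n
      · rw [hkn]
      · rw [sell_eq_top (hother k hk hkn)]
        exact le_top
    · refine Finset.sum_eq_single_of_mem n hn fun k hk hkn => ?_
      rw [sell_eq_top (hother k hk hkn), hother k hk hkn, sub_self]
  · push Not at h
    refine Or.inl ⟨top_le_iff.1 (Finset.le_inf fun k hk => (sell_eq_top (h k hk)).ge),
      fun t => Finset.sum_eq_zero fun k hk => ?_⟩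
    rw [sell_eq_top (h k hk), h k hk, sub_self]

theorem gain_eq_zero {t : Time T} (h : (t : WithTop (Time T)) ≤ ρ) : gain w η F ρ t = 0 :=
  Finset.sum_eq_zero fun n _ => by
    rw [minTime_of_le (h.trans (le_sell n)), minTime_of_le (h.trans (le_buy n)), sub_self]

theorem le_gain (hw : ∀ n, Continuous (w n)) {t : Time T} (h : F.inf (sell w η F ρ) ≤ t) :
    η ≤ gain w η F ρ t := by
  rcases round_cases w η F ρ with ⟨h1, -⟩ | ⟨n, -, h1, h2⟩
  · rw [h1] at h
    exact absurd (top_le_iff.1 h) WithTop.coe_ne_top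
  · rw [h1] at h
    rw [h2]
    have h3 := le_of_sell_eq hw (coe_minTime_of_le h).symm
    have h4 := nonpos_of_buy_eq hw (coe_minTime_of_le ((buy_le_sell n).trans h)).symm
    linarith

theorem neg_le_gain (hw : ∀ n, Continuous (w n)) (hη : 0 ≤ η) {M : ℝ} (hM : 0 ≤ M)
    (hlow : ∀ n t, -M ≤ w n t) (t : Time T) : -M ≤ gain w η F ρ t := by
  rcases le_or_gt (F.inf (sell w η F ρ)) t with h | h
  · linarith [le_gain hw h]
  · rcases round_cases w η F ρ with ⟨-, h1⟩ | ⟨n, -, h1, h2⟩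
    · rw [h1]
      linarith
    · rw [h1] at h
      rw [h2, minTime_of_le h.le]
      rcases le_or_gt (buy w F ρ n) t with h3 | h3
      · linarith [hlow n t, nonpos_of_buy_eq hw (coe_minTime_of_le h3).symm]
      · rw [minTime_of_le h3.le]
        linarith

/-- After `j` bets have been won the total gain is at least `j η`, up to the loss in the bet that
is still open. -/
theorem le_sum_gain (hw : ∀ n, Continuous (w n)) (hη : 0 ≤ η) {M : ℝ} (hM : 0 ≤ M)
    (hlow : ∀ n t, -M ≤ w n t) (t : Time T) (N : ℕ) :
    (round w η F N ≤ t → N * η ≤ ∑ i ∈ Finset.range N, gain w η F (round w η F i) t) ∧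
    ∀ j ≤ N, round w η F j ≤ t →
      j * η - M ≤ ∑ i ∈ Finset.range N, gain w η F (round w η F i) t := by
  induction N with
  | zero =>
    refine ⟨fun _ => by simp, fun j hj _ => ?_⟩
    obtain rfl : j = 0 := by omega
    simpa using hM
  | succ N ih =>
    rw [Finset.sum_range_succ]
    push_cast
    refine ⟨fun h => ?_, fun j hj h => ?_⟩
    · have := ih.1 ((round_le_succ N).trans h)
      linarith [le_gain (ρ := round w η F N) hw h]
    · rcases le_or_gt (round w η F N) t with h1 | h1
      · rcases le_or_gt (round w η F (N + 1)) t with h2 | h2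
        · have h3 := ih.1 h1
          have h4 := le_gain (ρ := round w η F N) hw h2
          have h5 : (j : ℝ) * η ≤ (N + 1) * η :=
            mul_le_mul_of_nonneg_right (by exact_mod_cast hj) hη
          linarith
        · have hjN : j ≤ N := by
            by_contra! hlt
            obtain rfl : j = N + 1 := by omega
            exact absurd h (not_le.2 h2)
          have h3 := ih.1 h1
          have h4 := neg_le_gain (F := F) (ρ := round w η F N) hw hη hM hlow t
          have h5 : (j : ℝ) * η ≤ N * η :=
            mul_le_mul_of_nonneg_right (by exact_mod_cast hjN) hη
          linarith
      · have hjN : j ≤ N := by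
          by_contra! hlt
          obtain rfl : j = N + 1 := by omega
          exact absurd ((round_le_succ N).trans h) (not_le.2 h1)
        rw [gain_eq_zero h1.le, add_zero]
        exact ih.2 j hjN h

/-- If some process is nonpositive at a time `t` after the end of round `j`, and all the processes
that have been nonpositive up to `t` have recovered at time `r`, then round `j + 1` ends by `r`. -/
theorem round_succ_le (hw : ∀ n, Continuous (w n)) {j n : ℕ} {t : Time T} (hn : n ∈ F)
    (ht : round w η F j ≤ t) (h : w n t ≤ 0) {r : Time T} (htr : t ≤ r)
    (hrec : ∀ k ∈ F, (∃ u ≤ t, w k u ≤ 0) → η ≤ w k r) : round w η F (j + 1) ≤ r := by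
  obtain ⟨k, hk, hbuy⟩ := exists_buy_le hn ht h
  have h1 := coe_minTime_of_le hbuy
  have h2 := hrec k hk ⟨_, minTime_le _ _, nonpos_of_buy_eq hw h1.symm⟩
  exact (Finset.inf_le hk).trans (sell_le (hbuy.trans (WithTop.coe_le_coe.2 htr)) h2)

/-- If infinitely many of the wealth processes become nonpositive, while at every fixed time they
eventually exceed `η`, then any number of successive bets can be won, with suitable indices. The
bets are won close to the first time `s` at which such drops accumulate, from the left or from the
right. -/
theorem exists_forall_round_le (hw : ∀ n, Continuous (w n))
    (hη : 0 < η) (hrec : ∀ t, ∃ n₀, ∀ n, n₀ ≤ n → η < w n t)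
    (hdrop : ∀ N, ∃ n, N ≤ n ∧ ∃ t, w n t ≤ 0) :
    ∃ m, ∀ j, ∃ N₀, ∀ N, N₀ ≤ N → ∃ t : Time T, round w η (Finset.Icc m N) j ≤ t := by
  let P : Time T → Set ℕ := fun r => {n | ∃ t ≤ r, w n t ≤ 0}
  have hPtop : (P ⊤).Infinite := Set.infinite_of_forall_exists_gt fun N => by
    obtain ⟨n, hn, t, ht⟩ := hdrop (N + 1)
    exact ⟨n, ⟨t, le_top, ht⟩, by omega⟩
  set s : Time T := sInf {r | (P r).Infinite} with hs
  have hlt : ∀ r, r < s → (P r).Finite := fun r hr => by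
    by_contra h
    exact absurd (sInf_le (show r ∈ {r | (P r).Infinite} from h)) (not_le.2 hr)
  have hgt : ∀ r, s < r → (P r).Infinite := fun r hr => by
    obtain ⟨u, hu, hur⟩ := sInf_lt_iff.1 hr
    refine Set.Infinite.mono ?_ hu
    rintro n ⟨t, ht, h⟩
    exact ⟨t, ht.trans hur.le, h⟩
  obtain ⟨n₁, hn₁⟩ := hrec s
  by_cases hL : {n | ∃ t < s, w n t ≤ 0}.Infinite
  · -- the drops accumulate at `s` from the left
    refine ⟨n₁, fun j => ?_⟩
    suffices h : ∃ r < s, ∃ N₀, ∀ N, N₀ ≤ N →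
        round w η (Finset.Icc n₁ N) j ≤ ((r : Time T) : WithTop (Time T)) by
      obtain ⟨r, -, N₀, h⟩ := h
      exact ⟨N₀, fun N hN => ⟨r, h N hN⟩⟩
    obtain ⟨-, t₀, ht₀, -⟩ := hL.nonempty
    induction j with
    | zero => exact ⟨⊥, bot_le.trans_lt ht₀, 0, fun N _ => le_rfl⟩
    | succ j ih =>
      obtain ⟨r, hr, N₀, hN₀⟩ := ih
      obtain ⟨n, ⟨⟨t, hts, hnt⟩, hnr⟩, hn⟩ := (hL.sdiff (hlt r hr)).exists_gt n₁
      have hrt : r < t := by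
        by_contra! h
        exact hnr ⟨t, h, hnt⟩
      have : (𝓝[<] s).NeBot := nhdsLT_neBot_of_exists_lt ⟨t, hts⟩
      have hev : ∀ᶠ u in 𝓝[<] s, ∀ k ∈ P t, n₁ ≤ k → η < w k u := by
        rw [(hlt t hts).eventually_all]
        intro k _
        by_cases hk : n₁ ≤ k
        · have := ((hw k).tendsto s).eventually_const_lt (hn₁ k hk)
          filter_upwards [mem_nhdsWithin_of_mem_nhds this] with u hu _ using hu
        · exact Eventually.of_forall fun u h => absurd h hk
      obtain ⟨r', hr', htr', hr's⟩ := (hev.and (Ioo_mem_nhdsLT hts)).exists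
      refine ⟨r', hr's, max N₀ n, fun N hN => ?_⟩
      refine round_succ_le hw (n := n) (t := t)
        (Finset.mem_Icc.2 ⟨hn.le, (le_max_right _ _).trans hN⟩)
        ((hN₀ N ((le_max_left _ _).trans hN)).trans (WithTop.coe_le_coe.2 hrt.le)) hnt htr'.le
        fun k hk hu => (hr' k hu (Finset.mem_Icc.1 hk).1).le
  · -- the drops accumulate at `s` from the right only
    rw [Set.not_infinite] at hL
    obtain ⟨n₂, hn₂⟩ := hL.bddAbove
    set m := max n₁ (n₂ + 1) with hm
    have hpos : ∀ n, m ≤ n → ∀ t ≤ s, 0 < w n t := by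
      intro n hn t hts
      rcases hts.eq_or_lt with rfl | h
      · exact hη.trans (hn₁ n ((le_max_left _ _).trans hn))
      · by_contra! h'
        have := hn₂ (show n ∈ {n | ∃ t < s, w n t ≤ 0} from ⟨t, h, h'⟩)
        have := (le_max_right n₁ (n₂ + 1)).trans hn
        omega
    have hs_lt : s < ⊤ := by
      by_contra h
      obtain ⟨n, ⟨t, -, ht⟩, hn⟩ := hPtop.exists_gt m
      exact absurd (hpos n hn.le t ((not_lt_top_iff.1 h) ▸ le_top))
        (not_lt.2 ht)
    refine ⟨m, fun j => ?_⟩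
    suffices h : ∀ r, s < r → ∃ N₀, ∀ N, N₀ ≤ N →
        round w η (Finset.Icc m N) j < ((r : Time T) : WithTop (Time T)) by
      obtain ⟨N₀, h⟩ := h ⊤ hs_lt
      exact ⟨N₀, fun N hN => ⟨⊤, (h N hN).le⟩⟩
    induction j with
    | zero => exact fun r hr => ⟨0, fun N _ => WithTop.coe_lt_coe.2 (bot_le.trans_lt hr)⟩
    | succ j ih =>
      intro r hr
      obtain ⟨r₀, hsr₀, hr₀⟩ := exists_between hr
      obtain ⟨n₃, hn₃⟩ := hrec r₀
      have hev : ∀ᶠ u in 𝓝 s, ∀ k ∈ Finset.Icc m n₃, 0 < w k u := by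
        rw [Finset.eventually_all]
        intro k hk
        exact ((hw k).tendsto s).eventually_const_lt (hpos k (Finset.mem_Icc.1 hk).1 s le_rfl)
      obtain ⟨r₁, hr₁, hr₁'⟩ := exists_Ico_subset_of_mem_nhds hev ⟨r₀, hsr₀⟩
      obtain ⟨r₂, hsr₂, hr₂⟩ := exists_between (lt_min hr₁ hsr₀)
      obtain ⟨n, ⟨t, ht, hnt⟩, hn⟩ := (hgt r₂ hsr₂).exists_gt m
      have hst : s < t := by
        by_contra! h
        exact absurd hnt (not_le.2 (hpos n hn.le t h))
      obtain ⟨N₀, hN₀⟩ := ih t hst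
      refine ⟨max N₀ n, fun N hN => lt_of_le_of_lt ?_ (WithTop.coe_lt_coe.2 hr₀)⟩
      refine round_succ_le hw (n := n) (t := t)
        (Finset.mem_Icc.2 ⟨hn.le, (le_max_right _ _).trans hN⟩)
        (hN₀ N ((le_max_left _ _).trans hN)).le hnt
        (ht.trans (hr₂.le.trans (min_le_right _ _))) ?_
      rintro k hk ⟨u, hut, hku⟩
      have hmk := (Finset.mem_Icc.1 hk).1
      by_cases hkn : n₃ ≤ k
      · exact (hn₃ k hkn).le
      · have hsu : s < u := by
          by_contra! h
          exact absurd hku (not_le.2 (hpos k hmk u h))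
        have hur : u < r₁ := hut.trans_lt (ht.trans_lt (hr₂.trans_le (min_le_left _ _)))
        exact absurd hku (not_le.2 (hr₁' ⟨hsu.le, hur⟩ k (Finset.mem_Icc.2 ⟨hmk, by omega⟩)))

end Bet

/-! ### The bets as simple strategies -/

theorem isStoppingTime_restrict {τ : PricePath d T → WithTop (Time T)}
    (hτ : IsStoppingTime (natFiltration d T) τ) (E : PricePath d T → Prop) [DecidablePred E]
    (hE : MeasurableSet[hτ.measurableSpace] {ω | E ω}) :
    IsStoppingTime (natFiltration d T) fun ω => if E ω then τ ω else ⊤ := by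
  intro t
  convert hE.2 t using 1
  ext ω
  simp only [Set.mem_ofPred_eq, Set.mem_inter_iff]
  split_ifs with h <;> simp [h]

theorem isStoppingTime_finset_inf {ι : Type*} (F : Finset ι)
    {τ : ι → PricePath d T → WithTop (Time T)}
    (hτ : ∀ i, IsStoppingTime (natFiltration d T) (τ i)) :
    IsStoppingTime (natFiltration d T) fun ω => F.inf fun i => τ i ω := by
  classical
  induction F using Finset.induction_on with
  | empty => intro t; simp
  | insert i F hi ih =>
    simp_rw [Finset.inf_insert]
    exact (hτ i).min ih

namespace Bet

variable {W : ℕ → Time T → PricePath d T → ℝ} {ρ : PricePath d T → WithTop (Time T)}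

theorem isStoppingTime_buy (hW : ∀ n, IsContAdapted (W n))
    (hρ : IsStoppingTime (natFiltration d T) ρ) (F : Finset ℕ) (n : ℕ) :
    IsStoppingTime (natFiltration d T) fun ω => buy (fun n t => W n t ω) F (ρ ω) n := by
  classical
  have hst : ∀ n, IsStoppingTime (natFiltration d T)
      fun ω => start (fun n t => W n t ω) (ρ ω) n := fun n =>
    isStoppingTime_hitAfter (hW n).neg hρ
  unfold buy
  refine isStoppingTime_restrict (hst n) _ ?_
  have : {ω | ∀ k ∈ F, (k < n → start (fun n t => W n t ω) (ρ ω) n <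
      start (fun n t => W n t ω) (ρ ω) k) ∧ (n < k → start (fun n t => W n t ω) (ρ ω) n ≤
      start (fun n t => W n t ω) (ρ ω) k)} = ⋂ k ∈ F,
      {ω | k < n → start (fun n t => W n t ω) (ρ ω) n < start (fun n t => W n t ω) (ρ ω) k} ∩
      {ω | n < k → start (fun n t => W n t ω) (ρ ω) n ≤ start (fun n t => W n t ω) (ρ ω) k} := by
    ext ω
    simp
  rw [this]
  refine MeasurableSet.biInter F.countable_toSet fun k _ => MeasurableSet.inter ?_ ?_
  · by_cases h : k < n
    · simpa [h] using measurableSet_lt_stoppingTime (hst n) (hst k)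
    · simp [h]
  · by_cases h : n < k
    · simpa [h] using IsStoppingTime.measurableSet_le_stopping_time (hst n) (hst k)
    · simp [h]

theorem isStoppingTime_sell (hW : ∀ n, IsContAdapted (W n))
    (hρ : IsStoppingTime (natFiltration d T) ρ) (η : ℝ) (F : Finset ℕ) (n : ℕ) :
    IsStoppingTime (natFiltration d T) fun ω => sell (fun n t => W n t ω) η F (ρ ω) n :=
  isStoppingTime_hitAfter ((hW n).sub (.const η)) (isStoppingTime_buy hW hρ F n)

theorem isStoppingTime_round (hW : ∀ n, IsContAdapted (W n)) (η : ℝ) (F : Finset ℕ) (j : ℕ) :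
    IsStoppingTime (natFiltration d T) fun ω => round (fun n t => W n t ω) η F j := by
  induction j with
  | zero => exact isStoppingTime_const _ _
  | succ j ih => exact isStoppingTime_finset_inf F fun n => isStoppingTime_sell hW ih η F n

end Bet

/-- Wealth processes that eventually exceed `η > 0` at each fixed time, and are bounded from below
along the path, are typically positive on the whole time interval from some index on: otherwise one
could win any number of bets on the recovery of a process that has dropped to zero. -/
theorem vovkOuterMeasure_infinitely_many_drops {V : ℕ → Time T → PricePath d T → ℝ}
    (hV : ∀ n, IsGain (V n)) (x : ℝ) {η : ℝ} (hη : 0 < η) :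
    vovkOuterMeasure {ω | (∃ a : ℝ, ∀ n t, -a ≤ V n t ω) ∧
      (∀ t, ∃ n₀, ∀ n, n₀ ≤ n → η < x + V n t ω) ∧
      ∀ N, ∃ n, N ≤ n ∧ ∃ t, x + V n t ω ≤ 0} = 0 := by
  let W : ℕ → Time T → PricePath d T → ℝ := fun n t ω => x + V n t ω
  have hW : ∀ n, IsContAdapted (W n) := fun n => (IsContAdapted.const x).add (hV n).isContAdapted
  let U : ℕ → ℕ → Time T → PricePath d T → ℝ := fun m N t ω =>
    ∑ j ∈ Finset.range N, Bet.gain (fun n t => W n t ω) η (Finset.Icc m N)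
      (Bet.round (fun n t => W n t ω) η (Finset.Icc m N) j) t
  have hU : ∀ m N, IsGain (U m N) := by
    intro m N
    refine IsGain.sum _ fun j _ => IsGain.sum _ fun n _ => ?_
    have hρ := Bet.isStoppingTime_round hW η (Finset.Icc m N) j
    refine (((hV n).stopAt (Bet.isStoppingTime_sell hW hρ η (Finset.Icc m N) n)).sub
      ((hV n).stopAt (Bet.isStoppingTime_buy hW hρ (Finset.Icc m N) n))).congr fun t ω => ?_
    simp only [W]
    ring
  refine vovkOuterMeasure_mono_null ?_ (vovkOuterMeasure_iUnion_null fun m =>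
    vovkOuterMeasure_unbounded_gains (hU m))
  rintro ω ⟨⟨a, ha⟩, hrec, hdrop⟩
  have hc : ∀ n, Continuous fun t => W n t ω := fun n => (hW n).continuous ω
  have hlow : ∀ n t, -(max 0 (a - x)) ≤ W n t ω := fun n t => by
    have := ha n t
    have := le_max_right 0 (a - x)
    simp only [W]
    linarith
  obtain ⟨m, hm⟩ := Bet.exists_forall_round_le hc hη hrec hdrop
  have key := fun N t => (Bet.le_sum_gain (F := Finset.Icc m N) hc hη.le (le_max_left _ _)
    hlow t N).2
  refine Set.mem_iUnion.2 ⟨m, ⟨max 0 (a - x), fun N t => ?_⟩, fun L => ?_⟩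
  · have := key N t 0 (Nat.zero_le _) (by simp [Bet.round])
    simp only [Nat.cast_zero, zero_mul, zero_sub] at this
    exact this
  · obtain ⟨j, hj⟩ := exists_nat_ge ((L + max 0 (a - x)) / η)
    rw [div_le_iff₀ hη] at hj
    obtain ⟨N₀, hN₀⟩ := hm j
    refine ⟨max N₀ j, fun N hN => ?_⟩
    obtain ⟨t, ht⟩ := hN₀ N ((le_max_left _ _).trans hN)
    refine ⟨t, le_trans ?_ (key N t j ((le_max_right _ _).trans hN) ht)⟩
    linarith

/-! ### A discrete Burkholder–Davis–Gundy inequality -/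

namespace DiscreteBDG

/-- The estimate for a step `D` which is so large that it dominates the previous quadratic variation
`s²` and maximum `m`. -/
theorem sq_sub_sq_le_of_large_step {A A' s s' m D : ℝ} (hA : 0 < A)
    (hA2 : A ^ 2 = s ^ 2 + m ^ 2) (hs2 : s' ^ 2 = s ^ 2 + D ^ 2)
    (hlarge : 2 * A < s') (hA'2 : s' ^ 2 + (D - m) ^ 2 ≤ A' ^ 2) :
    2 * D ^ 2 - (A' - A) ^ 2 ≤ 6 * A * (s' - s) := by
  have hs' : 0 < s' := by linarith
  have hsA : s ≤ A := abs_le_of_sq_le_sq' (by nlinarith) hA.le |>.2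
  rcases le_or_gt A' (3 / 2 * s') with h | h
  · -- `1.61` is admissible since `(s' + 1.61 A)² ≥ s'² + 9 A²` for `s' ≥ 2 A`
    have h1 : D * m + 3 * A * s ≤ A * (s' + 1.61 * A) := by
      refine abs_le_of_sq_le_sq' ?_ (by positivity) |>.2
      have h2 : (D * m + 3 * A * s) ^ 2 ≤ (D ^ 2 + 9 * A ^ 2) * (m ^ 2 + s ^ 2) := by
        nlinarith [sq_nonneg (D * s - 3 * A * m)]
      have h3 : D ^ 2 + 9 * A ^ 2 ≤ (s' + 1.61 * A) ^ 2 := by nlinarith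
      calc (D * m + 3 * A * s) ^ 2 ≤ (D ^ 2 + 9 * A ^ 2) * (m ^ 2 + s ^ 2) := h2
        _ = A ^ 2 * (D ^ 2 + 9 * A ^ 2) := by rw [hA2]; ring
        _ ≤ A ^ 2 * (s' + 1.61 * A) ^ 2 := mul_le_mul_of_nonneg_left h3 (by positivity)
        _ = _ := by ring
    have h4 : A * A' ≤ A * (3 / 2 * s') := mul_le_mul_of_nonneg_left h hA.le
    have h5 : A * (2 * A) ≤ A * s' := mul_le_mul_of_nonneg_left hlarge.le hA.le
    nlinarith
  · have h1 : A * (2 * s) ≤ A * s' := mul_le_mul_of_nonneg_left (by linarith) hA.le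
    have h2 : 0 ≤ (A' - 3 / 2 * s') * (A' + 3 / 2 * s' - 2 * A) :=
      mul_nonneg (by linarith) (by linarith)
    nlinarith

/-- `potential_step` for a step that does not exceed the running maximum. -/
theorem potential_step_of_le_max {A A' s s' m q x Δ : ℝ} (hA : 0 < A) (hA' : 0 ≤ A')
    (hs' : 0 ≤ s') (hq : 0 ≤ q) (hx : |x| ≤ m) (hcase : |x + Δ| ≤ m) (hA2 : A ^ 2 = q + m ^ 2)
    (hA'2 : A' ^ 2 = q + Δ ^ 2 + m ^ 2) (hs2 : s ^ 2 = q) (hs'2 : s' ^ 2 = q + Δ ^ 2) :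
    A' + ((x + Δ) ^ 2 + (q + Δ ^ 2)) / A' - 6 * s' ≤
      A + (x ^ 2 + q) / A - 6 * s + 2 * (x / A) * Δ := by
  have hss' : s ≤ s' := abs_le_of_sq_le_sq' (by linarith [sq_nonneg Δ]) hs' |>.2
  have hAA' : A ≤ A' := abs_le_of_sq_le_sq' (by linarith [sq_nonneg Δ]) hA' |>.2
  have hsA : s ≤ A := abs_le_of_sq_le_sq' (by linarith [sq_nonneg m]) hA.le |>.2
  have hs'A' : s' ≤ A' := abs_le_of_sq_le_sq' (by linarith [sq_nonneg m]) hA' |>.2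
  have hΔ : Δ ^ 2 = (s' - s) * (s' + s) := by linarith [hs2, hs'2]
  have hΔm : Δ ^ 2 ≤ 4 * m ^ 2 := by
    have h0 : |Δ| ≤ 2 * m := by
      calc |Δ| = |(x + Δ) - x| := by ring_nf
        _ ≤ |x + Δ| + |x| := abs_sub _ _
        _ ≤ _ := by linarith
    have := sq_le_sq' (by linarith [abs_nonneg Δ]) h0
    rw [sq_abs] at this
    linarith
  have h1 : s + s' ≤ 5 / 2 * A := by
    refine abs_le_of_sq_le_sq' ?_ (by positivity) |>.2
    have := sq_nonneg (3 * s - s')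
    have : (5 / 2 * A) ^ 2 = 25 / 4 * (q + m ^ 2) := by rw [← hA2]; ring
    have := sq_nonneg m
    linarith
  have h2 : A' - A ≤ s' - s := by
    have h3 : (A' - A) * (A' + A) = (s' - s) * (s' + s) := by linarith
    have h4 : (s' - s) * (s' + s) ≤ (s' - s) * (A' + A) :=
      mul_le_mul_of_nonneg_left (by linarith) (by linarith)
    exact le_of_mul_le_mul_right (h3.trans_le h4) (by linarith)
  have h3 : 2 * Δ ^ 2 / A ≤ 5 * (s' - s) := by
    rw [div_le_iff₀ hA, hΔ]
    linarith [mul_le_mul_of_nonneg_left h1 (sub_nonneg.2 hss')]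
  have h4 : ((x + Δ) ^ 2 + (q + Δ ^ 2)) / A' ≤ ((x + Δ) ^ 2 + (q + Δ ^ 2)) / A :=
    div_le_div_of_nonneg_left (by positivity) hA hAA'
  have h5 : ((x + Δ) ^ 2 + (q + Δ ^ 2)) / A =
      (x ^ 2 + q) / A + 2 * (x / A) * Δ + 2 * Δ ^ 2 / A := by
    field_simp
    ring
  linarith

/-- `potential_step` for a step to a new maximum. -/
theorem potential_step_of_max_le {A A' s s' m q x Δ : ℝ} (hA : 0 < A) (hA' : 0 ≤ A')
    (hs' : 0 ≤ s') (hx : |x| ≤ m) (hcase : m ≤ |x + Δ|) (hA2 : A ^ 2 = q + m ^ 2)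
    (hA'2 : A' ^ 2 = q + Δ ^ 2 + (x + Δ) ^ 2) (hs2 : s ^ 2 = q) (hs'2 : s' ^ 2 = q + Δ ^ 2) :
    A' + ((x + Δ) ^ 2 + (q + Δ ^ 2)) / A' - 6 * s' ≤
      A + (x ^ 2 + q) / A - 6 * s + 2 * (x / A) * Δ := by
  have hm : 0 ≤ m := (abs_nonneg x).trans hx
  have hss' : s ≤ s' := abs_le_of_sq_le_sq' (by linarith [sq_nonneg Δ]) hs' |>.2
  have hsA : s ≤ A := abs_le_of_sq_le_sq' (by linarith [sq_nonneg m]) hA.le |>.2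
  have hΔ : Δ ^ 2 = (s' - s) * (s' + s) := by linarith [hs2, hs'2]
  have hm2 : m ^ 2 ≤ (x + Δ) ^ 2 := by
    rw [← sq_abs (x + Δ)]
    exact pow_le_pow_left₀ hm hcase 2
  have hA'pos : 0 < A' := hA.trans_le
    (abs_le_of_sq_le_sq' (by linarith [sq_nonneg Δ]) hA' |>.2)
  have h1 : ((x + Δ) ^ 2 + (q + Δ ^ 2)) / A' = A' := by
    rw [div_eq_iff hA'pos.ne']
    linarith
  have h2 : 2 * Δ ^ 2 - (A' - A) ^ 2 ≤ 6 * A * (s' - s) := by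
    rcases le_or_gt s' (2 * A) with h | h
    · have := mul_le_mul_of_nonneg_left (show s' + s ≤ 3 * A by linarith)
        (sub_nonneg.2 hss')
      linarith [sq_nonneg (A' - A)]
    · have hD : m ≤ |Δ| := by
        refine abs_le_of_sq_le_sq' ?_ (abs_nonneg Δ) |>.2
        rw [sq_abs]
        have : (2 * A) ^ 2 ≤ s' ^ 2 := pow_le_pow_left₀ (by positivity) h.le 2
        have := sq_nonneg s
        have := sq_nonneg m
        linarith
      have hxD : |Δ| - m ≤ |x + Δ| := by
        have : |Δ| ≤ |x + Δ| + |x| := by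
          calc |Δ| = |(x + Δ) - x| := by ring_nf
            _ ≤ |x + Δ| + |x| := abs_sub _ _
        linarith
      have hxD2 : (|Δ| - m) ^ 2 ≤ (x + Δ) ^ 2 := by
        rw [← sq_abs (x + Δ)]
        exact pow_le_pow_left₀ (by linarith) hxD 2
      have := sq_sub_sq_le_of_large_step (A' := A') (s := s) (s' := s') (m := m) (D := |Δ|) hA
        (by rw [hA2, hs2]) (by rw [hs'2, hs2, sq_abs]) h (by rw [hs'2, hA'2]; linarith)
      rwa [sq_abs] at this
  rw [h1]
  have h3 : A' + A' - (A + (x ^ 2 + q) / A + 2 * (x / A) * Δ) =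
      (2 * Δ ^ 2 - (A' - A) ^ 2) / A := by
    field_simp
    linarith
  have h4 : (2 * Δ ^ 2 - (A' - A) ^ 2) / A ≤ 6 * (s' - s) := by
    rw [div_le_iff₀ hA]
    linarith
  linarith

/-- The potential `A + (x² + q) / A - 6 √q`, with `A = √(q + m²)`, increases by at most
`2 (x / A) Δ` when the sequence moves from `x` to `x + Δ`. -/
theorem potential_step {x m q Δ : ℝ} (hx : |x| ≤ m) (hq : 0 ≤ q) :
    √(q + Δ ^ 2 + (max m |x + Δ|) ^ 2) +
        ((x + Δ) ^ 2 + (q + Δ ^ 2)) / √(q + Δ ^ 2 + (max m |x + Δ|) ^ 2) - 6 * √(q + Δ ^ 2) ≤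
      √(q + m ^ 2) + (x ^ 2 + q) / √(q + m ^ 2) - 6 * √q + 2 * (x / √(q + m ^ 2)) * Δ := by
  have hm : 0 ≤ m := (abs_nonneg x).trans hx
  have hA2 : √(q + m ^ 2) ^ 2 = q + m ^ 2 := Real.sq_sqrt (by positivity)
  have hs2 : √q ^ 2 = q := Real.sq_sqrt hq
  have hs'2 : √(q + Δ ^ 2) ^ 2 = q + Δ ^ 2 := Real.sq_sqrt (by positivity)
  rcases (Real.sqrt_nonneg (q + m ^ 2)).eq_or_lt with hA0 | hA0
  · -- at the start of the sequence everything vanishes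
    rw [← hA0] at hA2
    obtain rfl : q = 0 := by nlinarith
    obtain rfl : m = 0 := by nlinarith
    obtain rfl : x = 0 := abs_eq_zero.1 (le_antisymm hx (abs_nonneg x))
    have h1 : ∀ a b : ℝ, 0 ≤ a → 0 ≤ b → a ^ 2 = 2 * b ^ 2 →
        a + (b ^ 2 + b ^ 2) / a ≤ 6 * b := by
      intro a b ha hb hab
      have h2 : (b ^ 2 + b ^ 2) / a = a := by
        rcases ha.eq_or_lt with h | h
        · rw [← h, div_zero]
        · rw [div_eq_iff h.ne']
          linarith
      have h3 : a ≤ 3 * b := abs_le_of_sq_le_sq' (by nlinarith) (by positivity) |>.2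
      linarith
    have h4 := h1 (√(Δ ^ 2 + |Δ| ^ 2)) |Δ| (Real.sqrt_nonneg _) (abs_nonneg Δ)
      (by rw [Real.sq_sqrt (by positivity), sq_abs]; ring)
    simp only [zero_add, max_eq_right (abs_nonneg Δ), Real.sqrt_sq_eq_abs] at h4 ⊢
    norm_num
    simpa using h4
  · rcases le_or_gt |x + Δ| m with hcase | hcase
    · rw [max_eq_left hcase]
      exact potential_step_of_le_max hA0 (Real.sqrt_nonneg _) (Real.sqrt_nonneg _) hq hx hcase
        hA2 (Real.sq_sqrt (by positivity)) hs2 hs'2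
    · rw [max_eq_right hcase.le, sq_abs]
      exact potential_step_of_max_le hA0 (Real.sqrt_nonneg _) (Real.sqrt_nonneg _) hx hcase.le
        hA2 (Real.sq_sqrt (by positivity)) hs2 hs'2

/-- The quadratic variation of a sequence. -/
def qv (x : ℕ → ℝ) (k : ℕ) : ℝ := ∑ j ∈ Finset.range k, (x (j + 1) - x j) ^ 2

/-- The running maximum of the absolute value of a sequence. -/
def runMax (x : ℕ → ℝ) : ℕ → ℝ
  | 0 => |x 0|
  | k + 1 => max (runMax x k) |x (k + 1)|

/-- The integrand in the pathwise Burkholder–Davis–Gundy inequality. It is `0` as long as the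
sequence is, by the convention on division by zero. -/
def weight (x : ℕ → ℝ) (k : ℕ) : ℝ := x k / √(qv x k + runMax x k ^ 2)

variable (x : ℕ → ℝ)

theorem qv_nonneg (k : ℕ) : 0 ≤ qv x k := Finset.sum_nonneg fun _ _ => sq_nonneg _

theorem abs_le_runMax {j k : ℕ} (h : j ≤ k) : |x j| ≤ runMax x k := by
  induction k with
  | zero =>
    obtain rfl : j = 0 := by omega
    exact le_rfl
  | succ k ih =>
    rcases Nat.lt_or_ge j (k + 1) with h' | h'
    · exact (ih (by omega)).trans (le_max_left _ _)
    · obtain rfl : j = k + 1 := by omega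
      exact le_max_right _ _

/-- The pathwise Burkholder–Davis–Gundy inequality of Beiglböck and Siorpaes. -/
theorem runMax_le (h0 : x 0 = 0) (N : ℕ) :
    runMax x N ≤ 6 * √(qv x N) +
      ∑ k ∈ Finset.range N, 2 * weight x k * (x (k + 1) - x k) := by
  have key : √(qv x N + runMax x N ^ 2) + (x N ^ 2 + qv x N) / √(qv x N + runMax x N ^ 2) -
      6 * √(qv x N) ≤ ∑ k ∈ Finset.range N, 2 * weight x k * (x (k + 1) - x k) := by
    induction N with
    | zero => simp [qv, runMax, h0]
    | succ N ih =>
      have hstep := potential_step (Δ := x (N + 1) - x N) (abs_le_runMax x (le_refl N))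
        (qv_nonneg x N)
      rw [Finset.sum_range_succ]
      have h1 : qv x (N + 1) = qv x N + (x (N + 1) - x N) ^ 2 := Finset.sum_range_succ _ _
      have h2 : runMax x (N + 1) = max (runMax x N) |x (N + 1)| := rfl
      rw [add_sub_cancel] at hstep
      rw [h1, h2]
      unfold weight at ih ⊢
      linarith
  have h1 : runMax x N ≤ √(qv x N + runMax x N ^ 2) :=
    Real.le_sqrt_of_sq_le (by linarith [qv_nonneg x N])
  have h2 : 0 ≤ (x N ^ 2 + qv x N) / √(qv x N + runMax x N ^ 2) :=
    div_nonneg (add_nonneg (sq_nonneg _) (qv_nonneg x N)) (Real.sqrt_nonneg _)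
  linarith

end DiscreteBDG

/-! ### Quadratic variation along partitions -/

namespace Grid

variable (R : Grid d T)

theorem finite_range (ω : PricePath d T) : (Set.range fun k => R.τ k ω).Finite := by
  obtain ⟨K, hK⟩ := R.exists_top ω
  refine ((Finset.range (K + 1)).image fun l => R.τ l ω).finite_toSet.subset ?_
  rintro _ ⟨l, rfl⟩
  simp only [Finset.coe_image, Finset.coe_range, Set.mem_image, Set.mem_Iio]
  rcases le_total l K with h | h
  · exact ⟨l, by omega, rfl⟩
  · exact ⟨K, by omega, hK.trans (eq_top_of_le (R.monotone ω) hK h).symm⟩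

theorem noCross_self (ω : PricePath d T) (j : ℕ) : NoCross (R.times ω) (R.times ω j) := by
  intro k hk
  have hkj : k < j := by
    by_contra! h
    exact absurd (R.monotone ω h) (not_le.2 hk)
  exact R.monotone ω hkj

variable (p : ℕ → PricePath d T → EuclideanSpace ℝ (Fin d))

/-- At the `j`th time of the partition, or at `t` if it is earlier, the integral is a partial sum. -/
theorem integral_minTime (ω : PricePath d T) (j : ℕ) (t : Time T) :
    R.integral p (minTime (R.times ω j) t) ω =
      ∑ k ∈ Finset.range j, inner ℝ (p k ω) (incr (R.times ω) ω k t) := by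
  obtain ⟨K, hK⟩ := R.exists_top ω
  have hK' : R.times ω (max K j) = ⊤ := eq_top_of_le (R.monotone ω) hK (le_max_left _ _)
  rw [R.integral_eq_sum p hK']
  have hsub : Finset.range j ⊆ Finset.range (max K j) :=
    Finset.range_mono (le_max_right _ _)
  rw [← Finset.sum_subset hsub]
  · refine Finset.sum_congr rfl fun k hk => ?_
    rw [incr_minTime (R.monotone ω) (R.noCross_self ω j)]
    split_ifs with h
    · rfl
    · have h1 : R.times ω (k + 1) ≤ R.times ω j := R.monotone ω (Finset.mem_range.1 hk)
      have h2 : R.times ω k ≤ R.times ω (k + 1) := R.monotone ω k.le_succ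
      rw [incr_eq_zero (le_antisymm (h1.trans (not_lt.1 h)) h2)]
  · intro k _ hk
    rw [incr_minTime (R.monotone ω) (R.noCross_self ω j), if_neg, inner_zero_right]
    exact not_lt.2 (R.monotone ω (by simpa using hk))

theorem minTime_eq_of_incr_ne {ω : PricePath d T} {k : ℕ} {t : Time T}
    (h : incr (R.times ω) ω k t ≠ 0) : minTime (R.times ω k) t = minTime (R.times ω k) ⊤ := by
  have hk : R.times ω k ≤ t := by
    by_contra! h'
    exact h (incr_eq_zero_of_le (R.monotone ω) h'.le ω)
  rw [← WithTop.coe_inj, coe_minTime_of_le hk,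
    coe_minTime_of_le (hk.trans (WithTop.coe_le_coe.2 le_top))]

/-- Summation by parts: the square of an integral process is an integral process plus the sum of
the squared increments. -/
theorem integral_sq {ω : PricePath d T} {K : ℕ} (hK : R.times ω K = ⊤) (t : Time T) :
    R.integral p t ω ^ 2 =
      ∑ k ∈ Finset.range K, 2 * R.integral p (minTime (R.times ω k) ⊤) ω *
        inner ℝ (p k ω) (incr (R.times ω) ω k t) +
      ∑ k ∈ Finset.range K, (inner ℝ (p k ω) (incr (R.times ω) ω k t)) ^ 2 := by
  have htel : ∀ (x : ℕ → ℝ) (n : ℕ), (∑ k ∈ Finset.range n, x k) ^ 2 =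
      ∑ k ∈ Finset.range n, 2 * (∑ j ∈ Finset.range k, x j) * x k +
      ∑ k ∈ Finset.range n, x k ^ 2 := by
    intro x n
    induction n with
    | zero => simp
    | succ n ih =>
      rw [Finset.sum_range_succ, Finset.sum_range_succ _ n, Finset.sum_range_succ _ n, add_sq, ih]
      ring
  rw [R.integral_eq_sum p hK, htel]
  congr 1
  refine Finset.sum_congr rfl fun k _ => ?_
  by_cases h : incr (R.times ω) ω k t = 0
  · simp [h]
  · rw [← R.minTime_eq_of_incr_ne h, R.integral_minTime]

theorem integral_const (v : EuclideanSpace ℝ (Fin d)) (t : Time T) (ω : PricePath d T) :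
    R.integral (fun _ _ => v) t ω = inner ℝ v (ω t) - inner ℝ v (ω ⊥) := by
  obtain ⟨K, hK⟩ := R.exists_top ω
  rw [R.integral_eq_sum _ hK, ← inner_sum, sum_incr, hK, R.times_zero, minTime_top, minTime_bot,
    inner_sub_right]

/-- The sum of the squared increments of the path in the direction `v`. -/
def qv (v : EuclideanSpace ℝ (Fin d)) (t : Time T) (ω : PricePath d T) : ℝ :=
  ∑' k, (inner ℝ v (incr (R.times ω) ω k t)) ^ 2

theorem qv_eq_sum (v : EuclideanSpace ℝ (Fin d)) {ω : PricePath d T} {K : ℕ}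
    (hK : R.times ω K = ⊤) (t : Time T) :
    R.qv v t ω = ∑ k ∈ Finset.range K, (inner ℝ v (incr (R.times ω) ω k t)) ^ 2 :=
  R.tsum_eq_sum hK (fun _ x => (inner ℝ v x) ^ 2) (by simp) t

/-- The value of the path at the `k`th time, in the direction `v` and relative to its start. -/
def level (v : EuclideanSpace ℝ (Fin d)) (k : ℕ) (ω : PricePath d T) : ℝ :=
  inner ℝ v (ω (minTime (R.times ω k) ⊤)) - inner ℝ v (ω ⊥)

theorem measurable_level (v : EuclideanSpace ℝ (Fin d)) (k : ℕ) :
    Measurable[(R.isStoppingTime k).measurableSpace] (R.level v k) := by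
  have h : IsContAdapted fun (t : Time T) (ω : PricePath d T) =>
      inner ℝ v (ω t) - inner ℝ v (ω ⊥) := by
    have h0 : IsStoppingTime (natFiltration d T)
        fun _ => ((⊥ : Time T) : WithTop (Time T)) := isStoppingTime_const _ _
    have h1 := (IsContAdapted.inner_eval (T := T) v).sub ((IsContAdapted.inner_eval v).stopped h0)
    simpa only [minTime_bot] using h1
  exact h.measurable_stopped (R.isStoppingTime k)

/-- The sum of squares as the square of the path minus an integral. -/
theorem qv_eq (v : EuclideanSpace ℝ (Fin d)) (t : Time T) (ω : PricePath d T) :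
    R.qv v t ω = (inner ℝ v (ω t) - inner ℝ v (ω ⊥)) ^ 2 -
      2 * R.integral (fun k ω => R.level v k ω • v) t ω := by
  obtain ⟨K, hK⟩ := R.exists_top ω
  have h := R.integral_sq (fun _ _ => v) hK t
  simp_rw [R.integral_const v] at h
  rw [R.qv_eq_sum v hK, R.integral_eq_sum _ hK, h, Finset.mul_sum]
  simp_rw [real_inner_smul_left, level, mul_assoc]
  ring

/-- On each interval of the partition, the path moves by at most `c` in the direction `v`. -/
def OscLE (v : EuclideanSpace ℝ (Fin d)) (c : ℝ) : Prop :=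
  ∀ (ω : PricePath d T) (k : ℕ) (t : Time T), R.times ω k ≤ t → t ≤ R.times ω (k + 1) →
    |inner ℝ v (ω t) - inner ℝ v (ω (minTime (R.times ω k) ⊤))| ≤ c

variable {R}

/-- The value at the last time of a partition of small mesh is close to the current value. -/
theorem OscLE.abs_pull_level {v : EuclideanSpace ℝ (Fin d)} {c : ℝ} (h : R.OscLE v c)
    (M : Grid d T) {ω : PricePath d T} {k : ℕ} (hk : M.times ω k ≠ ⊤) :
    |pull (R.times ω) (fun l => R.level v l ω) (M.times ω) k - M.level v k ω| ≤ c := by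
  obtain ⟨K, hK⟩ := R.exists_top ω
  obtain ⟨l, hl⟩ := exists_mem_interval (R.times_zero ω) hK (lt_top_iff_ne_top.2 hk)
  obtain ⟨u, hu⟩ := exists_coe_eq_of_ne_top hk
  rw [pull_eq_of_mem (R.monotone ω) _ hl, level, level, sub_sub_sub_cancel_right, abs_sub_comm]
  rw [hu] at hl ⊢
  rw [minTime_coe, min_eq_left le_top]
  exact h ω l u hl.1 hl.2.le

/-- The squared difference of the sums of squares along two partitions is dominated by a gain
process, up to an error which is controlled by the mesh. The difference is `-2 D`, where `D` is an
integral with positions `ψ` of order `c` along a common refinement. Summation by parts applied to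
`D` and to the path itself expresses `D²` by integrals, up to the stated error. -/
theorem exists_gain_sq_sub_qv {R' : Grid d T} {v : EuclideanSpace ℝ (Fin d)} {c : ℝ}
    (h : R.OscLE v c) (h' : R'.OscLE v c) :
    ∃ Z : Time T → PricePath d T → ℝ, IsGain Z ∧ ∀ t ω,
      (R.qv v t ω - R'.qv v t ω) ^ 2 / 4 -
        4 * c ^ 2 * (inner ℝ v (ω t) - inner ℝ v (ω ⊥)) ^ 2 ≤ Z t ω := by
  let M := Grid.merge R.τ R'.τ R.isStoppingTime R'.isStoppingTime R.finite_range R'.finite_range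
  let a : ℕ → PricePath d T → ℝ := fun k ω =>
    pull (R.times ω) (fun l => R.level v l ω) (M.times ω) k
  let a' : ℕ → PricePath d T → ℝ := fun k ω =>
    pull (R'.times ω) (fun l => R'.level v l ω) (M.times ω) k
  have hconst : ∀ (R : Grid d T) ω, ∃ L, ∀ l, L ≤ l → R.τ l ω = R.τ L ω := fun R ω => by
    obtain ⟨K, hK⟩ := R.exists_top ω
    exact ⟨K, const_of_top (R.monotone ω) hK⟩
  have ha : ∀ k, Measurable[(M.isStoppingTime k).measurableSpace] (a k) := fun k =>
    M.measurable_pull R.isStoppingTime (hconst R) (R.measurable_level v) k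
  have ha' : ∀ k, Measurable[(M.isStoppingTime k).measurableSpace] (a' k) := fun k =>
    M.measurable_pull R'.isStoppingTime (hconst R') (R'.measurable_level v) k
  let ψ : ℕ → PricePath d T → ℝ := fun k ω => a k ω - a' k ω
  have hψ : ∀ k, Measurable[(M.isStoppingTime k).measurableSpace] (ψ k) := fun k =>
    (ha k).sub (ha' k)
  have hpull : ∀ (R : Grid d T), (∀ l ω, NoCross (M.times ω) (R.τ l ω)) → ∀ t ω,
      R.integral (fun k ω => R.level v k ω • v) t ω = M.integral (fun k ω =>
        pull (R.times ω) (fun l => R.level v l ω) (M.times ω) k • v) t ω := by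
    intro R hR t ω
    obtain ⟨K, hK⟩ := R.exists_top ω
    obtain ⟨K', hK'⟩ := M.exists_top ω
    rw [R.integral_eq_sum _ hK, M.integral_eq_sum _ hK']
    rw [sum_inner_incr_eq_pull (R.monotone ω) (M.monotone ω) (M.times_zero ω)
      (const_of_top (R.monotone ω) hK) hK' (fun l => hR l ω)]
    refine Finset.sum_congr rfl fun k _ => ?_
    rw [map_pull (R.monotone ω) (fun l => R.level v l ω) (M.times ω) k (fun x => x • v)
      (zero_smul ℝ v)]
  have hψle : ∀ k ω, ψ k ω ^ 2 ≤ 4 * c ^ 2 := by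
    intro k ω
    by_cases hk : M.times ω k = ⊤
    · have h0 : ∀ (R : Grid d T),
          pull (R.times ω) (fun l => R.level v l ω) (M.times ω) k = 0 := fun R =>
        pull_eq_zero _ fun l hl => by
          rw [hk] at hl
          exact not_top_lt hl.2
      have h1 : ψ k ω = 0 := by simp only [ψ, a, a', h0, sub_self]
      rw [h1, zero_pow two_ne_zero]
      positivity
    · have h1 := h.abs_pull_level M hk
      have h2 := h'.abs_pull_level M hk
      have h3 : |ψ k ω| ≤ 2 * c := by
        have : ψ k ω = (a k ω - M.level v k ω) - (a' k ω - M.level v k ω) := by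
          simp only [ψ]
          ring
        rw [this]
        refine (abs_sub _ _).trans ?_
        simp only [a, a']
        linarith
      calc ψ k ω ^ 2 = |ψ k ω| ^ 2 := (sq_abs _).symm
        _ ≤ (2 * c) ^ 2 := pow_le_pow_left₀ (abs_nonneg _) h3 2
        _ = 4 * c ^ 2 := by ring
  let D : Time T → PricePath d T → ℝ := M.integral fun k ω => ψ k ω • v
  have hDpos : M.IsPosition fun k ω => ψ k ω • v := fun k => (hψ k).smul_const v
  have hD : ∀ t ω, R.qv v t ω - R'.qv v t ω = -2 * D t ω := by
    intro t ω
    obtain ⟨K, hK⟩ := M.exists_top ω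
    rw [R.qv_eq, R'.qv_eq, hpull R (fun l ω => Grid.noCross_merge_left _ _ _ _ l ω),
      hpull R' (fun l ω => Grid.noCross_merge_right _ _ _ _ l ω)]
    simp only [D]
    rw [M.integral_eq_sum _ hK, M.integral_eq_sum _ hK, M.integral_eq_sum _ hK]
    simp only [ψ, a, a', sub_smul, inner_sub_left, Finset.sum_sub_distrib]
    ring
  have hDc : IsContAdapted D := M.isContAdapted_integral hDpos
  let q : ℕ → PricePath d T → EuclideanSpace ℝ (Fin d) := fun k ω =>
    (2 * D (minTime (M.τ k ω) ⊤) ω * ψ k ω - 8 * c ^ 2 * M.level v k ω) • v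
  have hq : M.IsPosition q := fun k =>
    ((((hDc.measurable_stopped (M.isStoppingTime k)).const_mul 2).mul (hψ k)).sub
      ((M.measurable_level v k).const_mul _)).smul_const v
  refine ⟨M.integral q, M.isGain hq, fun t ω => ?_⟩
  obtain ⟨K, hK⟩ := M.exists_top ω
  have h1 := M.integral_sq (fun k ω => ψ k ω • v) hK t
  have h2 := M.qv_eq v t ω
  rw [M.qv_eq_sum v hK, M.integral_eq_sum _ hK] at h2
  have h3 : ∑ k ∈ Finset.range K, (inner ℝ (ψ k ω • v) (incr (M.times ω) ω k t)) ^ 2 ≤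
      4 * c ^ 2 * ∑ k ∈ Finset.range K, (inner ℝ v (incr (M.times ω) ω k t)) ^ 2 := by
    rw [Finset.mul_sum]
    refine Finset.sum_le_sum fun k _ => ?_
    rw [real_inner_smul_left, mul_pow]
    exact mul_le_mul_of_nonneg_right (hψle k ω) (sq_nonneg _)
  have h4 : M.integral q t ω =
      ∑ k ∈ Finset.range K, 2 * D (minTime (M.times ω k) ⊤) ω *
        inner ℝ (ψ k ω • v) (incr (M.times ω) ω k t) -
      8 * c ^ 2 * ∑ k ∈ Finset.range K,
        inner ℝ (M.level v k ω • v) (incr (M.times ω) ω k t) := by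
    rw [M.integral_eq_sum _ hK, Finset.mul_sum, ← Finset.sum_sub_distrib]
    refine Finset.sum_congr rfl fun k _ => ?_
    simp only [q, times, real_inner_smul_left]
    ring
  have h5 : (-2 * D t ω) ^ 2 / 4 = D t ω ^ 2 := by ring
  have h6 : D t ω ^ 2 = _ := h1
  rw [h2] at h3
  rw [hD, h4, h5, h6]
  simp only [D]
  linarith

end Grid

/-- Along partitions with geometrically decreasing mesh the sums of squares are typically close to
each other, uniformly in time. -/
theorem vovkOuterMeasure_qv_not_close {v : EuclideanSpace ℝ (Fin d)} {R R' : ℕ → Grid d T} {C : ℝ}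
    (h : ∀ n, (R n).OscLE v (C * (2⁻¹ : ℝ) ^ n)) (h' : ∀ n, (R' n).OscLE v (C * (2⁻¹ : ℝ) ^ n)) :
    vovkOuterMeasure {ω | ¬ ∃ K : ℝ, ∀ n t,
      |(R n).qv v t ω - (R' n).qv v t ω| ≤ K * (3 / 4 : ℝ) ^ n} = 0 := by
  choose Z hZ hle using fun n => Grid.exists_gain_sq_sub_qv (h n) (h' n)
  -- the weights turn the errors of order `4⁻ⁿ` into a convergent series, and a bound of the sum
  -- into bounds of order `(3 / 4)ⁿ` for the differences
  have hV : ∀ N, IsGain fun t ω => ∑ n ∈ Finset.range N, (16 / 9 : ℝ) ^ n * Z n t ω := fun N =>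
    IsGain.sum _ fun n _ => (hZ n).const_mul _
  refine vovkOuterMeasure_mono_null ?_ (vovkOuterMeasure_unbounded_gains hV)
  intro ω hω
  obtain ⟨B, hB⟩ : ∃ B : ℝ, ∀ t : Time T, (inner ℝ v (ω t) - inner ℝ v (ω ⊥)) ^ 2 ≤ B := by
    have hc : Continuous fun t : Time T => (inner ℝ v (ω t) - inner ℝ v (ω ⊥) : ℝ) ^ 2 :=
      ((continuous_const.inner ω.continuous).sub continuous_const).pow 2
    obtain ⟨B, hB⟩ := (isCompact_range hc).bddAbove
    exact ⟨B, fun t => hB ⟨t, rfl⟩⟩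
  have hB0 : 0 ≤ B := (sq_nonneg _).trans (hB ⊥)
  have hgeom : ∀ N, ∑ n ∈ Finset.range N, (4 / 9 : ℝ) ^ n ≤ 9 / 5 := fun N => by
    have := (summable_geometric_of_lt_one (r := (4 / 9 : ℝ)) (by norm_num)
      (by norm_num)).sum_le_tsum (Finset.range N) fun _ _ => by positivity
    rw [tsum_geometric_of_lt_one (by norm_num) (by norm_num)] at this
    norm_num at this ⊢
    exact this
  have hlow : ∀ N t, ∑ n ∈ Finset.range N, (16 / 9 : ℝ) ^ n *
      (((R n).qv v t ω - (R' n).qv v t ω) ^ 2 / 4) - 4 * C ^ 2 * B * (9 / 5) ≤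
      ∑ n ∈ Finset.range N, (16 / 9 : ℝ) ^ n * Z n t ω := by
    intro N t
    have h1 : ∑ n ∈ Finset.range N, ((16 / 9 : ℝ) ^ n *
        (((R n).qv v t ω - (R' n).qv v t ω) ^ 2 / 4) - 4 * C ^ 2 * B * (4 / 9 : ℝ) ^ n) ≤
        ∑ n ∈ Finset.range N, (16 / 9 : ℝ) ^ n * Z n t ω := by
      refine Finset.sum_le_sum fun n _ => ?_
      have h2 := mul_le_mul_of_nonneg_left (hle n t ω)
        (show (0 : ℝ) ≤ (16 / 9 : ℝ) ^ n by positivity)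
      have h3 : (16 / 9 : ℝ) ^ n * (4 * (C * (2⁻¹ : ℝ) ^ n) ^ 2) = 4 * C ^ 2 * (4 / 9 : ℝ) ^ n := by
        rw [show (4 / 9 : ℝ) = 16 / 9 * 2⁻¹ ^ 2 by norm_num, mul_pow C, ← pow_mul, mul_comm n 2,
          pow_mul, mul_pow]
        ring
      have h4 : (16 / 9 : ℝ) ^ n * (4 * (C * (2⁻¹ : ℝ) ^ n) ^ 2) *
          (inner ℝ v (ω t) - inner ℝ v (ω ⊥)) ^ 2 ≤ 4 * C ^ 2 * (4 / 9 : ℝ) ^ n * B := by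
        rw [h3]
        exact mul_le_mul_of_nonneg_left (hB t) (by positivity)
      linarith
    rw [Finset.sum_sub_distrib, ← Finset.mul_sum] at h1
    have h5 := mul_le_mul_of_nonneg_left (hgeom N)
      (show (0 : ℝ) ≤ 4 * C ^ 2 * B by positivity)
    linarith
  refine ⟨⟨4 * C ^ 2 * B * (9 / 5), fun N t => ?_⟩, ?_⟩
  · refine le_trans ?_ (hlow N t)
    have : 0 ≤ ∑ n ∈ Finset.range N, (16 / 9 : ℝ) ^ n *
      (((R n).qv v t ω - (R' n).qv v t ω) ^ 2 / 4) := Finset.sum_nonneg fun n _ => by positivity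
    linarith
  · by_contra! hbdd
    obtain ⟨L, hL⟩ := hbdd
    refine hω ⟨2 * √(L + 4 * C ^ 2 * B * (9 / 5)), fun n t => ?_⟩
    obtain ⟨N, hnN, hN⟩ := hL (n + 1)
    have h1 : (16 / 9 : ℝ) ^ n * (((R n).qv v t ω - (R' n).qv v t ω) ^ 2 / 4) ≤
        L + 4 * C ^ 2 * B * (9 / 5) := by
      have h2 := Finset.single_le_sum (f := fun n => (16 / 9 : ℝ) ^ n *
        (((R n).qv v t ω - (R' n).qv v t ω) ^ 2 / 4)) (fun i _ => by positivity)
        (Finset.mem_range.2 hnN)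
      linarith [hlow N t, hN t]
    set Q := (R n).qv v t ω - (R' n).qv v t ω
    have h3 : ((4 / 3 : ℝ) ^ n * |Q| / 2) ^ 2 ≤ L + 4 * C ^ 2 * B * (9 / 5) := by
      refine le_trans (le_of_eq ?_) h1
      rw [div_pow, mul_pow, sq_abs, ← pow_mul, mul_comm n 2, pow_mul]
      norm_num
      ring
    have h4 := Real.le_sqrt_of_sq_le h3
    have h5 : (3 / 4 : ℝ) ^ n * (4 / 3 : ℝ) ^ n = 1 := by
      rw [← mul_pow]
      norm_num
    calc |Q| = 2 * ((4 / 3 : ℝ) ^ n * |Q| / 2) * (3 / 4 : ℝ) ^ n := by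
          linear_combination -|Q| * h5
      _ ≤ _ := by gcongr

/-! ### Lebesgue partitions -/

/-- If `ρ` refines `τ`, then a time which is not crossed by `τ` is not crossed by `ρ`. -/
theorem NoCross.trans {τ ρ : ℕ → WithTop (Time T)} (h0 : τ 0 = ((⊥ : Time T) : WithTop (Time T)))
    {K : ℕ} (hK : τ K = ⊤) (h : ∀ l, NoCross ρ (τ l)) {a : WithTop (Time T)} (ha : NoCross τ a) :
    NoCross ρ a := by
  intro k hk
  obtain ⟨l, hl⟩ := exists_mem_interval h0 hK (hk.trans_le le_top)
  exact (h (l + 1) k hl.2).trans (ha l (hl.1.trans_lt hk))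

section lebesguePartition

variable {f : Time T → ℝ}

/-- The continuous process whose first nonnegative value marks the end of a step of size `2⁻ⁿ`
which starts at `ρ`. -/
def excess (f : Time T → ℝ) (n : ℕ) (ρ : WithTop (Time T)) (t : Time T) : ℝ :=
  |f t - f (minTime ρ t)| - (2⁻¹ : ℝ) ^ n

theorem continuous_excess (hf : Continuous f) (n : ℕ) (ρ : WithTop (Time T)) :
    Continuous (excess f n ρ) :=
  ((hf.sub (hf.comp (IsContAdapted.continuous_minTime ρ))).abs).sub continuous_const

theorem excess_of_le (f : Time T → ℝ) (n : ℕ) {u t : Time T} (h : u ≤ t) :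
    excess f n u t = |f t - f u| - (2⁻¹ : ℝ) ^ n := by
  rw [excess, minTime_coe, min_eq_left h]

theorem lebesguePartition_succ_le {n k : ℕ} {u t : Time T} (hu : lebesguePartition f n k = u)
    (hut : u ≤ t) (h : excess f n u t = 0) : lebesguePartition f n (k + 1) ≤ t := by
  rw [excess_of_le f n hut, sub_eq_zero] at h
  exact sInf_le ⟨u, t, hu, hut, h, rfl⟩

theorem exists_excess_eq_zero (hf : Continuous f) (n : ℕ) {u t : Time T} (hut : u ≤ t)
    (h : 0 ≤ excess f n u t) : ∃ s, u ≤ s ∧ s ≤ t ∧ excess f n u s = 0 := by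
  have h0 : excess f n u u ≤ 0 := by
    rw [excess_of_le f n le_rfl, sub_self, abs_zero, zero_sub, neg_nonpos]
    positivity
  obtain ⟨s, hs, hs0⟩ := intermediate_value_Icc hut
    (continuous_excess hf n (u : WithTop (Time T))).continuousOn ⟨h0, h⟩
  exact ⟨s, hs.1, hs.2, hs0⟩

/-- The recursion as a hitting time, which shows that the partition consists of stopping times. By
the intermediate value theorem the increment is exactly `2⁻ⁿ` when it first is at least `2⁻ⁿ`. -/
theorem lebesguePartition_succ (hf : Continuous f) (n k : ℕ) :
    lebesguePartition f n (k + 1) =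
      hitAfter (lebesguePartition f n k) (excess f n (lebesguePartition f n k)) := by
  refine le_antisymm ?_ ?_
  · rcases eq_or_ne (hitAfter (lebesguePartition f n k) (excess f n (lebesguePartition f n k))) ⊤
      with h | h
    · rw [h]
      exact le_top
    · obtain ⟨t, ht⟩ := exists_coe_eq_of_ne_top h
      have h1 := nonneg_of_hitAfter_eq (continuous_excess hf n _) ht
      have h2 : lebesguePartition f n k ≤ t := ht ▸ le_hitAfter _ _
      obtain ⟨u, hu⟩ := exists_coe_eq_of_ne_top (ne_top_of_le_ne_top WithTop.coe_ne_top h2)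
      rw [hu] at h1 h2
      obtain ⟨s, hus, hst, hs⟩ := exists_excess_eq_zero hf n (WithTop.coe_le_coe.1 h2) h1
      rw [ht]
      exact (lebesguePartition_succ_le hu hus hs).trans (WithTop.coe_le_coe.2 hst)
  · refine le_sInf ?_
    rintro s ⟨u, t, hu, hut, h, rfl⟩
    refine hitAfter_le (hu ▸ WithTop.coe_le_coe.2 hut) ?_
    rw [hu, excess_of_le f n hut, h, sub_self]

theorem lebesguePartition_le_succ (hf : Continuous f) (n k : ℕ) :
    lebesguePartition f n k ≤ lebesguePartition f n (k + 1) := by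
  rw [lebesguePartition_succ hf]
  exact le_hitAfter _ _

theorem abs_sub_le_of_mem_lebesguePartition (hf : Continuous f) {n k : ℕ} {u t : Time T}
    (hu : lebesguePartition f n k = u) (hut : u ≤ t)
    (ht : (t : WithTop (Time T)) ≤ lebesguePartition f n (k + 1)) :
    |f t - f u| ≤ (2⁻¹ : ℝ) ^ n := by
  by_contra! h
  have h1 : 0 < excess f n u t := by
    rw [excess_of_le f n hut]
    linarith
  obtain ⟨s, hus, hst, hs⟩ := exists_excess_eq_zero hf n hut h1.le
  have : t ≤ s := WithTop.coe_le_coe.1 (ht.trans (lebesguePartition_succ_le hu hus hs))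
  rw [le_antisymm hst this] at hs
  exact h1.ne' hs

/-- A continuous function on `[0, T]` makes finitely many steps of size `2⁻ⁿ`. -/
theorem exists_lebesguePartition_eq_top (hf : Continuous f) (n : ℕ) :
    ∃ K, lebesguePartition f n K = ⊤ := by
  by_contra! h
  choose u hu using fun k => exists_coe_eq_of_ne_top (h k)
  have hmono : Monotone u := monotone_nat_of_le_succ fun k => by
    rw [← WithTop.coe_le_coe, ← hu, ← hu]
    exact lebesguePartition_le_succ hf n k
  have hstep : ∀ k, (2⁻¹ : ℝ) ^ n ≤ |f (u (k + 1)) - f (u k)| := by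
    intro k
    have h1 : 0 ≤ excess f n (lebesguePartition f n k) (u (k + 1)) :=
      nonneg_of_hitAfter_eq (continuous_excess hf n _)
        ((lebesguePartition_succ hf n k).symm.trans (hu (k + 1)))
    rw [hu k, excess_of_le f n (hmono k.le_succ)] at h1
    linarith
  have hlim : Tendsto (fun k => f (u k)) atTop (𝓝 (f (⨆ k, u k))) :=
    (hf.tendsto _).comp (tendsto_atTop_iSup hmono)
  have h0 : Tendsto (fun k => |f (u (k + 1)) - f (u k)|) atTop (𝓝 0) := by
    have := ((hlim.comp (tendsto_add_atTop_nat 1)).sub hlim).abs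
    rwa [sub_self, abs_zero] at this
  have h1 := ge_of_tendsto' h0 hstep
  have h2 : (0 : ℝ) < 2⁻¹ ^ n := by positivity
  linarith

theorem isStoppingTime_lebesguePartition {Y : Time T → PricePath d T → ℝ} (hY : IsContAdapted Y)
    (n k : ℕ) :
    IsStoppingTime (natFiltration d T) fun ω => lebesguePartition (fun t => Y t ω) n k := by
  induction k with
  | zero => exact isStoppingTime_const _ _
  | succ k ih =>
    have := isStoppingTime_hitAfter ((hY.sub (hY.stopped ih)).abs.sub (.const ((2⁻¹ : ℝ) ^ n))) ih
    convert this using 2 with ω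
    exact lebesguePartition_succ (hY.continuous ω) n k

end lebesguePartition

/-- The indices of the directions `eᵢ` and `eᵢ + eⱼ`, `i ≠ j`. -/
abbrev DirIndex (d : ℕ) : Type := Fin d ⊕ {p : Fin d × Fin d // p.1 ≠ p.2}

/-- The directions whose Lebesgue partitions make up the partitions of a path. -/
def dir : DirIndex d → EuclideanSpace ℝ (Fin d)
  | .inl i => EuclideanSpace.single i 1
  | .inr p => EuclideanSpace.single p.1.1 1 + EuclideanSpace.single p.1.2 1

theorem inner_dir_inl (i : Fin d) (x : EuclideanSpace ℝ (Fin d)) :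
    (inner ℝ (dir (.inl i)) x : ℝ) = x i := by
  simp [dir, EuclideanSpace.inner_single_left]

theorem inner_dir_inr (p : {p : Fin d × Fin d // p.1 ≠ p.2}) (x : EuclideanSpace ℝ (Fin d)) :
    (inner ℝ (dir (.inr p)) x : ℝ) = x p.1.1 + x p.1.2 := by
  simp [dir, inner_add_left, EuclideanSpace.inner_single_left]

/-- The `m`th point of the `n`th Lebesgue partition in the direction `dir a`. -/
def dirPartition (n : ℕ) (a : DirIndex d) (m : ℕ) (ω : PricePath d T) : WithTop (Time T) :=
  lebesguePartition (fun t => inner ℝ (dir a) (ω t)) n m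

theorem continuous_inner_path (v : EuclideanSpace ℝ (Fin d)) (ω : PricePath d T) :
    Continuous fun t => (inner ℝ v (ω t) : ℝ) := continuous_const.inner ω.continuous

/-- The partitions `pathPartition` as stopping times. -/
def lebesgueGrid (d : ℕ) (T : ℝ) [Fact (0 < T)] (n : ℕ) : Grid d T :=
  Grid.ofFamily (fun (a : DirIndex d × ℕ) ω => dirPartition n a.1 a.2 ω)
    (fun a => isStoppingTime_lebesguePartition (.inner_eval _) n a.2) fun ω => by
      have : (Set.range fun a : DirIndex d × ℕ => dirPartition n a.1 a.2 ω) =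
          ⋃ a : DirIndex d, Set.range fun m => dirPartition n a m ω := by
        ext s
        simp
      rw [this]
      refine Set.finite_iUnion fun a => ?_
      obtain ⟨K, hK⟩ := exists_lebesguePartition_eq_top (continuous_inner_path (dir a) ω) n
      have hmono : Monotone fun m => dirPartition n a m ω :=
        monotone_nat_of_le_succ (lebesguePartition_le_succ (continuous_inner_path (dir a) ω) n)
      refine ((Finset.range (K + 1)).image fun m => dirPartition n a m ω).finite_toSet.subset ?_
      rintro _ ⟨m, rfl⟩
      simp only [Finset.coe_image, Finset.coe_range, Set.mem_image, Set.mem_Iio]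
      rcases le_total m K with h | h
      · exact ⟨m, by omega, rfl⟩
      · exact ⟨K, by omega, (Grid.const_of_top hmono hK m h).symm⟩

theorem noCross_lebesgueGrid (n : ℕ) (a : DirIndex d) (m : ℕ) (ω : PricePath d T) :
    NoCross ((lebesgueGrid d T n).times ω) (dirPartition n a m ω) :=
  Grid.noCross_ofFamily (fun (a : DirIndex d × ℕ) ω => dirPartition n a.1 a.2 ω) _ _ (a, m) ω

theorem pathPartition_eq (ω : PricePath d T) (n k : ℕ) :
    pathPartition ω n k = (lebesgueGrid d T n).times ω k := by
  induction k with
  | zero => rfl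
  | succ k ih =>
    change _ = sInf {s | (lebesgueGrid d T n).times ω k < s ∧
      s ∈ Set.range fun a : DirIndex d × ℕ => dirPartition n a.1 a.2 ω}
    rw [← ih, pathPartition]
    congr 1
    ext s
    refine and_congr_right fun _ => ⟨?_, ?_⟩
    · rintro (⟨i, m, rfl⟩ | ⟨i, j, m, hij, rfl⟩)
      · exact ⟨(.inl i, m), by simp only [dirPartition, inner_dir_inl]⟩
      · exact ⟨(.inr ⟨(i, j), hij⟩, m), by simp only [dirPartition, inner_dir_inr]⟩
    · rintro ⟨⟨i | p, m⟩, rfl⟩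
      · exact Or.inl ⟨i, m, by simp only [dirPartition, inner_dir_inl]⟩
      · exact Or.inr ⟨p.1.1, p.1.2, m, p.2, by simp only [dirPartition, inner_dir_inr]⟩

/-- A partition that refines the `n`th Lebesgue partition in some direction has small mesh in this
direction. -/
theorem Grid.OscLE.of_noCross {R : Grid d T} {n : ℕ} {a : DirIndex d}
    (h : ∀ m ω, NoCross (R.times ω) (dirPartition n a m ω)) :
    R.OscLE (dir a) (2 * (2⁻¹ : ℝ) ^ n) := by
  intro ω k t hk ht
  obtain ⟨u, hu⟩ := exists_coe_eq_of_ne_top (ne_top_of_le_ne_top WithTop.coe_ne_top hk)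
  have hf := continuous_inner_path (dir a) ω
  obtain ⟨K, hK⟩ := exists_lebesguePartition_eq_top hf n
  obtain ⟨l, hl⟩ := exists_mem_interval (τ := fun m => dirPartition n a m ω) rfl hK
    (hu ▸ WithTop.coe_lt_top u)
  have ht' := ht.trans (h (l + 1) ω k hl.2)
  rw [hu] at hk hl
  obtain ⟨w, hw⟩ := exists_coe_eq_of_ne_top (ne_top_of_le_ne_top WithTop.coe_ne_top hl.1)
  have hwu : w ≤ u := WithTop.coe_le_coe.1 (hw ▸ hl.1)
  have h1 := abs_sub_le_of_mem_lebesguePartition hf hw hwu hl.2.le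
  have h2 := abs_sub_le_of_mem_lebesguePartition hf hw (hwu.trans (WithTop.coe_le_coe.1 hk)) ht'
  rw [hu, minTime_coe, min_eq_left le_top]
  rw [abs_sub_comm] at h1
  exact (abs_sub_le _ (inner ℝ (dir a) (ω w)) _).trans (by linarith)

theorem oscLE_lebesgueGrid (n : ℕ) (a : DirIndex d) :
    (lebesgueGrid d T n).OscLE (dir a) (2 * (2⁻¹ : ℝ) ^ n) :=
  .of_noCross fun m ω => noCross_lebesgueGrid n a m ω

/-- The common refinement of a Lebesgue partition and the times of a simple strategy. -/
def SimpleStrategy.grid (G : SimpleStrategy d T) (n : ℕ) : Grid d T :=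
  Grid.merge G.τ (lebesgueGrid d T n).τ G.isStoppingTime (lebesgueGrid d T n).isStoppingTime
    G.finite_range (lebesgueGrid d T n).finite_range

namespace SimpleStrategy

variable (G : SimpleStrategy d T)

theorem noCross_grid (n l : ℕ) (ω : PricePath d T) : NoCross ((G.grid n).times ω) (G.τ l ω) :=
  Grid.noCross_merge_left _ _ _ _ l ω

theorem oscLE_grid (n : ℕ) (a : DirIndex d) : (G.grid n).OscLE (dir a) (2 * (2⁻¹ : ℝ) ^ n) := by
  refine .of_noCross fun m ω => ?_
  obtain ⟨K, hK⟩ := (lebesgueGrid d T n).exists_top ω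
  exact NoCross.trans ((lebesgueGrid d T n).times_zero ω) hK
    (fun l => Grid.noCross_merge_right _ _ _ _ l ω) (noCross_lebesgueGrid n a m ω)

end SimpleStrategy

/-! ### Typical convergence of the quadratic variation -/

theorem vovkOuterMeasure_exists_null {ι : Type*} [Countable ι] {p : ι → PricePath d T → Prop}
    (h : ∀ i, vovkOuterMeasure {ω | p i ω} = 0) : vovkOuterMeasure {ω | ∃ i, p i ω} = 0 := by
  rcases isEmpty_or_nonempty ι with hι | hι
  · refine vovkOuterMeasure_mono_null ?_
      (vovkOuterMeasure_unbounded_gains (d := d) (T := T) fun _ => IsGain.zero)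
    rintro ω ⟨i, -⟩
    exact isEmptyElim i
  · obtain ⟨e, he⟩ := exists_surjective_nat ι
    refine vovkOuterMeasure_mono_null ?_ (vovkOuterMeasure_iUnion_null fun k => h (e k))
    rintro ω ⟨i, hi⟩
    obtain ⟨k, rfl⟩ := he i
    exact Set.mem_iUnion.2 ⟨k, hi⟩

namespace Grid

variable (R : Grid d T)

theorem OscLE.mono {R : Grid d T} {v : EuclideanSpace ℝ (Fin d)} {c c' : ℝ} (h : R.OscLE v c)
    (hc : c ≤ c') : R.OscLE v c' := fun ω k t h1 h2 => (h ω k t h1 h2).trans hc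

theorem OscLE.abs_inner_incr {R : Grid d T} {v : EuclideanSpace ℝ (Fin d)} {c : ℝ}
    (h : R.OscLE v c) (ω : PricePath d T) (k : ℕ) (t : Time T) :
    |inner ℝ v (incr (R.times ω) ω k t)| ≤ c := by
  by_cases hk : R.times ω k ≤ t
  · have h1 : R.times ω k ≤ minTime (R.times ω (k + 1)) t := by
      rw [coe_minTime]
      exact le_min (R.monotone ω k.le_succ) hk
    have h2 : (minTime (R.times ω (k + 1)) t : WithTop (Time T)) ≤ R.times ω (k + 1) := by
      rw [coe_minTime]
      exact min_le_left _ _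
    have h3 : minTime (R.times ω k) ⊤ = minTime (R.times ω k) t := by
      rw [← WithTop.coe_inj, coe_minTime_of_le hk,
        coe_minTime_of_le (hk.trans (WithTop.coe_le_coe.2 le_top))]
    have := h ω k _ h1 h2
    rwa [h3, ← inner_sub_right] at this
  · rw [incr_eq_zero_of_le (R.monotone ω) (not_le.1 hk).le, inner_zero_right, abs_zero]
    have h1 := h ω 0 ⊥ (R.times_zero ω).le
      (by rw [← R.times_zero ω]; exact R.monotone ω (Nat.zero_le _))
    exact (abs_nonneg _).trans h1

/-- The sum of the products of the increments of the `i`th and the `j`th coordinate. -/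
def cov (i j : Fin d) (t : Time T) (ω : PricePath d T) : ℝ :=
  ∑' k, incr (R.times ω) ω k t i * incr (R.times ω) ω k t j

theorem cov_eq_sum (i j : Fin d) {ω : PricePath d T} {K : ℕ} (hK : R.times ω K = ⊤) (t : Time T) :
    R.cov i j t ω = ∑ k ∈ Finset.range K, incr (R.times ω) ω k t i * incr (R.times ω) ω k t j :=
  R.tsum_eq_sum hK (fun _ x => x i * x j) (by simp) t

theorem qv_eq_sum_cov (v : EuclideanSpace ℝ (Fin d)) (t : Time T) (ω : PricePath d T) :
    R.qv v t ω = ∑ i, ∑ j, v i * v j * R.cov i j t ω := by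
  obtain ⟨K, hK⟩ := R.exists_top ω
  simp_rw [R.qv_eq_sum v hK, R.cov_eq_sum _ _ hK, Finset.mul_sum]
  simp_rw [Finset.sum_comm (t := Finset.range K)]
  refine Finset.sum_congr rfl fun k _ => ?_
  rw [PiLp.inner_apply, sq, Finset.sum_mul_sum]
  refine Finset.sum_congr rfl fun i _ => Finset.sum_congr rfl fun j _ => ?_
  simp only [RCLike.inner_apply, conj_trivial]
  ring

end Grid

/-- Covariations in terms of the quadratic variations in the directions `eᵢ` and `eᵢ + eⱼ`. -/
def polar (Q : DirIndex d → ℝ) (i j : Fin d) : ℝ :=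
  if h : i ≠ j then (Q (.inr ⟨(i, j), h⟩) - Q (.inl i) - Q (.inl j)) / 2 else Q (.inl i)

theorem Grid.cov_eq_polar (R : Grid d T) (i j : Fin d) (t : Time T) (ω : PricePath d T) :
    R.cov i j t ω = polar (fun a => R.qv (dir a) t ω) i j := by
  obtain ⟨K, hK⟩ := R.exists_top ω
  unfold polar
  split_ifs with h
  · simp only [R.qv_eq_sum _ hK, R.cov_eq_sum _ _ hK, inner_dir_inl, inner_dir_inr]
    rw [← Finset.sum_sub_distrib, ← Finset.sum_sub_distrib, Finset.sum_div]
    refine Finset.sum_congr rfl fun k _ => ?_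
    ring
  · rw [ne_eq, not_not] at h
    subst h
    simp only [R.qv_eq_sum _ hK, R.cov_eq_sum _ _ hK, inner_dir_inl, sq]

theorem tendsto_polar {Q : ℕ → DirIndex d → ℝ} {L : DirIndex d → ℝ}
    (h : ∀ a, Tendsto (fun n => Q n a) atTop (𝓝 (L a))) (i j : Fin d) :
    Tendsto (fun n => polar (Q n) i j) atTop (𝓝 (polar L i j)) := by
  unfold polar
  split_ifs with hij
  · exact (((h _).sub (h _)).sub (h _)).div_const 2
  · exact h _

theorem abs_polar_le {Q : DirIndex d → ℝ} {B : ℝ} (h0 : ∀ a, 0 ≤ Q a) (h : ∀ a, Q a ≤ B)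
    (i j : Fin d) : |polar Q i j| ≤ B := by
  unfold polar
  split_ifs with hij
  · rw [abs_le]
    constructor <;> linarith [h0 (.inl i), h0 (.inl j), h0 (.inr ⟨(i, j), hij⟩), h (.inl i),
      h (.inl j), h (.inr ⟨(i, j), hij⟩)]
  · rw [abs_of_nonneg (h0 _)]
    exact h _

theorem Grid.qv_nonneg (R : Grid d T) (v : EuclideanSpace ℝ (Fin d)) (t : Time T)
    (ω : PricePath d T) : 0 ≤ R.qv v t ω := tsum_nonneg fun _ => sq_nonneg _

namespace SimpleStrategy

variable (G : SimpleStrategy d T)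

/-- The sums of squares along the Lebesgue partitions converge geometrically, uniformly in time,
and they are not affected in the limit by the insertion of the times of `G`. -/
structure IsRegular (ω : PricePath d T) : Prop where
  cauchy : ∀ a : DirIndex d, ∃ K : ℝ, ∀ n t, |(lebesgueGrid d T n).qv (dir a) t ω -
    (lebesgueGrid d T (n + 1)).qv (dir a) t ω| ≤ K * (3 / 4 : ℝ) ^ n
  close : ∀ a : DirIndex d, ∃ K : ℝ, ∀ n t, |(lebesgueGrid d T n).qv (dir a) t ω -
    (G.grid n).qv (dir a) t ω| ≤ K * (3 / 4 : ℝ) ^ n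

theorem vovkOuterMeasure_not_isRegular : vovkOuterMeasure {ω | ¬ G.IsRegular ω} = 0 := by
  have h1 := vovkOuterMeasure_exists_null fun a : DirIndex d =>
    vovkOuterMeasure_qv_not_close (T := T) (R := lebesgueGrid d T)
      (R' := fun n => lebesgueGrid d T (n + 1)) (fun n => oscLE_lebesgueGrid n a)
      (fun n => (oscLE_lebesgueGrid (n + 1) a).mono (by
        rw [pow_succ]
        have : (0 : ℝ) < 2⁻¹ ^ n := by positivity
        linarith))
  have h2 := vovkOuterMeasure_exists_null fun a : DirIndex d =>
    vovkOuterMeasure_qv_not_close (R := lebesgueGrid d T) (R' := G.grid)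
      (fun n => oscLE_lebesgueGrid n a) (fun n => G.oscLE_grid n a)
  refine vovkOuterMeasure_mono_null ?_ (vovkOuterMeasure_union_null h1 h2)
  intro ω hω
  by_contra h
  simp only [Set.mem_union, Set.mem_ofPred_eq, not_or, not_exists] at h
  exact hω ⟨fun a => by simpa using h.1 a, fun a => by simpa using h.2 a⟩

/-- The sum of the squared increments of the integral process along the `n`th partition. -/
def stepSq (n : ℕ) (t : Time T) (ω : PricePath d T) : ℝ :=
  ∑' k, (inner ℝ (G.posOn (G.grid n) k ω) (incr ((G.grid n).times ω) ω k t)) ^ 2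

theorem stepSq_eq_sum (n : ℕ) {ω : PricePath d T} {K : ℕ} (hK : (G.grid n).times ω K = ⊤)
    (t : Time T) : G.stepSq n t ω = ∑ k ∈ Finset.range K,
      (inner ℝ (G.posOn (G.grid n) k ω) (incr ((G.grid n).times ω) ω k t)) ^ 2 :=
  (G.grid n).tsum_eq_sum hK (fun k x => (inner ℝ (G.posOn (G.grid n) k ω) x) ^ 2) (by simp) t

/-- The sum of squares along the refined partition has the form of `quadVar`, with the limiting
covariations replaced by sums along the partition. -/
theorem stepSq_eq_sum_cov (n : ℕ) {ω : PricePath d T} {L : ℕ}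
    (hL : ∀ l, L ≤ l → G.τ l ω = G.τ L ω) (t : Time T) :
    G.stepSq n t ω = ∑ l ∈ Finset.range L, ∑ i, ∑ j, G.g l ω i * G.g l ω j *
      ((G.grid n).cov i j (minTime (G.τ (l + 1) ω) t) ω -
        (G.grid n).cov i j (minTime (G.τ l ω) t) ω) := by
  obtain ⟨K, hK⟩ := (G.grid n).exists_top ω
  have h1 : ∀ l, ∑ i, ∑ j, G.g l ω i * G.g l ω j *
      ((G.grid n).cov i j (minTime (G.τ (l + 1) ω) t) ω -
        (G.grid n).cov i j (minTime (G.τ l ω) t) ω) =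
      ∑ k ∈ Finset.range K, if G.τ l ω ≤ (G.grid n).times ω k ∧ (G.grid n).times ω k < G.τ (l + 1) ω
        then (inner ℝ (G.g l ω) (incr ((G.grid n).times ω) ω k t)) ^ 2 else 0 := by
    intro l
    simp_rw [mul_sub, Finset.sum_sub_distrib]
    rw [← Grid.qv_eq_sum_cov, ← Grid.qv_eq_sum_cov, (G.grid n).qv_eq_sum _ hK,
      (G.grid n).qv_eq_sum _ hK]
    exact sum_map_incr_sub ((G.grid n).monotone ω) K (G.noCross_grid n l ω)
      (G.noCross_grid n (l + 1) ω) (G.τ_le_succ l ω) (fun x => (inner ℝ (G.g l ω) x) ^ 2)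
      (by simp) ω t
  rw [G.stepSq_eq_sum n hK, Finset.sum_congr rfl fun l _ => h1 l, Finset.sum_comm]
  refine Finset.sum_congr rfl fun k _ => ?_
  rw [posOn, map_pull (G.monotone ω) (fun l => G.g l ω) ((G.grid n).times ω) k
    (fun x => (inner ℝ x (incr ((G.grid n).times ω) ω k t) : ℝ) ^ 2) (by simp), pull_eq_sum hL]

namespace IsRegular

variable {G} {ω : PricePath d T}

theorem exists_tendsto (h : G.IsRegular ω) (a : DirIndex d) (t : Time T) :
    ∃ L, Tendsto (fun n => (lebesgueGrid d T n).qv (dir a) t ω) atTop (𝓝 L) := by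
  obtain ⟨K, hK⟩ := h.cauchy a
  exact cauchySeq_tendsto_of_complete
    (cauchySeq_of_le_geometric (3 / 4 : ℝ) K (by norm_num) fun n => hK n t)

theorem tendsto_grid (h : G.IsRegular ω) {a : DirIndex d} {t : Time T} {L : ℝ}
    (hL : Tendsto (fun n => (lebesgueGrid d T n).qv (dir a) t ω) atTop (𝓝 L)) :
    Tendsto (fun n => (G.grid n).qv (dir a) t ω) atTop (𝓝 L) := by
  obtain ⟨K, hK⟩ := h.close a
  have h0 : Tendsto (fun n : ℕ => K * (3 / 4 : ℝ) ^ n) atTop (𝓝 0) := by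
    simpa using (tendsto_pow_atTop_nhds_zero_of_lt_one (r := (3 / 4 : ℝ)) (by norm_num)
      (by norm_num)).const_mul K
  have h1 := squeeze_zero_norm (f := fun n => (lebesgueGrid d T n).qv (dir a) t ω -
    (G.grid n).qv (dir a) t ω) (fun n => hK n t) h0
  simpa using hL.sub h1

/-- For a regular path the limit in the definition of the covariation exists, and it is also the
limit along the refined partitions. -/
theorem tendsto_cov (h : G.IsRegular ω) (i j : Fin d) (t : Time T) :
    Tendsto (fun n => (G.grid n).cov i j t ω) atTop (𝓝 (covariation i j t ω)) := by
  choose L hL using fun a => h.exists_tendsto a t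
  have h1 : Tendsto (fun n => (lebesgueGrid d T n).cov i j t ω) atTop (𝓝 (polar L i j)) := by
    simp_rw [Grid.cov_eq_polar]
    exact tendsto_polar hL i j
  have h2 : Tendsto (fun n => (G.grid n).cov i j t ω) atTop (𝓝 (polar L i j)) := by
    simp_rw [Grid.cov_eq_polar]
    exact tendsto_polar (fun a => h.tendsto_grid (hL a)) i j
  -- the sums which define the covariation omit the first interval of the partition
  have h3 : ∀ n, covariationApprox n i j t ω = (lebesgueGrid d T n).cov i j t ω -
      incr ((lebesgueGrid d T n).times ω) ω 0 t i *
        incr ((lebesgueGrid d T n).times ω) ω 0 t j := by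
    intro n
    have hfun : pathPartition ω n = (lebesgueGrid d T n).times ω :=
      funext fun k => pathPartition_eq ω n k
    obtain ⟨K, hK⟩ := (lebesgueGrid d T n).exists_top ω
    have hK' := eq_top_of_le ((lebesgueGrid d T n).monotone ω) hK K.le_succ
    rw [Grid.cov_eq_sum _ i j hK', Finset.sum_range_succ', add_sub_cancel_right]
    have hmono : Monotone fun k => (lebesgueGrid d T n).times ω (k + 1) := fun k l hkl =>
      (lebesgueGrid d T n).monotone ω (by omega)
    simp only [covariationApprox, hfun]
    exact tsum_incr (τ := fun k => (lebesgueGrid d T n).times ω (k + 1)) (K := K)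
      (Grid.const_of_top hmono hK') (fun _ x => x i * x j) (by simp) ω t
  have h4 : Tendsto (fun n => incr ((lebesgueGrid d T n).times ω) ω 0 t i *
      incr ((lebesgueGrid d T n).times ω) ω 0 t j) atTop (𝓝 0) := by
    have hg : Tendsto (fun n : ℕ => 2 * (2⁻¹ : ℝ) ^ n) atTop (𝓝 0) := by
      simpa using (tendsto_pow_atTop_nhds_zero_of_lt_one (r := (2⁻¹ : ℝ)) (by norm_num)
        (by norm_num)).const_mul 2
    have h5 : ∀ i, Tendsto (fun n => incr ((lebesgueGrid d T n).times ω) ω 0 t i) atTop (𝓝 0) :=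
      fun i => squeeze_zero_norm (fun n => by
        have := (oscLE_lebesgueGrid (T := T) n (.inl i)).abs_inner_incr ω 0 t
        rwa [inner_dir_inl] at this) hg
    simpa using (h5 i).mul (h5 j)
  have h6 : Tendsto (fun n => covariationApprox n i j t ω) atTop (𝓝 (polar L i j)) := by
    simp_rw [h3]
    simpa using h1.sub h4
  rwa [covariation, h6.limUnder_eq]

theorem tendsto_stepSq (h : G.IsRegular ω) (t : Time T) :
    Tendsto (fun n => G.stepSq n t ω) atTop (𝓝 (G.quadVar t ω)) := by
  obtain ⟨L, hL⟩ := G.eventually_const ω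
  have h1 : G.quadVar t ω = ∑ l ∈ Finset.range L, ∑ i, ∑ j, G.g l ω i * G.g l ω j *
      (covariation i j (minTime (G.τ (l + 1) ω) t) ω -
        covariation i j (minTime (G.τ l ω) t) ω) := by
    refine tsum_eq_sum fun l hl => ?_
    have hl' : L ≤ l := by simpa using hl
    simp [hL l hl', hL (l + 1) (by omega)]
  simp_rw [G.stepSq_eq_sum_cov _ hL, h1]
  exact tendsto_finsetSum _ fun l _ => tendsto_finsetSum _ fun i _ => tendsto_finsetSum _ fun j _ =>
    ((h.tendsto_cov i j _).sub (h.tendsto_cov i j _)).const_mul _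

theorem exists_qv_le (h : G.IsRegular ω) (a : DirIndex d) :
    ∃ B, ∀ n t, (G.grid n).qv (dir a) t ω ≤ B := by
  obtain ⟨K, hK⟩ := h.cauchy a
  obtain ⟨K', hK'⟩ := h.close a
  obtain ⟨B, hB⟩ : ∃ B, ∀ t, (lebesgueGrid d T 0).qv (dir a) t ω ≤ B := by
    obtain ⟨k, hk⟩ := (lebesgueGrid d T 0).exists_top ω
    have hc : Continuous fun t => (lebesgueGrid d T 0).qv (dir a) t ω := by
      simp_rw [(lebesgueGrid d T 0).qv_eq_sum _ hk]
      exact continuous_finsetSum _ fun k _ =>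
        (continuous_const.inner (continuous_incr _ ω k)).pow 2
    obtain ⟨B, hB⟩ := (isCompact_range hc).bddAbove
    exact ⟨B, fun t => hB ⟨t, rfl⟩⟩
  have hK0 : 0 ≤ K := by simpa using (abs_nonneg _).trans (hK 0 ⊥)
  have hK'0 : 0 ≤ K' := by simpa using (abs_nonneg _).trans (hK' 0 ⊥)
  have hpow : ∀ n : ℕ, (3 / 4 : ℝ) ^ n ≤ 1 := fun n => pow_le_one₀ (by norm_num) (by norm_num)
  refine ⟨B + 4 * K + K', fun n t => ?_⟩
  have h1 : (lebesgueGrid d T n).qv (dir a) t ω ≤ B + 4 * K * (1 - (3 / 4 : ℝ) ^ n) := by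
    induction n with
    | zero => simpa using hB t
    | succ n ih =>
      have := (abs_le.1 (hK n t)).1
      rw [pow_succ]
      linarith
  have h2 := (abs_le.1 (hK' n t)).1
  have h3 : (0 : ℝ) ≤ (3 / 4 : ℝ) ^ n := by positivity
  nlinarith [mul_le_mul_of_nonneg_left (hpow n) hK'0, mul_nonneg hK0 h3]

theorem exists_stepSq_le (h : G.IsRegular ω) : ∃ B, ∀ n t, G.stepSq n t ω ≤ B := by
  obtain ⟨L, hL⟩ := G.eventually_const ω
  choose B hB using fun a => h.exists_qv_le a
  have hB0 : ∀ a, 0 ≤ B a := fun a => ((G.grid 0).qv_nonneg (dir a) ⊥ ω).trans (hB a 0 ⊥)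
  have hcov : ∀ n i j t, |(G.grid n).cov i j t ω| ≤ ∑ a, B a := fun n i j t => by
    rw [Grid.cov_eq_polar]
    exact abs_polar_le (fun a => Grid.qv_nonneg _ _ _ _) (fun a => (hB a n t).trans
      (Finset.single_le_sum (fun a _ => hB0 a) (Finset.mem_univ a))) i j
  refine ⟨∑ l ∈ Finset.range L, ∑ i, ∑ j, |G.g l ω i * G.g l ω j| * (2 * ∑ a, B a), fun n t => ?_⟩
  rw [G.stepSq_eq_sum_cov n hL]
  refine Finset.sum_le_sum fun l _ => Finset.sum_le_sum fun i _ => Finset.sum_le_sum fun j _ => ?_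
  refine (le_abs_self _).trans ?_
  rw [abs_mul]
  refine mul_le_mul_of_nonneg_left ((abs_sub _ _).trans ?_) (abs_nonneg _)
  linarith [hcov n i j (minTime (G.τ (l + 1) ω) t), hcov n i j (minTime (G.τ l ω) t)]

end IsRegular

end SimpleStrategy

/-! ### The pathwise inequality for integral processes -/

namespace DiscreteBDG

theorem weight_congr {x y : ℕ → ℝ} {k : ℕ} (h : ∀ j ≤ k, x j = y j) : weight x k = weight y k := by
  have hm : runMax x k = runMax y k := by
    induction k with
    | zero => simp [runMax, h 0 le_rfl]
    | succ k ih => rw [runMax, runMax, ih fun j hj => h j (by omega), h (k + 1) le_rfl]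
  have hq : qv x k = qv y k := Finset.sum_congr rfl fun j hj => by
    have := Finset.mem_range.1 hj
    rw [h j (by omega), h (j + 1) (by omega)]
  rw [weight, weight, hm, hq, h k le_rfl]

theorem measurable_weight {Ω : Type*} {m : MeasurableSpace Ω} {x : ℕ → Ω → ℝ} {k : ℕ}
    (h : ∀ j ≤ k, Measurable (x j)) : Measurable fun ω => weight (fun j => x j ω) k := by
  have hm : Measurable fun ω => runMax (fun j => x j ω) k := by
    induction k with
    | zero => exact (h 0 le_rfl).abs
    | succ k ih => exact (ih fun j hj => h j (by omega)).max (h (k + 1) le_rfl).abs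
  have hq : Measurable fun ω => qv (fun j => x j ω) k :=
    Finset.measurable_fun_sum _ fun j hj => by
      have := Finset.mem_range.1 hj
      exact ((h (j + 1) (by omega)).sub (h j (by omega))).pow_const 2
  exact (h k le_rfl).div (hq.add (hm.pow_const 2)).sqrt

end DiscreteBDG

theorem norm_pull_le {τ : ℕ → WithTop (Time T)} {L : ℕ} (hL : ∀ l, L ≤ l → τ l = τ L)
    (p : ℕ → EuclideanSpace ℝ (Fin d)) (ρ : ℕ → WithTop (Time T)) (k : ℕ) :
    ‖pull τ p ρ k‖ ≤ ∑ l ∈ Finset.range L, ‖p l‖ := by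
  rw [pull_eq_sum hL]
  refine norm_sum_le_of_le _ fun l _ => ?_
  split_ifs
  · exact le_rfl
  · simp

theorem abs_inner_le_of_abs_le {p x : EuclideanSpace ℝ (Fin d)} {c : ℝ} (h : ∀ i, |x i| ≤ c) :
    |inner ℝ p x| ≤ d * (‖p‖ * c) := by
  rw [PiLp.inner_apply]
  refine (Finset.abs_sum_le_sum_abs _ _).trans ?_
  have : ∀ i ∈ Finset.univ, |(inner ℝ (p i) (x i) : ℝ)| ≤ ‖p‖ * c := fun i _ => by
    rw [RCLike.inner_apply, conj_trivial, abs_mul, mul_comm]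
    exact mul_le_mul (PiLp.norm_apply_le p i) (h i) (abs_nonneg _) (norm_nonneg _)
  simpa using Finset.sum_le_sum this

namespace SimpleStrategy

variable (G : SimpleStrategy d T)

/-- The values of the integral process along the `n`th partition, up to time `t`. -/
def sample (n : ℕ) (t : Time T) (ω : PricePath d T) (k : ℕ) : ℝ :=
  G.integral (minTime ((G.grid n).times ω k) t) ω

theorem integral_eq_integral_grid (n : ℕ) (t : Time T) (ω : PricePath d T) :
    G.integral t ω = (G.grid n).integral (G.posOn (G.grid n)) t ω :=
  G.integral_eq_grid (fun l => G.noCross_grid n l ω) t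

theorem sample_succ_sub (n : ℕ) (t : Time T) (ω : PricePath d T) (k : ℕ) :
    G.sample n t ω (k + 1) - G.sample n t ω k =
      inner ℝ (G.posOn (G.grid n) k ω) (incr ((G.grid n).times ω) ω k t) := by
  simp only [sample, G.integral_eq_integral_grid n]
  rw [Grid.integral_minTime, Grid.integral_minTime, Finset.sum_range_succ, add_sub_cancel_left]

theorem sample_zero (n : ℕ) (t : Time T) (ω : PricePath d T) : G.sample n t ω 0 = 0 := by
  rw [sample, Grid.times_zero, minTime_bot, G.isGain.apply_bot]

/-- The positions of the strategy which, together with the square root of the quadratic variation,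
dominates the running maximum of the integral process. -/
def bdgPosition (n k : ℕ) (ω : PricePath d T) : EuclideanSpace ℝ (Fin d) :=
  (2 * DiscreteBDG.weight (G.sample n ⊤ ω) k) • G.posOn (G.grid n) k ω

/-- The gains from `bdgPosition`. -/
def bdgGain (n : ℕ) : Time T → PricePath d T → ℝ := (G.grid n).integral (G.bdgPosition n)

/-- The weight with index `k` depends only on the values of the integral process at the first `k`
times of the partition, hence it is known at the `k`th time. -/
theorem isGain_bdgGain (n : ℕ) : IsGain (G.bdgGain n) := by
  refine (G.grid n).isGain fun k => ?_
  have hw : Measurable[((G.grid n).isStoppingTime k).measurableSpace] fun ω =>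
      2 * DiscreteBDG.weight (G.sample n ⊤ ω) k := Measurable.const_mul ?_ 2
  · exact hw.smul (G.isPosition_posOn (G.grid n) k)
  refine DiscreteBDG.measurable_weight (x := fun j ω => G.sample n ⊤ ω j) fun j hj => ?_
  refine (G.isGain.isContAdapted.measurable_stopped ((G.grid n).isStoppingTime j)).mono ?_ le_rfl
  exact ((G.grid n).isStoppingTime j).measurableSpace_mono _ fun ω => (G.grid n).monotone ω hj

theorem bdgGain_eq_sum (n : ℕ) {ω : PricePath d T} {K : ℕ} (hK : (G.grid n).times ω K = ⊤)
    (t : Time T) : G.bdgGain n t ω = ∑ k ∈ Finset.range K,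
      2 * DiscreteBDG.weight (G.sample n t ω) k *
        (G.sample n t ω (k + 1) - G.sample n t ω k) := by
  rw [bdgGain, Grid.integral_eq_sum _ _ hK]
  refine Finset.sum_congr rfl fun k _ => ?_
  rw [sample_succ_sub, bdgPosition, real_inner_smul_left]
  by_cases h : incr ((G.grid n).times ω) ω k t = 0
  · simp [h]
  -- an interval which contributes starts before `t`, hence so do all the preceding ones
  have hk : (G.grid n).times ω k ≤ t := by
    by_contra! h'
    exact h (incr_eq_zero_of_le ((G.grid n).monotone ω) h'.le ω)
  congr 2
  refine DiscreteBDG.weight_congr fun j hj => ?_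
  have hj' := ((G.grid n).monotone ω hj).trans hk
  rw [sample, sample, ← WithTop.coe_inj.1 ((coe_minTime_of_le hj').trans
    (coe_minTime_of_le (hj'.trans (WithTop.coe_le_coe.2 le_top))).symm)]

/-- The pathwise Burkholder–Davis–Gundy inequality for integral processes. The last term bounds the
oscillation of the integral process between two consecutive times of the partition. -/
theorem abs_integral_le_bdg (ω : PricePath d T) :
    ∃ Γ : ℝ, 0 ≤ Γ ∧ ∀ n t s, s ≤ t →
      |G.integral s ω| ≤ 6 * √(G.stepSq n t ω) + G.bdgGain n t ω + Γ * (2⁻¹ : ℝ) ^ n := by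
  obtain ⟨L, hL⟩ := G.eventually_const ω
  refine ⟨2 * d * ∑ l ∈ Finset.range L, ‖G.g l ω‖, by positivity, fun n t s hst => ?_⟩
  obtain ⟨K, hK⟩ := (G.grid n).exists_top ω
  have hbdg := DiscreteBDG.runMax_le (G.sample n t ω) (G.sample_zero n t ω) K
  have hq : DiscreteBDG.qv (G.sample n t ω) K = G.stepSq n t ω := by
    rw [G.stepSq_eq_sum n hK]
    exact Finset.sum_congr rfl fun k _ => by rw [sample_succ_sub]
  rw [hq, ← G.bdgGain_eq_sum n hK] at hbdg
  obtain ⟨l, hl⟩ := exists_mem_interval ((G.grid n).times_zero ω) hK (WithTop.coe_lt_top s)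
  have hlK : l ≤ K := by
    by_contra! h
    rw [eq_top_of_le ((G.grid n).monotone ω) hK h.le] at hl
    exact absurd hl.1 (not_le.2 (WithTop.coe_lt_top s))
  have h1 : G.sample n s ω l = G.sample n t ω l := by
    rw [sample, sample, WithTop.coe_inj.1 ((coe_minTime_of_le hl.1).trans
      (coe_minTime_of_le (hl.1.trans (WithTop.coe_le_coe.2 hst))).symm)]
  have h2 : G.sample n s ω (l + 1) = G.integral s ω := by
    rw [sample, minTime_of_le hl.2.le]
  have h3 := G.sample_succ_sub n s ω l
  have h4 : |inner ℝ (G.posOn (G.grid n) l ω) (incr ((G.grid n).times ω) ω l s)| ≤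
      d * (‖G.posOn (G.grid n) l ω‖ * (2 * (2⁻¹ : ℝ) ^ n)) := abs_inner_le_of_abs_le fun i => by
    have := (G.oscLE_grid n (.inl i)).abs_inner_incr ω l s
    rwa [inner_dir_inl] at this
  have h5 : ‖G.posOn (G.grid n) l ω‖ ≤ ∑ l ∈ Finset.range L, ‖G.g l ω‖ := norm_pull_le hL _ _ _
  have h6 : (d : ℝ) * (‖G.posOn (G.grid n) l ω‖ * (2 * (2⁻¹ : ℝ) ^ n)) ≤
      d * ((∑ l ∈ Finset.range L, ‖G.g l ω‖) * (2 * (2⁻¹ : ℝ) ^ n)) := by gcongr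
  rw [← h3, h2, h1] at h4
  have h7 := abs_sub_abs_le_abs_sub (G.integral s ω) (G.sample n t ω l)
  have h8 := DiscreteBDG.abs_le_runMax (G.sample n t ω) hlK
  linarith

end SimpleStrategy

/-! ### Superhedging the running maximum -/

section Superhedging

variable (G : Fin d → SimpleStrategy d T)

theorem norm_vecIntegral_le (t : Time T) (ω : PricePath d T) :
    ‖vecIntegral G t ω‖ ≤ ∑ i, |(G i).integral t ω| := by
  rw [EuclideanSpace.norm_eq]
  refine Real.sqrt_le_iff.2 ⟨Finset.sum_nonneg fun i _ => abs_nonneg _, ?_⟩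
  exact Finset.sum_sq_le_sq_sum_of_nonneg fun i _ => abs_nonneg _

/-- The gains from superhedging the square root of the quadratic variation `6 d` times, and from
the strategies which turn this into a bound of the running maximum. -/
def hedge (H : ℕ → SimpleStrategy d T) (n : ℕ) (t : Time T) (ω : PricePath d T) : ℝ :=
  6 * d * (H n).integral t ω + ∑ i, (G i).bdgGain n t ω

variable {G} {H : ℕ → SimpleStrategy d T} {a : ℝ}

theorem isGain_hedge (n : ℕ) : IsGain (hedge G H n) :=
  ((H n).isGain.const_mul _).add (IsGain.sum _ fun i _ => (G i).isGain_bdgGain n)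

/-- The pathwise inequality at a single time bounds the gains from below. -/
theorem exists_forall_neg_le_hedge (hH : ∀ n, (H n).Admissible a) {ω : PricePath d T}
    (hω : ∀ i, (G i).IsRegular ω) : ∃ b : ℝ, ∀ n t, -b ≤ hedge G H n t ω := by
  choose Γ hΓ0 hΓ using fun i => (G i).abs_integral_le_bdg ω
  choose B hB using fun i => (hω i).exists_stepSq_le
  refine ⟨6 * d * a + ∑ i, (6 * √(B i) + Γ i), fun n t => ?_⟩
  have h1 := mul_le_mul_of_nonneg_left (hH n ω t) (show (0 : ℝ) ≤ 6 * d by positivity)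
  have h2 : ∑ i, -(6 * √(B i) + Γ i) ≤ ∑ i, (G i).bdgGain n t ω := by
    refine Finset.sum_le_sum fun i _ => ?_
    have h3 := (abs_nonneg _).trans (hΓ i n t t le_rfl)
    have h4 := Real.sqrt_le_sqrt (hB i n t)
    have h5 : Γ i * (2⁻¹ : ℝ) ^ n ≤ Γ i :=
      mul_le_of_le_one_right (hΓ0 i) (pow_le_one₀ (by norm_num) (by norm_num))
    linarith
  rw [Finset.sum_neg_distrib] at h2
  simp only [hedge]
  linarith

/-- For regular paths along which the quadratic variation is superhedged, `hedge` eventually covers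
the values of the integral processes at any earlier time, up to a small error. -/
theorem eventually_le_hedge {ω : PricePath d T} (hω : ∀ i, (G i).IsRegular ω) {t s : Time T}
    (hst : s ≤ t) (hH : ((√(vecQuadVar G t ω) : ℝ) : EReal) ≤
      liminf (fun n => ((a + (H n).integral t ω : ℝ) : EReal)) atTop) {δ : ℝ} (hδ : 0 < δ) :
    ∀ᶠ n in atTop, ∑ i, |(G i).integral s ω| - δ ≤ 6 * d * a + hedge G H n t ω := by
  choose Γ hΓ0 hΓ using fun i => (G i).abs_integral_le_bdg ω
  have hD : (0 : ℝ) < 6 * d + 1 := by positivity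
  have hη : 0 < δ / (2 * (6 * d + 1)) := by positivity
  set η := δ / (2 * (6 * d + 1)) with hη'
  have h1 : ∀ᶠ n in atTop, √(vecQuadVar G t ω) - η < a + (H n).integral t ω := by
    have h := eventually_lt_of_lt_liminf (lt_of_lt_of_le (EReal.coe_lt_coe_iff.2
      (sub_lt_self (√(vecQuadVar G t ω)) hη)) hH) (by isBoundedDefault)
    filter_upwards [h] with n hn
    exact EReal.coe_lt_coe_iff.1 hn
  have hlim : Tendsto (fun n => ∑ i, (6 * √((G i).stepSq n t ω) + Γ i * (2⁻¹ : ℝ) ^ n)) atTop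
      (𝓝 (∑ i, (6 * √((G i).quadVar t ω) + Γ i * 0))) := by
    refine tendsto_finsetSum _ fun i _ => ?_
    exact (((hω i).tendsto_stepSq t).sqrt.const_mul 6).add
      ((tendsto_pow_atTop_nhds_zero_of_lt_one (by norm_num) (by norm_num)).const_mul _)
  have hq0 : ∀ i, 0 ≤ (G i).quadVar t ω := fun i =>
    ge_of_tendsto' ((hω i).tendsto_stepSq t) fun n => tsum_nonneg fun _ => sq_nonneg _
  have hle : ∑ i, (6 * √((G i).quadVar t ω) + Γ i * 0) ≤ 6 * d * √(vecQuadVar G t ω) := by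
    have : ∀ i ∈ Finset.univ, 6 * √((G i).quadVar t ω) + Γ i * 0 ≤ 6 * √(vecQuadVar G t ω) := by
      intro i _
      have : √((G i).quadVar t ω) ≤ √(vecQuadVar G t ω) := Real.sqrt_le_sqrt
        (Finset.single_le_sum (fun j _ => hq0 j) (Finset.mem_univ i) :
          (G i).quadVar t ω ≤ vecQuadVar G t ω)
      linarith
    refine (Finset.sum_le_sum this).trans (le_of_eq ?_)
    simp
    ring
  have h2 := hlim.eventually_lt_const (lt_of_le_of_lt hle (lt_add_of_pos_right _ (half_pos hδ)))
  filter_upwards [h1, h2] with n hn1 hn2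
  have h3 : ∑ i, |(G i).integral s ω| ≤
      ∑ i, (6 * √((G i).stepSq n t ω) + Γ i * (2⁻¹ : ℝ) ^ n) + ∑ i, (G i).bdgGain n t ω := by
    rw [← Finset.sum_add_distrib]
    exact Finset.sum_le_sum fun i _ => (hΓ i n t s hst).trans (by linarith)
  have h4 := mul_le_mul_of_nonneg_left hn1.le (show (0 : ℝ) ≤ 6 * d by positivity)
  have h5 : 6 * d * η ≤ δ / 2 := by
    rw [hη', ← mul_div_assoc, div_le_iff₀ (by positivity)]
    nlinarith
  simp only [hedge]
  linarith

/-- Every price from which `√|[(G·S)]|` can be superhedged yields one for the running maximum. The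
surplus `ε` keeps the wealth away from zero at each fixed time. -/
theorem outerExpectation_runningMax_le {A : Set (PricePath d T)} (hA : IsTypical A)
    (ha : 0 < a) (hH : ∀ n, (H n).Admissible a)
    (hHA : ∀ ω ∈ A, ∀ t : Time T, ((√(vecQuadVar G t ω) : ℝ) : EReal) ≤
      liminf (fun n => ((a + (H n).integral t ω : ℝ) : EReal)) atTop) {ε : ℝ} (hε : 0 < ε) :
    outerExpectation (runningMax (vecIntegral G)) ≤ ENNReal.ofReal (6 * d * a + ε) := by
  set x : ℝ := 6 * d * a + ε with hx
  have hx0 : 0 < x := by positivity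
  let V := hedge G H
  have hV : ∀ n, IsGain (V n) := isGain_hedge
  -- paths along which the wealth `x + V n` reaches zero infinitely often, although it should not
  let N : Set (PricePath d T) := {ω | (∃ b : ℝ, ∀ n t, -b ≤ V n t ω) ∧
    (∀ t, ∃ n₀, ∀ n, n₀ ≤ n → ε / 2 < x + V n t ω) ∧ ∀ N, ∃ n, N ≤ n ∧ ∃ t, x + V n t ω ≤ 0}
  let E : Set (PricePath d T) := (Aᶜ ∪ {ω | ∃ i, ¬ (G i).IsRegular ω}) ∪ N
  have hE : vovkOuterMeasure E = 0 := vovkOuterMeasure_union_null (vovkOuterMeasure_union_null hA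
    (vovkOuterMeasure_exists_null fun i => (G i).vovkOuterMeasure_not_isRegular))
    (vovkOuterMeasure_infinitely_many_drops hV x (half_pos hε))
  -- the wealth is kept nonnegative by stopping at its first zero
  let σ : ℕ → PricePath d T → WithTop (Time T) := fun n ω =>
    hitAfter ((⊥ : Time T) : WithTop (Time T)) fun t => -(x + V n t ω)
  have hW : ∀ n, IsContAdapted fun t ω => -(x + V n t ω) := fun n =>
    ((IsContAdapted.const x).add (hV n).isContAdapted).neg
  have hσ : ∀ n, IsStoppingTime (natFiltration d T) (σ n) := fun n =>
    isStoppingTime_hitAfter (hW n) (isStoppingTime_const _ _)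
  choose K hK using fun n => (hV n).stopAt (hσ n)
  refine iInf₂_le_of_le Eᶜ (by rwa [IsTypical, compl_compl]) (sInf_le ⟨x, ⟨hx0, K, ?_, ?_⟩, rfl⟩)
  · intro n ω t
    have h0 : -(x + V n ⊥ ω) < 0 := by
      rw [(hV n).apply_bot]
      linarith
    have := hitAfter_nonpos ((hW n).continuous ω) h0 t
    rw [hK]
    simp only [σ]
    linarith
  · intro ω hω τ _
    simp only [E, Set.mem_compl_iff, Set.mem_union, not_or, not_not, Set.mem_ofPred_eq,
      not_exists] at hω
    obtain ⟨⟨hωA, hreg⟩, hN⟩ := hω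
    have hlow : ∀ t s, s ≤ t →
        ∀ᶠ n in atTop, ∑ i, |(G i).integral s ω| + ε / 2 + ε / 4 ≤ x + V n t ω := by
      intro t s hst
      filter_upwards [eventually_le_hedge hreg hst (hHA ω hωA t)
        (show (0 : ℝ) < ε / 4 by positivity)] with n hn
      simp only [V, hx]
      linarith
    have hpos : ∃ N, ∀ n, N ≤ n → ∀ t, 0 < x + V n t ω := by
      by_contra! h
      refine hN ⟨exists_forall_neg_le_hedge hH hreg, fun t => ?_, h⟩
      obtain ⟨n₀, hn₀⟩ := eventually_atTop.1 (hlow t t le_rfl)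
      refine ⟨n₀, fun n hn => lt_of_lt_of_le ?_ (hn₀ n hn)⟩
      have : 0 ≤ ∑ i, |(G i).integral t ω| := Finset.sum_nonneg fun i _ => abs_nonneg _
      linarith
    obtain ⟨N, hN⟩ := hpos
    have hKV : ∀ n, N ≤ n → ∀ t, (K n).integral t ω = V n t ω := by
      intro n hn t
      have : σ n ω = ⊤ := by
        by_contra h
        obtain ⟨u, hu⟩ := exists_coe_eq_of_ne_top h
        have := nonneg_of_hitAfter_eq ((hW n).continuous ω) hu
        linarith [hN n hn u]
      simp only [hK, this, minTime_top]
    have key : ∀ s ≤ τ ω, (‖vecIntegral G s ω‖ₑ : EReal) ≤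
        liminf (fun n => ((x + (K n).integral (τ ω) ω : ℝ) : EReal)) atTop := by
      intro s hs
      refine le_liminf_of_le (by isBoundedDefault) ?_
      filter_upwards [hlow _ s hs, eventually_ge_atTop N] with n hn hnN
      rw [hKV n hnN, ← ofReal_norm, EReal.coe_ennreal_ofReal, max_eq_left (norm_nonneg _)]
      exact EReal.coe_le_coe_iff.2 ((norm_vecIntegral_le G s ω).trans (by linarith))
    have hnonneg := (EReal.coe_ennreal_nonneg _).trans (key (τ ω) le_rfl)
    rw [← EReal.coe_toENNReal hnonneg, EReal.coe_ennreal_le_coe_ennreal_iff]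
    refine iSup₂_le fun s hs => ?_
    rw [← EReal.coe_ennreal_le_coe_ennreal_iff, EReal.coe_toENNReal hnonneg]
    exact key s hs

end Superhedging

end PricePathBDG

end

open PricePathBDG in
theorem proposition3p2 :
    ∃ c₁ : ℝ, 0 < c₁ ∧ c₁ ≤ 6 ∧
      ∀ (d : ℕ) (_ : 1 ≤ d) (T : ℝ) [Fact (0 < T)] (G : Fin d → SimpleStrategy d T),
        (∀ i, (G i).MemH) →
        outerExpectation (runningMax (vecIntegral G)) ≤
          ENNReal.ofReal c₁ * (d : ENNReal) *
            outerExpectation (fun t ω => ENNReal.ofReal (√(vecQuadVar G t ω))) := by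
  refine ⟨6, by norm_num, le_rfl, fun d hd T _ G _ => ?_⟩
  have hC : ENNReal.ofReal 6 * (d : ENNReal) = ENNReal.ofReal (6 * d) := by
    rw [ENNReal.ofReal_mul (by norm_num), ENNReal.ofReal_natCast]
  have hd' : (0 : ℝ) < 6 * d := by
    have : (0 : ℝ) < d := by exact_mod_cast hd
    positivity
  have hC0 : ENNReal.ofReal (6 * d) ≠ 0 := (ENNReal.ofReal_pos.2 hd').ne'
  rw [hC, ← ENNReal.div_le_iff' hC0 ENNReal.ofReal_ne_top]
  refine le_iInf₂ fun A hA => le_sInf ?_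
  rintro _ ⟨a, ⟨ha, H, hH, hHA⟩, rfl⟩
  rw [ENNReal.div_le_iff' hC0 ENNReal.ofReal_ne_top, ← ENNReal.ofReal_mul hd'.le]
  refine ENNReal.le_of_forall_pos_le_add fun ε hε _ => ?_
  rw [← ENNReal.ofReal_coe_nnreal, ← ENNReal.ofReal_add (mul_pos hd' ha).le ε.coe_nonneg]
  refine outerExpectation_runningMax_le hA ha hH (fun ω hω t => ?_) hε
  have := hHA ω hω (fun _ => t) (isStoppingTime_const _ t)
  rwa [EReal.coe_ennreal_ofReal, max_eq_left (Real.sqrt_nonneg _)] at this
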